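/- **Definitions.** Links are considered in $S^3$ up to isotopy. A *marked link* is a link $L$ with a function $\omega$ assigning an element of $\mathbb{Z}/2$ to each component, pictured as dots on the components counted modulo $2$; it is a *two-fold marked link* if the total number of dots is even, and an *odd-marked link* if it is odd. A diagram of $(L,\omega)$ is a diagram of $L$ with dots on its arcs such that the number of dots on each component $K$ is $\omega(K)$ modulo $2$; a smoothing of a crossing carries the dots along. Let $\det(L)=|H_1(\Sigma(L);\mathbb{Z})|$, where $\Sigma(L)$ is the double cover of $S^3$ branched over $L$ (and $\det(L)=0$ if this group is infinite). Let $\mathcal{Q}_2$ be the smallest set of two-fold marked links such that 1. the unknot with trivial marking is in $\mathcal{Q}_2$; 2. every two-fold marked link that splits into two odd-marked links is in $\mathcal{Q}_2$; 3. if $(L,\omega)$ has a dotted diagram whose two smoothings at some crossing represent $(L_0,\omega_0),(L_1,\omega_1)\in\mathcal{Q}_2$ with $\det(L)=\det(L_0)+\det(L_1)$, then $(L,\omega)\in\mathcal{Q}_2$. A link $L$ is *two-fold quasi-alternating (TQA)* if $L$ with the trivial marking is in $\mathcal{Q}_2$. For $e\in\mathbb{Z}$ and nonzero rational numbers $t_1,\dots,t_p$,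 let $M(e;t_1,\dots,t_p)$ be the Montesinos link obtained by joining cyclically a row of $e$ half-twists (crossings, with sign) and the rational tangles of fractions $1/t_1,\dots,1/t_p$. Here fractions are normalised so that they add under the sum of tangles, a row of $n$ crossings has fraction $n$, and a column of $n$ crossings has fraction $1/n$; so $M(0;n_1,\dots,n_p)$ is the pretzel link $P(n_1,\dots,n_p)$ for integers $n_i$. Put $$\varepsilon=e+\sum_{i=1}^p\left\lfloor\frac1{t_i}\right\rfloor .$$ For $t\neq 0$ with $1/t\notin\mathbb{Z}$ let $\hat t=\{1/t\}^{-1}$, where $\{x\}=x-\lfloor x\rfloor$. For $t=\alpha/\beta$ in lowest terms with $\beta>0$ let $t^f=\alpha/(\beta-\alpha)$ if $t>0$ and $t^f=\alpha/(\beta+\alpha)$ if $t<0$ (whenever the denominator is nonzero); $\hat t^f$ means $(\hat t)^f$. **Proposition.** Let $L=M(e;t_1,\dots,t_p)$ be a Montesinos link that is a knot. Then $L$ is TQA if any one of the following conditions holds: * $\varepsilon>-1$ or $\varepsilon<1-p$; * $\varepsilon=-1$ and $|\hat t_i^f|\ge \hat t_j$ for some $i\ne j$ with $1/t_i,1/t_j\notin\mathbb{Z}$;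 * $\varepsilon=1-p$ and $|\hat t_i^f|\le \hat t_j$ for some $i\neq j$ with $1/t_i,1/t_j\notin\mathbb{Z}$. -/

import Mathlib

/-!
Link diagrams with dots are presented in sliced form: a generic planar diagram is cut by
horizontal lines into slices, each containing one elementary piece, and is recorded as the list of
its slices from top to bottom.  Two such diagrams represent the same (dotted) link exactly when
they are related by the moves listed in `LocalMove`.
-/

namespace TwoFold

/-- The elementary pieces of a diagram, read from top to bottom.
`cap` is a local maximum (it creates two adjacent strands), `cup` is a local minimum (it joins two
adjacent strands), `crossOver` is the crossing whose strand from upper left to lower right passes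
over, `crossUnder` is the crossing whose strand from upper left to lower right passes under, and `dot` is a
dot on a vertical strand. -/
inductive Piece
  | cap
  | cup
  | crossOver
  | crossUnder
  | dot

namespace Piece

/-- Number of strands entering a piece from above. -/
def ins : Piece → ℕ
  | cap => 0
  | cup => 2
  | crossOver => 2
  | crossUnder => 2
  | dot => 1

/-- Number of strands leaving a piece below. -/
def outs : Piece → ℕ
  | cap => 2
  | cup => 0
  | crossOver => 2
  | crossUnder => 2
  | dot => 1

/-- The number of dots on a piece. -/
def dots : Piece → ℕ
  | dot => 1
  | _ => 0

end Piece

/-- One slice of a diagram: a piece with `pos` vertical strands to its left (and any number of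
vertical strands to its right). -/
structure Slice where
  piece : Piece
  pos : ℕ

open Piece

/-- The crossing pieces, by sign: `xing true` is `crossOver` and `xing false` is `crossUnder`. -/
def xing : Bool → Piece
  | true => crossOver
  | false => crossUnder

/-- `Runs n w m`: the list of slices `w` is a well-formed tangle diagram with `n` endpoints at the
top and `m` endpoints at the bottom. -/
def Runs : ℕ → List Slice → ℕ → Prop
  | n, [], m => n = m
  | n, s :: w, m => s.pos + s.piece.ins ≤ n ∧ Runs (n - s.piece.ins + s.piece.outs) w m

/-- The number of strands below the slices of `w`, when there are `n` strands above them. -/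
def strandsAfter : ℕ → List Slice → ℕ
  | n, [] => n
  | n, s :: w => strandsAfter (n - s.piece.ins + s.piece.outs) w

/-- The tangle diagram `w` moved to the right by `k` strands. -/
def shift (k : ℕ) (w : List Slice) : List Slice :=
  w.map fun s => ⟨s.piece, k + s.pos⟩

/-- The total number of dots. -/
def dotCount (w : List Slice) : ℕ :=
  (w.map fun s => s.piece.dots).sum

theorem Runs.append {u v : List Slice} {n k m : ℕ} (hu : Runs n u k) (hv : Runs k v m) :
    Runs n (u ++ v) m := by
  induction u generalizing n with
  | nil => cases hu; exact hv
  | cons s u ih => exact ⟨hu.1, ih hu.2⟩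

theorem Runs.shift {w : List Slice} {n m : ℕ} (h : Runs n w m) (k : ℕ) :
    Runs (k + n) (shift k w) (k + m) := by
  induction w generalizing n with
  | nil => cases h; exact rfl
  | cons s w ih =>
    obtain ⟨h1, h2⟩ := h
    refine ⟨?_, ?_⟩
    · simp only; omega
    · have := ih h2
      have e : k + n - s.piece.ins + s.piece.outs = k + (n - s.piece.ins + s.piece.outs) := by
        omega
      rw [← e] at this
      exact this

theorem Runs.addRight {w : List Slice} {n m : ℕ} (h : Runs n w m) (k : ℕ) :
    Runs (n + k) w (m + k) := by
  induction w generalizing n with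
  | nil => cases h; exact rfl
  | cons s w ih =>
    obtain ⟨h1, h2⟩ := h
    refine ⟨by omega, ?_⟩
    have := ih h2
    have e : n + k - s.piece.ins + s.piece.outs = n - s.piece.ins + s.piece.outs + k := by
      omega
    simpa only [e] using this

/-- A closed dotted link diagram. -/
structure Diagram where
  word : List Slice
  closed : Runs 0 word 0

/-- The local moves: planar isotopies (`comm`, `zigzag`, `zagzig`, and the passages of a crossing
past an extremum), the three Reidemeister moves, sliding a dot along a strand of the link through
every kind of piece, and cancelling two dots on the same strand. -/
inductive LocalMove : List Slice → List Slice → Prop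
  | comm (g h : Piece) (i k : ℕ) :
      LocalMove [⟨g, i⟩, ⟨h, i + g.outs + k⟩] [⟨h, i + g.ins + k⟩, ⟨g, i⟩]
  | zigzag (i : ℕ) : LocalMove [⟨cap, i + 1⟩, ⟨cup, i⟩] []
  | zagzig (i : ℕ) : LocalMove [⟨cap, i⟩, ⟨cup, i + 1⟩] []
  | capSlide (s : Bool) (i : ℕ) :
      LocalMove [⟨cap, i⟩, ⟨xing s, i + 1⟩] [⟨cap, i + 1⟩, ⟨xing (!s), i⟩]
  | cupSlide (s : Bool) (i : ℕ) :
      LocalMove [⟨xing s, i + 1⟩, ⟨cup, i⟩] [⟨xing (!s), i⟩, ⟨cup, i + 1⟩]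
  | reidemeisterOneCap (s : Bool) (i : ℕ) : LocalMove [⟨cap, i⟩, ⟨xing s, i⟩] [⟨cap, i⟩]
  | reidemeisterOneCup (s : Bool) (i : ℕ) : LocalMove [⟨xing s, i⟩, ⟨cup, i⟩] [⟨cup, i⟩]
  | reidemeisterTwo (s : Bool) (i : ℕ) : LocalMove [⟨xing s, i⟩, ⟨xing (!s), i⟩] []
  | reidemeisterThree (s : Bool) (i : ℕ) :
      LocalMove [⟨xing s, i⟩, ⟨xing s, i + 1⟩, ⟨xing s, i⟩]
        [⟨xing s, i + 1⟩, ⟨xing s, i⟩, ⟨xing s, i + 1⟩]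
  | dotCap (i : ℕ) : LocalMove [⟨cap, i⟩, ⟨dot, i⟩] [⟨cap, i⟩, ⟨dot, i + 1⟩]
  | dotCup (i : ℕ) : LocalMove [⟨dot, i⟩, ⟨cup, i⟩] [⟨dot, i + 1⟩, ⟨cup, i⟩]
  | dotLeft (s : Bool) (i : ℕ) : LocalMove [⟨dot, i⟩, ⟨xing s, i⟩] [⟨xing s, i⟩, ⟨dot, i + 1⟩]
  | dotRight (s : Bool) (i : ℕ) : LocalMove [⟨dot, i + 1⟩, ⟨xing s, i⟩] [⟨xing s, i⟩, ⟨dot, i⟩]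
  | dotCancel (i : ℕ) : LocalMove [⟨dot, i⟩, ⟨dot, i⟩] []

/-- Two closed diagrams that differ by one local move. -/
def Diagram.Move (D D' : Diagram) : Prop :=
  ∃ a l r b, LocalMove l r ∧ D.word = a ++ l ++ b ∧ D'.word = a ++ r ++ b

/-- Links with a marking of each component by an element of `ℤ/2` (the parity of the number of
dots on it), up to isotopy.  The parity of the total number of dots is invariant: the marking is
two-fold marking data if it is even, and the link is odd-marked if it is odd. -/
def MarkedLink : Type := Quot Diagram.Move

/-- The marked link represented by a dotted diagram. -/
def Diagram.link (D : Diagram) : MarkedLink := Quot.mk _ D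

/-- The disjoint union of two diagrams, one above the other; the two parts are separated by a
horizontal line of the plane. -/
def Diagram.disjointUnion (D E : Diagram) : Diagram :=
  ⟨D.word ++ E.word, D.closed.append E.closed⟩

/-- The crossingless diagram of the unknot, without dots. -/
def unknot : Diagram :=
  ⟨[⟨cap, 0⟩, ⟨cup, 0⟩], by simp [Runs, Piece.ins, Piece.outs]⟩

/-! ### Components and the determinant -/

/-- The points in which the strands of a diagram meet the horizontal lines between the slices:
`(k, j)` is the `j`-th point (from the left, starting from `0`) on the line below the first `k`
slices. -/
def Diagram.Node (D : Diagram) : Type :=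
  {x : ℕ × ℕ // x.2 < strandsAfter 0 (D.word.take x.1)}

/-- Consecutive points that are joined by a piece of strand which does not pass under a
crossing. -/
inductive Joined (w : List Slice) : ℕ × ℕ → ℕ × ℕ → Prop
  | left {k : ℕ} {g : Piece} {i j : ℕ} (h : w[k]? = some ⟨g, i⟩) (hj : j < i) :
      Joined w (k, j) (k + 1, j)
  | right {k : ℕ} {g : Piece} {i : ℕ} (j : ℕ) (h : w[k]? = some ⟨g, i⟩) :
      Joined w (k, i + g.ins + j) (k + 1, i + g.outs + j)
  | cap {k i : ℕ} (h : w[k]? = some ⟨Piece.cap, i⟩) : Joined w (k + 1, i) (k + 1, i + 1)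
  | cup {k i : ℕ} (h : w[k]? = some ⟨Piece.cup, i⟩) : Joined w (k, i) (k, i + 1)
  | dot {k i : ℕ} (h : w[k]? = some ⟨Piece.dot, i⟩) : Joined w (k, i) (k + 1, i)
  | crossOver {k i : ℕ} (h : w[k]? = some ⟨Piece.crossOver, i⟩) : Joined w (k, i) (k + 1, i + 1)
  | crossUnder {k i : ℕ} (h : w[k]? = some ⟨Piece.crossUnder, i⟩) : Joined w (k, i + 1) (k + 1, i)

/-- `PassesUnder w a o b`: at some crossing the lower strand runs from `a` to `b`, and `o` is a
point on the upper strand. -/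
inductive PassesUnder (w : List Slice) : ℕ × ℕ → ℕ × ℕ → ℕ × ℕ → Prop
  | crossOver {k i : ℕ} (h : w[k]? = some ⟨Piece.crossOver, i⟩) :
      PassesUnder w (k, i + 1) (k, i) (k + 1, i)
  | crossUnder {k i : ℕ} (h : w[k]? = some ⟨Piece.crossUnder, i⟩) :
      PassesUnder w (k, i) (k, i + 1) (k + 1, i + 1)

/-- The components of the link represented by a diagram. -/
def Diagram.Component (D : Diagram) : Type :=
  Quot fun a b : D.Node =>
    Joined D.word a.1 b.1 ∨ ∃ o : D.Node, PassesUnder D.word a.1 o.1 b.1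

/-- The diagram represents a knot, i.e. a link with exactly one component. -/
def Diagram.IsKnot (D : Diagram) : Prop := Nat.card D.Component = 1

/-- The Fox colouring relations: the colour is constant along each arc, and at each crossing the
colours of the two lower arcs add up to twice the colour of the upper arc. -/
noncomputable def Diagram.colouringRelations (D : Diagram) : Set (D.Node →₀ ℤ) :=
  {x | (∃ a b : D.Node, Joined D.word a.1 b.1 ∧
          x = Finsupp.single a 1 - Finsupp.single b 1) ∨
       (∃ a o b : D.Node, PassesUnder D.word a.1 o.1 b.1 ∧
          x = Finsupp.single a 1 + Finsupp.single b 1 - 2 • Finsupp.single o 1)}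

/-- The Fox colouring group: one generator for each point, subject to the colouring relations.
For a nonempty link it is the direct sum of `ℤ` and `H₁` of the double branched cover. -/
abbrev Diagram.ColouringGroup (D : Diagram) : Type :=
  (D.Node →₀ ℤ) ⧸ Submodule.span ℤ D.colouringRelations

/-- The subgroup of the colouring group generated by the differences of colours of points; it is
isomorphic to the first homology of the double cover of `S³` branched over the link. -/
noncomputable def Diagram.reducedColouringGroup (D : Diagram) : Submodule ℤ D.ColouringGroup :=
  Submodule.span ℤ (Set.range fun q : D.Node × D.Node =>
    Submodule.Quotient.mk (Finsupp.single q.1 1 - Finsupp.single q.2 1))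

/-- The determinant of the link: the order of the first homology of its double branched cover,
and `0` if that group is infinite. -/
noncomputable def Diagram.det (D : Diagram) : ℕ := Nat.card D.reducedColouringGroup

/-! ### Two-fold quasi-alternating links -/

/-- The smallest set of marked links that contains the unmarked unknot and all links that split
into two odd-marked links, and contains the link of a dotted diagram `D` whenever it contains the
links of the two smoothings of `D` at some crossing and the determinants add up.  Every member has
an even total number of dots. -/
inductive IsTQA : MarkedLink → Prop
  | unknot : IsTQA unknot.link
  | split (D E : Diagram) (hD : Odd (dotCount D.word)) (hE : Odd (dotCount E.word)) :
      IsTQA (D.disjointUnion E).link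
  | resolve (a b : List Slice) (s : Bool) (i : ℕ) (D D₀ D₁ : Diagram)
      (hD : D.word = a ++ [⟨xing s, i⟩] ++ b)
      (h₀ : D₀.word = a ++ b)
      (h₁ : D₁.word = a ++ [⟨cup, i⟩, ⟨cap, i⟩] ++ b)
      (hdet : D.det = D₀.det + D₁.det)
      (ht₀ : IsTQA D₀.link) (ht₁ : IsTQA D₁.link) : IsTQA D.link

/-- The (unmarked) link represented by a diagram is TQA: the diagram carries no dots, and the link
with its trivial marking is TQA. -/
def Diagram.IsTQALink (D : Diagram) : Prop := dotCount D.word = 0 ∧ IsTQA D.link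

/-! ### Montesinos links

Rational tangles have two endpoints at the top and two at the bottom.  The fraction is normalised
so that a row of `n` crossings side by side has fraction `n`, a column of `n` crossings has
fraction `1 / n`, and the fraction is additive for the tangle sum. -/

/-- A column of `|n|` crossings of the same sign as `n`. -/
def column (n : ℤ) : List Slice :=
  List.replicate n.natAbs ⟨xing (decide (0 ≤ n)), 0⟩

/-- The sum of two tangles: they are placed side by side, and the adjacent pairs of endpoints at
the top and at the bottom are joined. -/
def tangleSum (T S : List Slice) : List Slice :=
  [⟨cap, 1⟩] ++ T ++ shift 2 S ++ [⟨cup, 1⟩]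

/-- The tangle of fraction `0`, consisting of two horizontal arcs. -/
def zeroTangle : List Slice := [⟨cup, 0⟩, ⟨cap, 0⟩]

/-- A row of `m` crossings of sign `s`, closed off by the tangle `T` on the right. -/
def addCrossings (s : Bool) : ℕ → List Slice → List Slice
  | 0, T => T
  | m + 1, T => tangleSum [⟨xing s, 0⟩] (addCrossings s m T)

/-- A row of `|n|` crossings of the same sign as `n`, followed by the tangle `T` on the right. -/
def addRow (n : ℤ) (T : List Slice) : List Slice :=
  addCrossings (decide (0 ≤ n)) n.natAbs T

/-- The rational tangle of a continued fraction `a₁ + 1/(a₂ + 1/(a₃ + ⋯))`, built alternately from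
rows and columns of crossings: it has fraction `[a₁, a₂, …]` if `horizontal` is true, and
the inverse of `[a₁, a₂, …]` otherwise.  The empty continued fraction has the value `∞`. -/
def contFracTangle : (horizontal : Bool) → List ℤ → List Slice
  | true, [] => []
  | false, [] => zeroTangle
  | true, a :: l => addRow a (contFracTangle false l)
  | false, a :: l => column a ++ contFracTangle true l

/-- The regular continued fraction of `a / b` (by the Euclidean algorithm). -/
def contFrac : ℤ → ℕ → List ℤ
  | _, 0 => []
  | a, b + 1 => a / ((b + 1 : ℕ) : ℤ) :: contFrac ((b + 1 : ℕ) : ℤ) (a % ((b + 1 : ℕ) : ℤ)).toNat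
  termination_by _ b => b
  decreasing_by
    have h1 := Int.emod_lt_of_pos a (show (0 : ℤ) < ((b + 1 : ℕ) : ℤ) by positivity)
    have h2 := Int.emod_nonneg a (show ((b + 1 : ℕ) : ℤ) ≠ 0 by positivity)
    omega

/-- The rational tangle with parameter `t = α / β ≠ 0` in a Montesinos link; it has fraction
`1 / t = β / α`, so an integer `t = n` gives a column of `n` crossings up to isotopy, as in a
pretzel link. -/
def rationalTangle (t : ℚ) : List Slice := contFracTangle true (contFrac t⁻¹.num t⁻¹.den)

/-- The sum of finitely many tangles. -/
def tangleSums (l : List (List Slice)) : List Slice := l.foldr tangleSum zeroTangle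

theorem runs_xing (s : Bool) : Runs 2 [⟨xing s, 0⟩] 2 := by
  cases s <;> simp [Runs, xing, Piece.ins, Piece.outs]

theorem runs_zeroTangle : Runs 2 zeroTangle 2 := by
  simp [Runs, zeroTangle, Piece.ins, Piece.outs]

theorem runs_tangleSum {T S : List Slice} (hT : Runs 2 T 2) (hS : Runs 2 S 2) :
    Runs 2 (tangleSum T S) 2 := by
  have h1 : Runs 2 [⟨cap, 1⟩] 4 := by simp [Runs, Piece.ins, Piece.outs]
  have h2 : Runs 4 [⟨cup, 1⟩] 2 := by simp [Runs, Piece.ins, Piece.outs]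
  exact ((h1.append (hT.addRight 2)).append (hS.shift 2)).append h2

theorem runs_column (n : ℤ) : Runs 2 (column n) 2 := by
  unfold column
  induction n.natAbs with
  | zero => exact rfl
  | succ m ih =>
    rw [List.replicate_succ]
    exact (runs_xing _).append ih

theorem runs_addCrossings (s : Bool) (m : ℕ) {T : List Slice} (hT : Runs 2 T 2) :
    Runs 2 (addCrossings s m T) 2 := by
  induction m with
  | zero => exact hT
  | succ m ih => exact runs_tangleSum (runs_xing s) ih

theorem runs_contFracTangle (h : Bool) (l : List ℤ) : Runs 2 (contFracTangle h l) 2 := by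
  induction l generalizing h with
  | nil =>
    cases h
    · exact runs_zeroTangle
    · exact rfl
  | cons a l ih =>
    cases h
    · exact (runs_column a).append (ih true)
    · exact runs_addCrossings _ _ (ih false)

theorem runs_tangleSums (l : List (List Slice)) (h : ∀ T ∈ l, Runs 2 T 2) :
    Runs 2 (tangleSums l) 2 := by
  induction l with
  | nil => exact runs_zeroTangle
  | cons T l ih =>
    exact runs_tangleSum (h T (by simp)) (ih fun S hS => h S (by simp [hS]))

/-- The standard diagram of the Montesinos link `M(e; t₁, …, t_p)`: a row of `e` crossings and the
rational tangles with parameters `t₁, …, t_p` are added up from left to right, the two upper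
endpoints of the sum are joined above it, and the two lower endpoints below it. -/
def montesinos (e : ℤ) {p : ℕ} (t : Fin p → ℚ) : Diagram where
  word := [⟨cap, 0⟩] ++
    addRow e (tangleSums (List.ofFn fun i => rationalTangle (t i))) ++ [⟨cup, 0⟩]
  closed := by
    have h1 : Runs 0 [⟨cap, 0⟩] 2 := by simp [Runs, Piece.ins, Piece.outs]
    have h2 : Runs 2 [⟨cup, 0⟩] 0 := by simp [Runs, Piece.ins, Piece.outs]
    refine (h1.append (runs_addCrossings _ _ (runs_tangleSums _ ?_))).append h2
    intro T hT
    obtain ⟨i, rfl⟩ := (List.mem_ofFn' _ _).1 hT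
    exact runs_contFracTangle _ _

/-- `ε = e + ∑ ⌊1 / tᵢ⌋`. -/
def epsilon (e : ℤ) {p : ℕ} (t : Fin p → ℚ) : ℤ := e + ∑ i, ⌊(t i)⁻¹⌋

/-- `t̂ = {1 / t}⁻¹`, which is meaningful if `1 / t` is not an integer. -/
def hat (t : ℚ) : ℚ := (Int.fract t⁻¹)⁻¹

/-- For `t = α / β` in lowest terms with `β > 0`: `tᶠ = α / (β - α)` if `t > 0`, and
`tᶠ = α / (β + α)` if `t < 0`. -/
def flypeParam (t : ℚ) : ℚ :=
  if 0 < t then (t.num : ℚ) / ((t.den : ℚ) - t.num) else (t.num : ℚ) / ((t.den : ℚ) + t.num)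

end TwoFold

open TwoFold

/-! The link is the closure of a sum of tangles. A crossing commutes, under tangle sum, with every
rational tangle built from crossings of one sign (a flype), so the integral parts of the fractions
`1/t_i` can be collected into one row. What remains is the closure of a row of `ε` crossings plus
tangles whose fractions are the nonzero fractional parts `x_i = {1/t_i}`, all strictly between `0`
and `1`.

Determinants are computed by counting Fox colourings with values in `ℂˣ`. If a diagram has a hole
filled by a rational tangle of fraction `n/d`, the determinant of the closure is `|N₁ n + N₂ d|` for
constants `N₁`, `N₂`. Smoothing a crossing of sign `s` in the hole gives determinants `|N₁|` and
`|N₂|`, and these add up exactly when `s N₁ N₂ ≥ 0`. Hence a link with such a tangle of sign `s` in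
the hole is TQA once the links with `0` and with `∞` in the hole are (`IsContext.isTQA_of_pos`). For
a tangle of fraction in `(0,1)` this amounts to deleting it or replacing it by one crossing, and it
is allowed as long as the other fractions have nonnegative sum (`Resolvable.isTQA_closure`).

For `ε ≥ 0` everything is positive and the resolution ends at two-bridge links. Writing each `x_i`
as `1 - (1 - x_i)` mirrors this to `ε ≤ -p`.

For `ε = -1` the inequality on parameters says `x_i + x_j ≥ 1`. Resolving the other tangles leaves
`-1 + x_i + x_j` plus some further positive crossings. If this value is positive, a simultaneous
Euclidean algorithm shows that the link is TQA (`isTQA_closure_mul_of_lt`). If it is zero, the link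
is a two-component unlink with determinant `0`, and this is where the marking enters. The original
link is a knot, so two dots placed anywhere on it cancel (`Diagram.IsKnot.isotopic_two_dots`). They
are placed at endpoints of the `i`-th tangle before resolving. Two of the three nontrivial patterns
put one dot on each component of the unlink, which is then split into two odd-marked links
(`exists_isTQA_closure_on_mul`). The case `ε = 1 - p` is the mirror image. -/

namespace TwoFold

open Piece

set_option linter.unusedSimpArgs false

/-! ### Isotopy of tangle diagrams -/

@[simp] theorem ins_cap : cap.ins = 0 := rfl

@[simp] theorem ins_cup : cup.ins = 2 := rfl

@[simp] theorem ins_dot : dot.ins = 1 := rfl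

@[simp] theorem ins_xing (s : Bool) : (xing s).ins = 2 := by cases s <;> rfl

@[simp] theorem outs_cap : cap.outs = 2 := rfl

@[simp] theorem outs_cup : cup.outs = 0 := rfl

@[simp] theorem outs_dot : dot.outs = 1 := rfl

@[simp] theorem outs_xing (s : Bool) : (xing s).outs = 2 := by cases s <;> rfl

theorem runs_append_iff {u v : List Slice} {n m : ℕ} :
    Runs n (u ++ v) m ↔ ∃ k, Runs n u k ∧ Runs k v m := by
  refine ⟨fun h => ?_, fun ⟨k, hu, hv⟩ => hu.append hv⟩
  induction u generalizing n with
  | nil => exact ⟨n, rfl, h⟩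
  | cons s u ih =>
    obtain ⟨k, h1, h2⟩ := ih h.2
    exact ⟨k, ⟨h.1, h1⟩, h2⟩

@[simp] theorem shift_nil (k : ℕ) : shift k [] = [] := rfl

@[simp] theorem shift_cons (k : ℕ) (g : Piece) (i : ℕ) (w : List Slice) :
    shift k (⟨g, i⟩ :: w) = ⟨g, k + i⟩ :: shift k w := rfl

@[simp] theorem shift_append (k : ℕ) (u v : List Slice) :
    shift k (u ++ v) = shift k u ++ shift k v := by simp [shift]

theorem shift_shift (k l : ℕ) (w : List Slice) : shift k (shift l w) = shift (k + l) w := by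
  simp [shift, Function.comp_def, add_assoc]

@[simp] theorem shift_zero (w : List Slice) : shift 0 w = w := by
  simp [shift]

theorem Runs.frame {w : List Slice} {n m : ℕ} (h : Runs n w m) (k r : ℕ) :
    Runs (k + n + r) (TwoFold.shift k w) (k + m + r) := (h.shift k).addRight r

theorem LocalMove.shift {l r : List Slice} (h : LocalMove l r) (k : ℕ) :
    LocalMove (shift k l) (shift k r) := by
  cases h with
  | comm g h i j =>
    have := LocalMove.comm g h (k + i) j
    simpa [shift_cons, add_assoc] using this
  | zigzag i => exact LocalMove.zigzag (k + i)
  | zagzig i => exact LocalMove.zagzig (k + i)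
  | capSlide s i => exact LocalMove.capSlide s (k + i)
  | cupSlide s i => exact LocalMove.cupSlide s (k + i)
  | reidemeisterOneCap s i => exact LocalMove.reidemeisterOneCap s (k + i)
  | reidemeisterOneCup s i => exact LocalMove.reidemeisterOneCup s (k + i)
  | reidemeisterTwo s i => exact LocalMove.reidemeisterTwo s (k + i)
  | reidemeisterThree s i => exact LocalMove.reidemeisterThree s (k + i)
  | dotCap i => exact LocalMove.dotCap (k + i)
  | dotCup i => exact LocalMove.dotCup (k + i)
  | dotLeft s i => exact LocalMove.dotLeft s (k + i)
  | dotRight s i => exact LocalMove.dotRight s (k + i)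
  | dotCancel i => exact LocalMove.dotCancel (k + i)

/-- Two tangle diagrams with `n` upper and `m` lower endpoints that differ by one local move. -/
def WordMove (n m : ℕ) (w w' : List Slice) : Prop :=
  Runs n w m ∧ Runs n w' m ∧
    ∃ a l r b, LocalMove l r ∧ w = a ++ l ++ b ∧ w' = a ++ r ++ b

/-- Isotopy of tangle diagrams with `n` upper and `m` lower endpoints. -/
def Isotopic (n m : ℕ) : List Slice → List Slice → Prop := Relation.EqvGen (WordMove n m)

namespace Isotopic

variable {n m k l : ℕ} {u v w : List Slice}

theorem refl (w : List Slice) : Isotopic n m w w := Relation.EqvGen.refl w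

theorem symm (h : Isotopic n m u v) : Isotopic n m v u := Relation.EqvGen.symm _ _ h

theorem trans (h : Isotopic n m u v) (h' : Isotopic n m v w) : Isotopic n m u w :=
  Relation.EqvGen.trans _ _ _ h h'

theorem of_eq (h : u = v) : Isotopic n m u v := h ▸ refl u

theorem of_move (h : LocalMove u v) (hu : Runs n u m) (hv : Runs n v m) : Isotopic n m u v :=
  Relation.EqvGen.rel _ _ ⟨hu, hv, [], u, v, [], h, by simp, by simp⟩

theorem map {f : List Slice → List Slice}
    (hf : ∀ u v, WordMove n m u v → WordMove k l (f u) (f v)) (h : Isotopic n m u v) :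
    Isotopic k l (f u) (f v) := by
  induction h with
  | rel x y hxy => exact Relation.EqvGen.rel _ _ (hf _ _ hxy)
  | refl x => exact refl _
  | symm x y _ ih => exact ih.symm
  | trans x y z _ _ h1 h2 => exact h1.trans h2

theorem mid (a b : List Slice) (ha : Runs k a n) (hb : Runs m b l) (h : Isotopic n m u v) :
    Isotopic k l (a ++ u ++ b) (a ++ v ++ b) := by
  refine map (f := fun w => a ++ w ++ b) ?_ h
  rintro u v ⟨hu, hv, a', x, y, b', hm, rfl, rfl⟩
  exact ⟨(ha.append hu).append hb, (ha.append hv).append hb, a ++ a', x, y, b' ++ b, hm,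
    by simp, by simp⟩

theorem left (a : List Slice) (ha : Runs k a n) (h : Isotopic n m u v) :
    Isotopic k m (a ++ u) (a ++ v) := by
  simpa using mid a [] ha (rfl : Runs m [] m) h

theorem right (b : List Slice) (hb : Runs m b l) (h : Isotopic n m u v) :
    Isotopic n l (u ++ b) (v ++ b) := by
  simpa using mid [] b (rfl : Runs n [] n) hb h

theorem frame (h : Isotopic n m u v) (k r : ℕ) :
    Isotopic (k + n + r) (k + m + r) (shift k u) (shift k v) := by
  refine map (f := shift k) ?_ h
  rintro u v ⟨hu, hv, a', x, y, b', hm, rfl, rfl⟩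
  exact ⟨hu.frame k r, hv.frame k r, shift k a', shift k x, shift k y, shift k b', hm.shift k,
    by simp, by simp⟩

theorem addRight (h : Isotopic n m u v) (r : ℕ) : Isotopic (n + r) (m + r) u v := by
  simpa using h.frame 0 r

theorem shift (h : Isotopic n m u v) (k : ℕ) :
    Isotopic (k + n) (k + m) (shift k u) (TwoFold.shift k v) := h.frame k 0

/-- Two tangle diagrams side by side can be moved vertically past each other. -/
theorem interchange_singleton (g : Piece) (i : ℕ) {a b : ℕ} (hg : i + g.ins ≤ n)
    (hv : Runs a v b) : Isotopic (n + a) (n - g.ins + g.outs + b)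
      ([⟨g, i⟩] ++ TwoFold.shift (n - g.ins + g.outs) v) (TwoFold.shift n v ++ [⟨g, i⟩]) := by
  induction v generalizing a with
  | nil => exact refl _
  | cons s v ih =>
    obtain ⟨h, j⟩ := s
    obtain ⟨h1, h2⟩ := hv
    simp only at h1 h2
    have e1 : n - g.ins + g.outs + j = i + g.outs + (n - g.ins - i + j) := by omega
    have e2 : n + j = i + g.ins + (n - g.ins - i + j) := by omega
    have hm := LocalMove.comm g h i (n - g.ins - i + j)
    rw [← e1, ← e2] at hm
    have step : Isotopic (n + a) (n - g.ins + g.outs + (a - h.ins + h.outs))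
        [⟨g, i⟩, ⟨h, n - g.ins + g.outs + j⟩] [⟨h, n + j⟩, ⟨g, i⟩] := by
      refine of_move hm ?_ ?_ <;> simp only [Runs] <;> omega
    have s1 := step.right (TwoFold.shift (n - g.ins + g.outs) v) (h2.shift _)
    have s2 := (ih h2).left [⟨h, n + j⟩] (k := n + a) (by simp only [Runs]; omega)
    simpa using s1.trans s2

/-- The slices of `w` pass `v` one at a time. The two shifts differ because `v` stands to the right
of the `n` upper strands of `w` before it, and of its `m` lower strands after it. -/
theorem interchange {a b : ℕ} (hw : Runs n w m) (hv : Runs a v b) :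
    Isotopic (n + a) (m + b) (w ++ TwoFold.shift m v) (TwoFold.shift n v ++ w) := by
  induction w generalizing n with
  | nil => cases hw; simpa using refl _
  | cons s w ih =>
    obtain ⟨g, i⟩ := s
    obtain ⟨h1, h2⟩ := hw
    simp only at h1 h2
    have s1 := (ih h2).left [⟨g, i⟩] (k := n + a) (by simp only [Runs]; omega)
    have s2 := (interchange_singleton g i h1 hv).right w (h2.addRight b)
    simpa using s1.trans (by simpa using s2)

end Isotopic

theorem link_eq_of_isotopic {u v : List Slice} (hu : Runs 0 u 0) (hv : Runs 0 v 0)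
    (h : Isotopic 0 0 u v) : Diagram.link ⟨u, hu⟩ = Diagram.link ⟨v, hv⟩ := by
  -- The equivalence closure runs through arbitrary words, so well-formedness of the intermediate
  -- words has to be carried along with the equality of links.
  have key : ∀ u v, Isotopic 0 0 u v → (Runs 0 u 0 ↔ Runs 0 v 0) ∧
      ∀ hu hv, Diagram.link ⟨u, hu⟩ = Diagram.link ⟨v, hv⟩ := by
    intro u v h
    induction h with
    | rel x y hxy =>
      obtain ⟨hx, hy, a, l, r, b, hm, e1, e2⟩ := hxy
      exact ⟨by simp [hx, hy], fun _ _ => Quot.sound ⟨a, l, r, b, hm, e1, e2⟩⟩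
    | refl x => exact ⟨Iff.rfl, fun _ _ => rfl⟩
    | symm x y _ ih => exact ⟨ih.1.symm, fun h1 h2 => (ih.2 h2 h1).symm⟩
    | trans x y z _ _ h1 h2 =>
      exact ⟨h1.1.trans h2.1, fun hx hz => (h1.2 hx (h1.1.1 hx)).trans (h2.2 _ hz)⟩
  exact (key u v h).2 hu hv

/-! ### Isotopies of tangles with two upper and two lower endpoints -/

theorem isotopic_tangleSum {T T' S S' : List Slice} (hT : Runs 2 T 2) (hS' : Runs 2 S' 2)
    (h : Isotopic 2 2 T T') (h' : Isotopic 2 2 S S') :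
    Isotopic 2 2 (tangleSum T S) (tangleSum T' S') := by
  have c1 : Runs 2 [⟨cap, 1⟩] 4 := by simp [Runs]
  have c2 : Runs 4 [⟨cup, 1⟩] 2 := by simp [Runs]
  have s1 := (h'.shift 2).mid ([⟨cap, 1⟩] ++ T) [⟨cup, 1⟩] (c1.append (hT.addRight 2)) c2
  have s2 := (h.addRight 2).mid [⟨cap, 1⟩] (shift 2 S' ++ [⟨cup, 1⟩]) c1 ((hS'.shift 2).append c2)
  simp only [tangleSum, List.append_assoc] at *
  exact s1.trans s2

/-- The two bracketings differ only in the heights of the connecting caps and cups, so interchanges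
suffice. -/
theorem isotopic_sum_assoc {T S R : List Slice} (hT : Runs 2 T 2) (hS : Runs 2 S 2)
    (hR : Runs 2 R 2) :
    Isotopic 2 2 (tangleSum (tangleSum T S) R) (tangleSum T (tangleSum S R)) := by
  have c1 : Runs 2 [⟨cap, 1⟩, ⟨cap, 1⟩] 6 := by simp [Runs]
  have c2 : Runs 2 [⟨cap, 1⟩] 4 := by simp [Runs]
  have c3 : Runs 4 [⟨cup, 1⟩] 2 := by simp [Runs]
  have c4 : Runs 6 [⟨cup, 3⟩, ⟨cup, 1⟩] 2 := by simp [Runs]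
  have hT6 : Runs 6 T 6 := hT.addRight 4
  have hS6 : Runs 6 (shift 2 S) 6 := (hS.shift 2).addRight 2
  have hR6 : Runs 6 (shift 4 R) 6 := hR.shift 4
  have s1 := (Isotopic.interchange c3 hR).mid ([⟨cap, 1⟩, ⟨cap, 1⟩] ++ T ++ shift 2 S) [⟨cup, 1⟩]
    ((c1.append hT6).append hS6) c3
  have m2 : Isotopic 6 2 [⟨cup, 1⟩, ⟨cup, 1⟩] [⟨cup, 3⟩, ⟨cup, 1⟩] :=
    .of_move (LocalMove.comm cup cup 1 0) (by simp [Runs]) (by simp [Runs])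
  have s2 := m2.left ([⟨cap, 1⟩, ⟨cap, 1⟩] ++ T ++ shift 2 S ++ shift 4 R)
    (((c1.append hT6).append hS6).append hR6)
  have m3 : Isotopic 2 6 [⟨cap, 1⟩, ⟨cap, 3⟩] [⟨cap, 1⟩, ⟨cap, 1⟩] :=
    .of_move (LocalMove.comm cap cap 1 0) (by simp [Runs]) (by simp [Runs])
  have s3 := m3.symm.right (T ++ shift 2 S ++ shift 4 R ++ [⟨cup, 3⟩, ⟨cup, 1⟩])
    (((hT6.append hS6).append hR6).append c4)
  have s4 := (Isotopic.interchange hT c2).symm.mid [⟨cap, 1⟩]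
    (shift 2 S ++ shift 4 R ++ [⟨cup, 3⟩, ⟨cup, 1⟩]) c2 ((hS6.append hR6).append c4)
  simp only [tangleSum, shift_append, shift_cons, shift_nil, shift_shift, List.append_assoc,
    List.cons_append, List.nil_append, Nat.reduceAdd] at *
  exact ((s1.trans s2).trans s3).trans s4

theorem isotopic_sum_zero {T : List Slice} (hT : Runs 2 T 2) :
    Isotopic 2 2 (tangleSum T zeroTangle) T := by
  have c2 : Runs 2 [⟨cap, 1⟩] 4 := by simp [Runs]
  have m1 : Isotopic 2 2 [⟨cap, 2⟩, ⟨cup, 1⟩] [] :=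
    .of_move (LocalMove.zigzag 1) (by simp [Runs]) (by simp [Runs])
  have s1 := m1.left ([⟨cap, 1⟩] ++ T ++ [⟨cup, 2⟩])
    ((c2.append (hT.addRight 2)).append (by simp [Runs]))
  have c0 : Runs 2 [⟨cup, 0⟩] 0 := by simp [Runs]
  have s2 := (Isotopic.interchange hT c0).left [⟨cap, 1⟩] c2
  have m3 : Isotopic 2 2 [⟨cap, 1⟩, ⟨cup, 2⟩] [] :=
    .of_move (LocalMove.zagzig 1) (by simp [Runs]) (by simp [Runs])
  have s3 := m3.right T hT
  simp only [tangleSum, zeroTangle, shift_append, shift_cons, shift_nil, List.append_assoc,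
    List.cons_append, List.nil_append, Nat.reduceAdd, List.append_nil] at *
  exact (s1.trans s2).trans s3

theorem isotopic_zero_sum {T : List Slice} (hT : Runs 2 T 2) :
    Isotopic 2 2 (tangleSum zeroTangle T) T := by
  have m1 : Isotopic 2 2 [⟨cap, 1⟩, ⟨cup, 0⟩] [] :=
    .of_move (LocalMove.zigzag 0) (by simp [Runs]) (by simp [Runs])
  have s1 := m1.right ([⟨cap, 0⟩] ++ shift 2 T ++ [⟨cup, 1⟩])
    (l := 2) (Runs.append (k := 4) (Runs.append (k := 4) (by simp [Runs]) (hT.shift 2))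
      (by simp [Runs]))
  have c0 : Runs 0 [⟨cap, 0⟩] 2 := by simp [Runs]
  have s2 := (Isotopic.interchange c0 hT).right [⟨cup, 1⟩] (l := 2) (by simp [Runs])
  have m3 : Isotopic 2 2 [⟨cap, 0⟩, ⟨cup, 1⟩] [] :=
    .of_move (LocalMove.zagzig 0) (by simp [Runs]) (by simp [Runs])
  have s3 := m3.left T hT
  simp only [tangleSum, zeroTangle, shift_append, shift_cons, shift_nil, List.append_assoc,
    List.cons_append, List.nil_append, Nat.reduceAdd, List.append_nil, shift_zero] at *
  exact (s1.trans s2).trans s3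

/-- Sliding both crossings through the neighbouring extrema turns the row into a column between the
same two strands, where the second Reidemeister move applies. Sliding flips the sign, so opposite
signs cancel. -/
theorem isotopic_xing_sum_xing (s : Bool) :
    Isotopic 2 2 (tangleSum [⟨xing s, 0⟩] [⟨xing !s, 0⟩]) zeroTangle := by
  have m1 : Isotopic 2 4 [⟨cap, 0⟩, ⟨xing !s, 1⟩] [⟨cap, 1⟩, ⟨xing s, 0⟩] := by
    refine .of_move (by simpa using LocalMove.capSlide (!s) 0) ?_ ?_ <;>
      simp [Runs]
  have s1 := m1.symm.right [⟨xing !s, 2⟩, ⟨cup, 1⟩] (l := 2)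
    (by simp [Runs])
  have m2 : Isotopic 4 2 [⟨xing !s, 2⟩, ⟨cup, 1⟩] [⟨xing s, 1⟩, ⟨cup, 2⟩] := by
    refine .of_move (by simpa using LocalMove.cupSlide (!s) 1) ?_ ?_ <;>
      simp [Runs]
  have s2 := m2.left [⟨cap, 0⟩, ⟨xing !s, 1⟩] (k := 2)
    (by simp [Runs])
  have m3 : Isotopic 4 4 [⟨xing !s, 1⟩, ⟨xing s, 1⟩] [] := by
    refine .of_move (by simpa using LocalMove.reidemeisterTwo (!s) 1) ?_ ?_ <;>
      simp [Runs]
  have s3 := m3.mid [⟨cap, 0⟩] [⟨cup, 2⟩] (k := 2) (l := 2) (by simp [Runs])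
    (by simp [Runs])
  have s4 : Isotopic 2 2 [⟨cap, 0⟩, ⟨cup, 2⟩] [⟨cup, 0⟩, ⟨cap, 0⟩] :=
    .of_move (LocalMove.comm cap cup 0 0) (by simp [Runs]) (by simp [Runs])
  simp only [tangleSum, zeroTangle, shift_append, shift_cons, shift_nil, List.append_assoc,
    List.cons_append, List.nil_append, Nat.reduceAdd, List.append_nil] at *
  exact ((s1.trans s2).trans s3).trans s4

/-- A crossing added on the left of a tangle, drawn as a crossing above it. -/
theorem isotopic_xing_sum (s : Bool) {T : List Slice} (hT : Runs 2 T 2) :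
    Isotopic 2 2 (tangleSum [⟨xing s, 0⟩] T)
      ([⟨cap, 0⟩, ⟨xing !s, 1⟩] ++ shift 2 T ++ [⟨cup, 1⟩]) := by
  have m1 : Isotopic 2 4 [⟨cap, 0⟩, ⟨xing !s, 1⟩] [⟨cap, 1⟩, ⟨xing s, 0⟩] := by
    refine .of_move (by simpa using LocalMove.capSlide (!s) 0) ?_ ?_ <;>
      simp [Runs]
  have s1 := m1.symm.right (shift 2 T ++ [⟨cup, 1⟩])
    ((hT.shift 2).append (m := 2) (by simp [Runs]))
  simpa [tangleSum] using s1

/-- A crossing added on the right of a tangle, drawn as a crossing above it. -/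
theorem isotopic_sum_xing (s : Bool) {T : List Slice} (hT : Runs 2 T 2) :
    Isotopic 2 2 (tangleSum T [⟨xing s, 0⟩])
      ([⟨cap, 2⟩, ⟨xing !s, 1⟩] ++ T ++ [⟨cup, 1⟩]) := by
  have s1 := (Isotopic.interchange hT (runs_xing s)).mid [⟨cap, 1⟩] [⟨cup, 1⟩] (k := 2) (l := 2)
    (by simp [Runs]) (by simp [Runs])
  have m1 : Isotopic 2 4 [⟨cap, 1⟩, ⟨xing s, 2⟩] [⟨cap, 2⟩, ⟨xing !s, 1⟩] := by
    refine .of_move (LocalMove.capSlide s 1) ?_ ?_ <;>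
      simp [Runs]
  have s2 := m1.right (T ++ [⟨cup, 1⟩])
    ((hT.addRight 2).append (m := 2) (by simp [Runs]))
  simp only [tangleSum, shift_append, shift_cons, shift_nil, List.append_assoc,
    List.cons_append, List.nil_append, Nat.reduceAdd, List.append_nil] at *
  exact s1.trans s2

/-- Once the crossings on the left are drawn above the tangle, all three lie on three adjacent
strands and the claim is the third Reidemeister move. Drawing them above reverses their sign, hence
the `!s` on the vertical crossings. -/
theorem isotopic_braid_left (s : Bool) {T : List Slice} (hT : Runs 2 T 2) :
    Isotopic 2 2
      (tangleSum [⟨xing s, 0⟩] ([⟨xing !s, 0⟩] ++ tangleSum [⟨xing s, 0⟩] T))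
      ([⟨xing !s, 0⟩] ++ tangleSum [⟨xing s, 0⟩] ([⟨xing !s, 0⟩] ++ T)) := by
  have hL := runs_tangleSum (runs_xing s) hT
  have hB : Runs 2 ([⟨cap, 0⟩, ⟨xing !s, 1⟩] ++ shift 2 T ++ [⟨cup, 1⟩]) 2 :=
    Runs.append (k := 4) (Runs.append (k := 4) (by simp [Runs])
      (hT.shift 2)) (by simp [Runs])
  have s0 := isotopic_xing_sum s ((runs_xing (!s)).append hL)
  have s1 := (((isotopic_xing_sum s hT).left [⟨xing !s, 0⟩] (runs_xing _)).shift 2).mid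
    [⟨cap, 0⟩, ⟨xing !s, 1⟩] [⟨cup, 1⟩] (k := 2) (l := 2)
    (by simp [Runs]) (by simp [Runs])
  -- now `cap 0, x 1, x 2, cap 2, x 3, T@4, cup 3, cup 1`
  have m2 : Isotopic 6 2 [⟨cup, 1⟩, ⟨cup, 1⟩] [⟨cup, 3⟩, ⟨cup, 1⟩] :=
    .of_move (LocalMove.comm cup cup 1 0) (by simp [Runs]) (by simp [Runs])
  have s2 := m2.symm.left ([⟨cap, 0⟩, ⟨xing !s, 1⟩, ⟨xing !s, 2⟩, ⟨cap, 2⟩, ⟨xing !s, 3⟩] ++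
    shift 4 T) (k := 2) (Runs.append (k := 6) (by simp [Runs])
      (hT.shift 4))
  have c4 : Runs 3 [⟨cup, 1⟩] 1 := by simp [Runs]
  have hXT : Runs 3 ([⟨xing !s, 0⟩] ++ shift 1 T) 3 :=
    Runs.append (k := 3) (by simp [Runs]) (hT.shift 1)
  have s3 := (Isotopic.interchange c4 hXT).symm.mid
    [⟨cap, 0⟩, ⟨xing !s, 1⟩, ⟨xing !s, 2⟩, ⟨cap, 2⟩] [⟨cup, 1⟩] (k := 2) (l := 2)
    (by simp [Runs]) (by simp [Runs])
  have m4 : Isotopic 4 4 [⟨cap, 2⟩, ⟨cup, 1⟩] [] :=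
    .of_move (LocalMove.zigzag 1) (by simp [Runs]) (by simp [Runs])
  have s4 := m4.mid [⟨cap, 0⟩, ⟨xing !s, 1⟩, ⟨xing !s, 2⟩]
    ([⟨xing !s, 1⟩] ++ shift 2 T ++ [⟨cup, 1⟩]) (k := 2) (l := 2)
    (by simp [Runs])
    (Runs.append (k := 4) (Runs.append (k := 4) (by simp [Runs])
      (hT.shift 2)) (by simp [Runs]))
  have m5 : Isotopic 4 4 [⟨xing !s, 1⟩, ⟨xing !s, 2⟩, ⟨xing !s, 1⟩]
      [⟨xing !s, 2⟩, ⟨xing !s, 1⟩, ⟨xing !s, 2⟩] := by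
    refine .of_move (LocalMove.reidemeisterThree (!s) 1) ?_ ?_ <;>
      simp [Runs]
  have s5 := m5.mid [⟨cap, 0⟩] (shift 2 T ++ [⟨cup, 1⟩]) (k := 2) (l := 2)
    (by simp [Runs])
    (Runs.append (k := 4) (hT.shift 2) (by simp [Runs]))
  have m6 : Isotopic 2 4 [⟨cap, 0⟩, ⟨xing !s, 2⟩] [⟨xing !s, 0⟩, ⟨cap, 0⟩] := by
    refine .of_move (LocalMove.comm cap (xing !s) 0 0) ?_ ?_ <;>
      simp [Runs]
  have s6 := m6.right ([⟨xing !s, 1⟩, ⟨xing !s, 2⟩] ++ shift 2 T ++ [⟨cup, 1⟩]) (l := 2)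
    (Runs.append (k := 4) (Runs.append (k := 4) (by simp [Runs])
      (hT.shift 2)) (by simp [Runs]))
  have s7 := (isotopic_xing_sum s ((runs_xing (!s)).append hT)).symm.left [⟨xing !s, 0⟩]
    (runs_xing _)
  simp only [shift_append, shift_cons, shift_nil, shift_shift, List.append_assoc,
    List.cons_append, List.nil_append, Nat.reduceAdd, List.append_nil] at *
  exact (((((((s0.trans s1).trans s2).trans s3).trans s4).trans s5).trans s6).trans s7)


theorem isotopic_braid_right (s : Bool) {T : List Slice} (hT : Runs 2 T 2) :
    Isotopic 2 2
      (tangleSum ([⟨xing !s, 0⟩] ++ tangleSum T [⟨xing s, 0⟩]) [⟨xing s, 0⟩])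
      ([⟨xing !s, 0⟩] ++ tangleSum ([⟨xing !s, 0⟩] ++ T) [⟨xing s, 0⟩]) := by
  have hR := runs_tangleSum hT (runs_xing s)
  have s0 := isotopic_sum_xing s ((runs_xing (!s)).append hR)
  have s1 := (((isotopic_sum_xing s hT).left [⟨xing !s, 0⟩] (runs_xing _)).addRight 2).mid
    [⟨cap, 2⟩, ⟨xing !s, 1⟩] [⟨cup, 1⟩] (k := 2) (l := 2) (by simp [Runs]) (by simp [Runs])
  -- now `cap 2, x 1, x 0, cap 2, x 1, T, cup 1, cup 1`
  have m2 : Isotopic 6 2 [⟨cup, 1⟩, ⟨cup, 1⟩] [⟨cup, 3⟩, ⟨cup, 1⟩] :=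
    .of_move (LocalMove.comm cup cup 1 0) (by simp [Runs]) (by simp [Runs])
  have s2 := m2.left ([⟨cap, 2⟩, ⟨xing !s, 1⟩, ⟨xing !s, 0⟩, ⟨cap, 2⟩, ⟨xing !s, 1⟩] ++ T)
    (k := 2) (Runs.append (k := 6) (by simp [Runs]) (hT.addRight 4))
  have c4 : Runs 3 [⟨cup, 0⟩] 1 := by simp [Runs]
  have hXT : Runs 3 ([⟨xing !s, 1⟩] ++ T) 3 :=
    Runs.append (k := 3) (by simp [Runs]) (hT.addRight 1)
  have s3 := (Isotopic.interchange hXT c4).mid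
    [⟨cap, 2⟩, ⟨xing !s, 1⟩, ⟨xing !s, 0⟩, ⟨cap, 2⟩] [⟨cup, 1⟩] (k := 2) (l := 2)
    (by simp [Runs]) (by simp [Runs])
  have m4 : Isotopic 4 4 [⟨cap, 2⟩, ⟨cup, 3⟩] [] :=
    .of_move (LocalMove.zagzig 2) (by simp [Runs]) (by simp [Runs])
  have s4 := m4.mid [⟨cap, 2⟩, ⟨xing !s, 1⟩, ⟨xing !s, 0⟩]
    ([⟨xing !s, 1⟩] ++ T ++ [⟨cup, 1⟩]) (k := 2) (l := 2) (by simp [Runs])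
    (Runs.append (k := 4) (Runs.append (k := 4) (by simp [Runs]) (hT.addRight 2)) (by simp [Runs]))
  have m5 : Isotopic 4 4 [⟨xing !s, 0⟩, ⟨xing !s, 1⟩, ⟨xing !s, 0⟩]
      [⟨xing !s, 1⟩, ⟨xing !s, 0⟩, ⟨xing !s, 1⟩] := by
    refine .of_move (LocalMove.reidemeisterThree (!s) 0) ?_ ?_ <;> simp [Runs]
  have s5 := m5.symm.mid [⟨cap, 2⟩] (T ++ [⟨cup, 1⟩]) (k := 2) (l := 2) (by simp [Runs])
    (Runs.append (k := 4) (hT.addRight 2) (by simp [Runs]))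
  have m6 : Isotopic 2 4 [⟨xing !s, 0⟩, ⟨cap, 2⟩] [⟨cap, 2⟩, ⟨xing !s, 0⟩] := by
    refine .of_move (by simpa using LocalMove.comm (xing !s) cap 0 0) ?_ ?_ <;> simp [Runs]
  have s6 := m6.symm.right ([⟨xing !s, 1⟩, ⟨xing !s, 0⟩] ++ T ++ [⟨cup, 1⟩]) (l := 2)
    (Runs.append (k := 4) (Runs.append (k := 4) (by simp [Runs]) (hT.addRight 2)) (by simp [Runs]))
  have s7 := (isotopic_sum_xing s ((runs_xing (!s)).append hT)).symm.left [⟨xing !s, 0⟩]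
    (runs_xing _)
  simp only [shift_append, shift_cons, shift_nil, shift_shift, List.append_assoc,
    List.cons_append, List.nil_append, Nat.reduceAdd, List.append_nil] at *
  exact (((((((s0.trans s1).trans s2).trans s3).trans s4).trans s5).trans s6).trans s7)

theorem isotopic_xing_sum_infinity (s : Bool) :
    Isotopic 2 2 (tangleSum [⟨xing s, 0⟩] []) [] := by
  have s0 := isotopic_xing_sum s (T := []) rfl
  have m1 : Isotopic 4 2 [⟨xing !s, 1⟩, ⟨cup, 1⟩] [⟨cup, 1⟩] := by
    refine .of_move (LocalMove.reidemeisterOneCup (!s) 1) ?_ ?_ <;> simp [Runs]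
  have s1 := m1.left [⟨cap, 0⟩] (k := 2) (by simp [Runs])
  have m3 : Isotopic 2 2 [⟨cap, 0⟩, ⟨cup, 1⟩] [] :=
    .of_move (LocalMove.zagzig 0) (by simp [Runs]) (by simp [Runs])
  exact (s0.trans s1).trans m3

theorem isotopic_xing_zero (s : Bool) :
    Isotopic 2 2 ([⟨xing s, 0⟩] ++ zeroTangle) zeroTangle := by
  have m1 : Isotopic 2 0 [⟨xing s, 0⟩, ⟨cup, 0⟩] [⟨cup, 0⟩] := by
    refine .of_move (LocalMove.reidemeisterOneCup s 0) ?_ ?_ <;> simp [Runs]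
  exact m1.right [⟨cap, 0⟩] (by simp [Runs])

theorem isotopic_xing_xing (s : Bool) :
    Isotopic 2 2 ([⟨xing s, 0⟩] ++ [⟨xing !s, 0⟩]) [] := by
  refine .of_move (LocalMove.reidemeisterTwo s 0) ?_ ?_ <;> simp [Runs]

/-- In the closure of a sum of two tangles, a crossing above the first one can be moved above the
second one. -/
theorem isotopic_closure_transfer (s : Bool) {A B : List Slice} (hA : Runs 2 A 2)
    (hB : Runs 2 B 2) :
    Isotopic 0 0 ([⟨cap, 0⟩] ++ tangleSum ([⟨xing s, 0⟩] ++ A) B ++ [⟨cup, 0⟩])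
      ([⟨cap, 0⟩] ++ tangleSum A ([⟨xing s, 0⟩] ++ B) ++ [⟨cup, 0⟩]) := by
  have hAB : Runs 4 (A ++ shift 2 B ++ [⟨cup, 1⟩, ⟨cup, 0⟩]) 0 :=
    Runs.append (Runs.append (k := 4) (hA.addRight 2) (hB.shift 2)) (by simp [Runs])
  -- Either crossing twists the two arcs that join the tops of the two tangles; the common
  -- intermediate picture is one crossing in the middle, between these arcs.
  have m1 : Isotopic 2 4 [⟨cap, 0⟩, ⟨xing !s, 1⟩] [⟨cap, 1⟩, ⟨xing s, 0⟩] := by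
    refine .of_move (by simpa using LocalMove.capSlide (!s) 0) ?_ ?_ <;> simp [Runs]
  have s1 := m1.symm.mid [⟨cap, 0⟩] (A ++ shift 2 B ++ [⟨cup, 1⟩, ⟨cup, 0⟩]) (k := 0)
    (by simp [Runs]) hAB
  have m2 : Isotopic 0 4 [⟨cap, 0⟩, ⟨cap, 2⟩] [⟨cap, 0⟩, ⟨cap, 0⟩] :=
    .of_move (LocalMove.comm cap cap 0 0) (by simp [Runs]) (by simp [Runs])
  have s2 := m2.symm.right ([⟨xing !s, 1⟩] ++ (A ++ shift 2 B ++ [⟨cup, 1⟩, ⟨cup, 0⟩])) (l := 0)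
    (Runs.append (k := 4) (by simp [Runs]) hAB)
  have m3 : Isotopic 2 4 [⟨cap, 1⟩, ⟨xing s, 2⟩] [⟨cap, 2⟩, ⟨xing !s, 1⟩] := by
    refine .of_move (LocalMove.capSlide s 1) ?_ ?_ <;> simp [Runs]
  have s3 := m3.symm.mid [⟨cap, 0⟩] (A ++ shift 2 B ++ [⟨cup, 1⟩, ⟨cup, 0⟩]) (k := 0)
    (by simp [Runs]) hAB
  have s4 := (Isotopic.interchange hA (runs_xing s)).symm.mid [⟨cap, 0⟩, ⟨cap, 1⟩]
    (shift 2 B ++ [⟨cup, 1⟩, ⟨cup, 0⟩]) (k := 0) (l := 0) (by simp [Runs])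
    (Runs.append (k := 4) (hB.shift 2) (by simp [Runs]))
  simp only [tangleSum, shift_append, shift_cons, shift_nil, shift_shift, List.append_assoc,
    List.cons_append, List.nil_append, Nat.reduceAdd, List.append_nil] at *
  exact ((s1.trans s2).trans s3).trans s4

/-! ### Dots -/

theorem isotopic_dot_upper_left {T S : List Slice} (hT : Runs 2 T 2) (hS : Runs 2 S 2) :
    Isotopic 2 2 (tangleSum ([⟨dot, 0⟩] ++ T) S) ([⟨dot, 0⟩] ++ tangleSum T S) := by
  have m1 : Isotopic 2 4 [⟨dot, 0⟩, ⟨cap, 1⟩] [⟨cap, 1⟩, ⟨dot, 0⟩] := by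
    refine .of_move (LocalMove.comm dot cap 0 0) ?_ ?_ <;> simp [Runs]
  have s1 := m1.symm.right (T ++ shift 2 S ++ [⟨cup, 1⟩]) (l := 2)
    (Runs.append (Runs.append (k := 4) (hT.addRight 2) (hS.shift 2)) (by simp [Runs]))
  simpa [tangleSum] using s1

theorem isotopic_dot_upper_right {T S : List Slice} (hT : Runs 2 T 2) (hS : Runs 2 S 2) :
    Isotopic 2 2 (tangleSum T ([⟨dot, 1⟩] ++ S)) ([⟨dot, 1⟩] ++ tangleSum T S) := by
  have d1 : Runs 2 [⟨dot, 1⟩] 2 := by simp [Runs]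
  have s0 := (Isotopic.interchange hT d1).mid [⟨cap, 1⟩] (shift 2 S ++ [⟨cup, 1⟩]) (k := 2)
    (l := 2) (by simp [Runs]) (Runs.append (k := 4) (hS.shift 2) (by simp [Runs]))
  have m1 : Isotopic 2 4 [⟨cap, 1⟩, ⟨dot, 3⟩] [⟨dot, 1⟩, ⟨cap, 1⟩] := by
    refine .of_move (LocalMove.comm cap dot 1 0) ?_ ?_ <;> simp [Runs]
  have s1 := m1.right (T ++ shift 2 S ++ [⟨cup, 1⟩]) (l := 2)
    (Runs.append (Runs.append (k := 4) (hT.addRight 2) (hS.shift 2)) (by simp [Runs]))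
  simp only [tangleSum, shift_append, shift_cons, shift_nil, shift_shift, List.append_assoc,
    List.cons_append, List.nil_append, Nat.reduceAdd, List.append_nil] at *
  exact s0.trans s1

theorem isotopic_dot_upper_middle {T S : List Slice} (hT : Runs 2 T 2) (hS : Runs 2 S 2) :
    Isotopic 2 2 (tangleSum ([⟨dot, 1⟩] ++ T) S) (tangleSum T ([⟨dot, 0⟩] ++ S)) := by
  have m1 : Isotopic 2 4 [⟨cap, 1⟩, ⟨dot, 1⟩] [⟨cap, 1⟩, ⟨dot, 2⟩] := by
    refine .of_move (LocalMove.dotCap 1) ?_ ?_ <;> simp [Runs]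
  have s1 := m1.right (T ++ shift 2 S ++ [⟨cup, 1⟩]) (l := 2)
    (Runs.append (Runs.append (k := 4) (hT.addRight 2) (hS.shift 2)) (by simp [Runs]))
  have d1 : Runs 2 [⟨dot, 0⟩] 2 := by simp [Runs]
  have s2 := (Isotopic.interchange hT d1).symm.mid [⟨cap, 1⟩] (shift 2 S ++ [⟨cup, 1⟩]) (k := 2)
    (l := 2) (by simp [Runs]) (Runs.append (k := 4) (hS.shift 2) (by simp [Runs]))
  simp only [tangleSum, shift_append, shift_cons, shift_nil, shift_shift, List.append_assoc,
    List.cons_append, List.nil_append, Nat.reduceAdd, List.append_nil] at *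
  exact s1.trans s2

theorem isotopic_dot_lower_left {T S : List Slice} (hT : Runs 2 T 2) (hS : Runs 2 S 2) :
    Isotopic 2 2 (tangleSum (T ++ [⟨dot, 0⟩]) S) (tangleSum T S ++ [⟨dot, 0⟩]) := by
  have d1 : Runs 2 [⟨dot, 0⟩] 2 := by simp [Runs]
  have s0 := (Isotopic.interchange d1 hS).mid ([⟨cap, 1⟩] ++ T) [⟨cup, 1⟩] (k := 2)
    (l := 2) (Runs.append (k := 4) (by simp [Runs]) (hT.addRight 2)) (by simp [Runs])
  have m1 : Isotopic 4 2 [⟨dot, 0⟩, ⟨cup, 1⟩] [⟨cup, 1⟩, ⟨dot, 0⟩] := by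
    refine .of_move (LocalMove.comm dot cup 0 0) ?_ ?_ <;> simp [Runs]
  have s1 := m1.left ([⟨cap, 1⟩] ++ T ++ shift 2 S) (k := 2)
    (Runs.append (Runs.append (k := 4) (by simp [Runs]) (hT.addRight 2)) (hS.shift 2))
  simp only [tangleSum, shift_append, shift_cons, shift_nil, shift_shift, List.append_assoc,
    List.cons_append, List.nil_append, Nat.reduceAdd, List.append_nil] at *
  exact s0.trans s1

theorem isotopic_dot_lower_right {T S : List Slice} (hT : Runs 2 T 2) (hS : Runs 2 S 2) :
    Isotopic 2 2 (tangleSum T (S ++ [⟨dot, 1⟩])) (tangleSum T S ++ [⟨dot, 1⟩]) := by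
  have m1 : Isotopic 4 2 [⟨cup, 1⟩, ⟨dot, 1⟩] [⟨dot, 3⟩, ⟨cup, 1⟩] := by
    refine .of_move (LocalMove.comm cup dot 1 0) ?_ ?_ <;> simp [Runs]
  have s1 := m1.symm.left ([⟨cap, 1⟩] ++ T ++ shift 2 S) (k := 2)
    (Runs.append (Runs.append (k := 4) (by simp [Runs]) (hT.addRight 2)) (hS.shift 2))
  simpa [tangleSum] using s1

theorem isotopic_dot_lower_middle {T S : List Slice} (hT : Runs 2 T 2) (hS : Runs 2 S 2) :
    Isotopic 2 2 (tangleSum (T ++ [⟨dot, 1⟩]) S) (tangleSum T (S ++ [⟨dot, 0⟩])) := by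
  have d1 : Runs 2 [⟨dot, 1⟩] 2 := by simp [Runs]
  have s0 := (Isotopic.interchange d1 hS).mid ([⟨cap, 1⟩] ++ T) [⟨cup, 1⟩] (k := 2)
    (l := 2) (Runs.append (k := 4) (by simp [Runs]) (hT.addRight 2)) (by simp [Runs])
  have m1 : Isotopic 4 2 [⟨dot, 1⟩, ⟨cup, 1⟩] [⟨dot, 2⟩, ⟨cup, 1⟩] := by
    refine .of_move (LocalMove.dotCup 1) ?_ ?_ <;> simp [Runs]
  have s1 := m1.left ([⟨cap, 1⟩] ++ T ++ shift 2 S) (k := 2)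
    (Runs.append (Runs.append (k := 4) (by simp [Runs]) (hT.addRight 2)) (hS.shift 2))
  simp only [tangleSum, shift_append, shift_cons, shift_nil, shift_shift, List.append_assoc,
    List.cons_append, List.nil_append, Nat.reduceAdd, List.append_nil] at *
  exact s0.trans s1

theorem isotopic_dot_xing (s : Bool) :
    Isotopic 2 2 ([⟨dot, 0⟩] ++ [⟨xing s, 0⟩]) ([⟨xing s, 0⟩] ++ [⟨dot, 1⟩]) := by
  refine .of_move (LocalMove.dotLeft s 0) ?_ ?_ <;> simp [Runs]

theorem isotopic_dot_xing_right (s : Bool) :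
    Isotopic 2 2 ([⟨dot, 1⟩] ++ [⟨xing s, 0⟩]) ([⟨xing s, 0⟩] ++ [⟨dot, 0⟩]) := by
  refine .of_move (LocalMove.dotRight s 0) ?_ ?_ <;> simp [Runs]

theorem isotopic_dot_dot {i : ℕ} (hi : i < 2) :
    Isotopic 2 2 ([⟨dot, i⟩] ++ [⟨dot, i⟩]) [] := by
  refine .of_move (LocalMove.dotCancel i) ?_ ?_ <;> simp [Runs] <;> omega

theorem isotopic_dot_comm :
    Isotopic 2 2 ([⟨dot, 0⟩] ++ [⟨dot, 1⟩]) ([⟨dot, 1⟩] ++ [⟨dot, 0⟩]) := by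
  refine .of_move (LocalMove.comm dot dot 0 0) ?_ ?_ <;> simp [Runs]

theorem isotopic_dot_zero :
    Isotopic 2 2 ([⟨dot, 0⟩] ++ zeroTangle) ([⟨dot, 1⟩] ++ zeroTangle) := by
  have m1 : Isotopic 2 0 [⟨dot, 0⟩, ⟨cup, 0⟩] [⟨dot, 1⟩, ⟨cup, 0⟩] := by
    refine .of_move (LocalMove.dotCup 0) ?_ ?_ <;> simp [Runs]
  exact m1.right [⟨cap, 0⟩] (by simp [Runs])

/-! ### The algebra of tangles up to isotopy -/

instance tangleSetoid : Setoid {w : List Slice // Runs 2 w 2} where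
  r u v := Isotopic 2 2 u.1 v.1
  iseqv := ⟨fun _ => .refl _, .symm, .trans⟩

/-- Tangles with two upper and two lower endpoints, up to isotopy. -/
def Tangle : Type := Quotient tangleSetoid

namespace Tangle

/-- The isotopy class of a tangle diagram. -/
def mk (w : List Slice) (h : Runs 2 w 2) : Tangle := Quotient.mk _ ⟨w, h⟩

theorem mk_eq {u v : List Slice} (hu : Runs 2 u 2) (hv : Runs 2 v 2) (h : Isotopic 2 2 u v) :
    mk u hu = mk v hv := Quotient.sound h

theorem ind {P : Tangle → Prop} (h : ∀ w hw, P (mk w hw)) (T : Tangle) : P T := by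
  induction T using Quotient.inductionOn with
  | h w => exact h w.1 w.2

instance : Mul Tangle where
  mul := Quotient.map₂ (fun u v => ⟨tangleSum u.1 v.1, runs_tangleSum u.2 v.2⟩)
    fun u _ h _ v' h' => isotopic_tangleSum u.2 v'.2 h h'

instance : One Tangle := ⟨mk zeroTangle runs_zeroTangle⟩

theorem mk_mul {u v : List Slice} (hu : Runs 2 u 2) (hv : Runs 2 v 2) :
    mk u hu * mk v hv = mk (tangleSum u v) (runs_tangleSum hu hv) := rfl

theorem one_def : (1 : Tangle) = mk zeroTangle runs_zeroTangle := rfl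

/-- Tangles form a monoid under the tangle sum. -/
instance : Monoid Tangle where
  mul_assoc a b c := by
    induction a using ind with | _ a ha
    induction b using ind with | _ b hb
    induction c using ind with | _ c hc
    exact mk_eq _ _ (isotopic_sum_assoc ha hb hc)
  one_mul a := by
    induction a using ind with | _ a ha
    exact mk_eq _ _ (isotopic_zero_sum ha)
  mul_one a := by
    induction a using ind with | _ a ha
    exact mk_eq _ _ (isotopic_sum_zero ha)

/-- The tangle of fraction `∞`. -/
def infinity : Tangle := mk [] rfl

/-- The tangle consisting of one crossing. -/
def crossing (s : Bool) : Tangle := mk [⟨xing s, 0⟩] (runs_xing s)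

theorem crossing_mul_crossing (s : Bool) : crossing s * crossing (!s) = 1 :=
  mk_eq _ _ (isotopic_xing_sum_xing s)

theorem crossing_mul_crossing' (s : Bool) : crossing (!s) * crossing s = 1 := by
  simpa using crossing_mul_crossing (!s)

/-- The tangle consisting of one crossing, as an invertible element. -/
def crossingUnit (s : Bool) : Tangleˣ :=
  ⟨crossing s, crossing (!s), crossing_mul_crossing s, crossing_mul_crossing' s⟩

@[simp] theorem coe_crossingUnit (s : Bool) : (crossingUnit s : Tangle) = crossing s := rfl

theorem crossingUnit_inv (s : Bool) : (crossingUnit s)⁻¹ = crossingUnit (!s) :=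
  Units.ext rfl

/-- Addition of a piece of a diagram above a tangle. -/
def onTop (u : List Slice) (hu : Runs 2 u 2) : Tangle → Tangle :=
  Quotient.map (fun w => ⟨u ++ w.1, hu.append w.2⟩) fun _ _ h => h.left u hu

/-- Addition of a piece of a diagram below a tangle. -/
def below (u : List Slice) (hu : Runs 2 u 2) : Tangle → Tangle :=
  Quotient.map (fun w => ⟨w.1 ++ u, w.2.append hu⟩) fun _ _ h => h.right u hu

theorem onTop_mk {u w : List Slice} (hu : Runs 2 u 2) (hw : Runs 2 w 2) :
    onTop u hu (mk w hw) = mk (u ++ w) (hu.append hw) := rfl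

theorem below_mk {u w : List Slice} (hu : Runs 2 u 2) (hw : Runs 2 w 2) :
    below u hu (mk w hw) = mk (w ++ u) (hw.append hu) := rfl

theorem onTop_below {u v : List Slice} (hu : Runs 2 u 2) (hv : Runs 2 v 2) (T : Tangle) :
    onTop u hu (below v hv T) = below v hv (onTop u hu T) := by
  induction T using ind with | _ w hw
  simp only [onTop_mk, below_mk, List.append_assoc]

theorem onTop_onTop {u v w : List Slice} (hu : Runs 2 u 2) (hv : Runs 2 v 2) (hw : Runs 2 w 2)
    (h : Isotopic 2 2 (u ++ v) w) (T : Tangle) : onTop u hu (onTop v hv T) = onTop w hw T := by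
  induction T using ind with | _ z hz
  refine mk_eq _ _ ?_
  simpa using h.right z hz

theorem below_below {u v w : List Slice} (hu : Runs 2 u 2) (hv : Runs 2 v 2) (hw : Runs 2 w 2)
    (h : Isotopic 2 2 (v ++ u) w) (T : Tangle) : below u hu (below v hv T) = below w hw T := by
  induction T using ind with | _ z hz
  refine mk_eq _ _ ?_
  simpa using h.left z hz

theorem onTop_nil (T : Tangle) : onTop [] rfl T = T := by
  induction T using ind with | _ z hz
  rfl

theorem below_nil (T : Tangle) : below [] rfl T = T := by
  induction T using ind with | _ z hz
  exact mk_eq _ _ (.of_eq (by simp))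

/-- Addition of a crossing above a tangle. -/
def addTop (s : Bool) : Equiv.Perm Tangle where
  toFun := onTop [⟨xing s, 0⟩] (runs_xing s)
  invFun := onTop [⟨xing !s, 0⟩] (runs_xing _)
  left_inv T := by
    rw [onTop_onTop _ _ (w := []) rfl (by simpa using isotopic_xing_xing (!s)), onTop_nil]
  right_inv T := by rw [onTop_onTop _ _ (w := []) rfl (isotopic_xing_xing s), onTop_nil]

theorem addTop_inv (s : Bool) : (addTop s)⁻¹ = addTop (!s) := Equiv.ext fun _ => rfl

/-- Addition of a crossing on the left of a tangle. -/
def addLeft (s : Bool) : Equiv.Perm Tangle where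
  toFun T := crossing s * T
  invFun T := crossing (!s) * T
  left_inv T := by simp [← mul_assoc, crossing_mul_crossing']
  right_inv T := by simp [← mul_assoc, crossing_mul_crossing]

theorem addLeft_inv (s : Bool) : (addLeft s)⁻¹ = addLeft (!s) := Equiv.ext fun _ => rfl

/-- Addition of a crossing on the right of a tangle. -/
def addRight (s : Bool) : Equiv.Perm Tangle where
  toFun T := T * crossing s
  invFun T := T * crossing (!s)
  left_inv T := by simp [mul_assoc, crossing_mul_crossing]
  right_inv T := by simp [mul_assoc, crossing_mul_crossing']

theorem addLeft_apply (s : Bool) (T : Tangle) : addLeft s T = crossing s * T := rfl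

theorem addRight_apply (s : Bool) (T : Tangle) : addRight s T = T * crossing s := rfl

theorem addTop_mk (s : Bool) {w : List Slice} (hw : Runs 2 w 2) :
    addTop s (mk w hw) = mk (⟨xing s, 0⟩ :: w) ((runs_xing s).append hw) := rfl

theorem addTop_infinity (s : Bool) : addTop s infinity = crossing s := rfl

theorem addTop_one (s : Bool) : addTop s 1 = 1 := mk_eq _ _ (isotopic_xing_zero s)

theorem addLeft_one (s : Bool) : addLeft s 1 = crossing s := mul_one (crossing s)

theorem addLeft_infinity (s : Bool) : addLeft s infinity = infinity :=
  mk_eq _ _ (isotopic_xing_sum_infinity s)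

/-- The crossings on the left, above and on the right twist consecutive pairs in the chain of
endpoints lower left, upper left, upper right, lower right. With the top one inverted they satisfy
the relations of the braid group on four strands. -/
theorem braid_left (s : Bool) :
    addLeft s * (addTop s)⁻¹ * addLeft s = (addTop s)⁻¹ * addLeft s * (addTop s)⁻¹ := by
  refine Equiv.ext fun T => ?_
  rw [addTop_inv]
  induction T using ind with | _ z hz
  exact mk_eq _ _ (isotopic_braid_left s hz)

theorem braid_right (s : Bool) :
    addRight s * (addTop s)⁻¹ * addRight s = (addTop s)⁻¹ * addRight s * (addTop s)⁻¹ := by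
  refine Equiv.ext fun T => ?_
  rw [addTop_inv]
  induction T using ind with | _ z hz
  exact mk_eq _ _ (isotopic_braid_right s hz)

theorem commute_addLeft_addRight (s : Bool) : addLeft s * addRight s = addRight s * addLeft s :=
  Equiv.ext fun T => (mul_assoc (crossing s) T (crossing s)).symm

end Tangle

section BraidGroup

variable {G : Type*} [Group G] {l v r : G}

/-! Two conjugation formulas in the braid group on four strands: the elements `l r⁻¹` and
`v l r⁻¹ v⁻¹` generate a normal subgroup. -/

theorem braid_conj (h : l * v * l = v * l * v) : v⁻¹ * l * v = l * v * l⁻¹ := by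
  rw [eq_mul_inv_iff_mul_eq, mul_assoc, mul_assoc, inv_mul_eq_iff_eq_mul, ← mul_assoc,
    ← mul_assoc]
  exact h

theorem braid_mul_conj (hl : l * v * l = v * l * v) (hr : r * v * r = v * r * v) :
    l * (v * (l * r⁻¹) * v⁻¹) = v * (l * r⁻¹) * v⁻¹ * r := by
  have h1 : l * v * l * v⁻¹ = v * l := by rw [hl]; group
  have h2 : r⁻¹ * v⁻¹ * r = v * r⁻¹ * v⁻¹ := by
    have h4 := congrArg (·⁻¹) (braid_conj hr.symm)
    simp only [mul_inv_rev, inv_inv] at h4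
    simpa [mul_assoc] using h4
  calc l * (v * (l * r⁻¹) * v⁻¹) = (l * v * l * v⁻¹) * (v * r⁻¹ * v⁻¹) := by group
    _ = v * l * (r⁻¹ * v⁻¹ * r) := by rw [h1, h2]
    _ = _ := by group

/-- With `a = l r⁻¹` and `c = v a v⁻¹` this reads `l⁻¹ c l = c a`, and `braid_conj_top` reads `v c
v⁻¹ = c a⁻¹ c`. Hence `l` and `v⁻¹` preserve the points fixed by both `a` and `c`. -/
theorem braid_conj_left (hl : l * v * l = v * l * v) (hr : r * v * r = v * r * v)
    (hc : l * r = r * l) :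
    l⁻¹ * (v * (l * r⁻¹) * v⁻¹) * l = v * (l * r⁻¹) * v⁻¹ * (l * r⁻¹) := by
  have h := braid_mul_conj hl hr
  have hc' : l * r⁻¹ = r⁻¹ * l := (Commute.inv_right hc : Commute l r⁻¹)
  generalize v * (l * r⁻¹) * v⁻¹ = c at h ⊢
  rw [mul_assoc, inv_mul_eq_iff_eq_mul, ← mul_assoc, h, hc']
  group

theorem braid_conj_top (hl : l * v * l = v * l * v) (hr : r * v * r = v * r * v)
    (hc : l * r = r * l) :
    v * (v * (l * r⁻¹) * v⁻¹) * v⁻¹ =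
      v * (l * r⁻¹) * v⁻¹ * (l * r⁻¹)⁻¹ * (v * (l * r⁻¹) * v⁻¹) := by
  have h := braid_mul_conj hl hr
  have hc' : l * r⁻¹ = r⁻¹ * l := (Commute.inv_right hc : Commute l r⁻¹)
  have e1 := braid_conj hl
  have e2 := braid_conj hr
  have e3 : v⁻¹ * (l * r⁻¹)⁻¹ * v = (r * v * r⁻¹) * (l * v⁻¹ * l⁻¹) := by
    have := congrArg (·⁻¹) e1
    simp only [mul_inv_rev, inv_inv] at this
    rw [← e2]
    calc v⁻¹ * (l * r⁻¹)⁻¹ * v = v⁻¹ * r * v * (v⁻¹ * (l⁻¹ * v)) := by group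
      _ = _ := by rw [this]; group
  have e4 : v * (l * r⁻¹) * v⁻¹ = (l * r⁻¹) * (v⁻¹ * (l * r⁻¹)⁻¹ * v) * (l * r⁻¹) := by
    rw [e3]
    calc v * (l * r⁻¹) * v⁻¹ = l * (v * (l * r⁻¹) * v⁻¹) * r⁻¹ := by rw [h]; group
      _ = l * (v * (r⁻¹ * l) * v⁻¹) * r⁻¹ := by rw [hc']
      _ = _ := by group
  calc v * (v * (l * r⁻¹) * v⁻¹) * v⁻¹
      = v * ((l * r⁻¹) * (v⁻¹ * (l * r⁻¹)⁻¹ * v) * (l * r⁻¹)) * v⁻¹ := by rw [← e4]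
    _ = _ := by group

end BraidGroup

namespace Tangle

/-! ### Positive rational tangles -/

/-- `Pos s T n d`: the tangle `T` is obtained from one crossing of sign `s` by adding crossings of
the same sign on the left and above; `n / d` is the absolute value of its fraction. -/
inductive Pos (s : Bool) : Tangle → ℕ → ℕ → Prop
  | crossing : Pos s (crossing s) 1 1
  | left {T : Tangle} {n d : ℕ} (h : Pos s T n d) : Pos s (addLeft s T) (n + d) d
  | top {T : Tangle} {n d : ℕ} (h : Pos s T n d) : Pos s (addTop s T) n (n + d)

namespace Pos

variable {s : Bool} {T S : Tangle} {n d m : ℕ}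

theorem pos (h : Pos s T n d) : 0 < n ∧ 0 < d := by
  induction h <;> omega

theorem coprime (h : Pos s T n d) : n.Coprime d := by
  induction h with
  | crossing => simp
  | left _ ih => simpa using ih
  | top _ ih => simpa using ih

theorem exists_left (h : Pos s T n d) (hlt : d < n) :
    ∃ T', T = addLeft s T' ∧ Pos s T' (n - d) d := by
  cases h with
  | crossing => omega
  | left h => exact ⟨_, rfl, by simpa using h⟩
  | top h => omega

theorem exists_top (h : Pos s T n d) (hlt : n < d) :
    ∃ T', T = addTop s T' ∧ Pos s T' n (d - n) := by
  cases h with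
  | crossing => omega
  | left h => omega
  | top h => exact ⟨_, rfl, by simpa using h⟩

theorem eq_crossing (h : Pos s T n d) (hnd : n = d) : T = Tangle.crossing s ∧ n = 1 := by
  cases h with
  | crossing => exact ⟨rfl, rfl⟩
  | left h => have := h.pos; omega
  | top h => have := h.pos; omega

/-- Comparing `n` with `d` tells which crossing was added last, so the Euclidean algorithm
reconstructs the tangle from its fraction. -/
theorem unique (h : Pos s T n d) (h' : Pos s S n d) : T = S := by
  induction h generalizing S with
  | crossing => exact (h'.eq_crossing rfl).1.symm
  | left h ih =>
    obtain ⟨S', rfl, hS⟩ := h'.exists_left (by have := h.pos; omega)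
    rw [ih (by simpa using hS)]
  | top h ih =>
    obtain ⟨S', rfl, hS⟩ := h'.exists_top (by have := h.pos; omega)
    rw [ih (by simpa using hS)]

theorem exists_of_coprime (s : Bool) (hn : 0 < n) (hd : 0 < d) (h : n.Coprime d) :
    ∃ T, Pos s T n d := by
  induction hk : n + d using Nat.strong_induction_on generalizing n d with
  | _ k ih =>
    rcases lt_trichotomy n d with hlt | rfl | hlt
    · obtain ⟨T, hT⟩ := ih d (by omega) hn (Nat.sub_pos_of_lt hlt)
        (by rwa [Nat.coprime_sub_self_right hlt.le]) (by omega)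
      exact ⟨addTop s T, by simpa [Nat.add_sub_of_le hlt.le] using hT.top⟩
    · obtain rfl : n = 1 := by simpa using h
      exact ⟨_, .crossing⟩
    · obtain ⟨T, hT⟩ := ih n (by omega) (Nat.sub_pos_of_lt hlt) hd
        (by rwa [Nat.coprime_sub_self_left hlt.le]) (by omega)
      exact ⟨addLeft s T, by simpa [Nat.sub_add_cancel hlt.le] using hT.left⟩

/-- Positive rational tangles are invariant under the flype that carries a crossing from one side
to the other. -/
theorem addLeft_eq_addRight (h : Pos s T n d) : addLeft s T = addRight s T := by
  have hl := braid_left s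
  have hr := braid_right s
  have hc := commute_addLeft_addRight s
  have c1 := braid_conj_left hl hr hc
  have c2 := braid_conj_top hl hr hc
  have hc' : (addLeft s * (addRight s)⁻¹) * addLeft s = addLeft s * (addLeft s * (addRight s)⁻¹) :=
    by rw [mul_assoc, (Commute.inv_right hc : Commute (addLeft s) (addRight s)⁻¹).eq]
  -- For the induction to pass through crossings above, `T` must be fixed not only by `a = l r⁻¹`
  -- but also by its conjugate `c = v a v⁻¹`, with `v` the inverse of adding a crossing above.
  have key : (addLeft s * (addRight s)⁻¹) T = T ∧
      ((addTop s)⁻¹ * (addLeft s * (addRight s)⁻¹) * (addTop s)⁻¹⁻¹) T = T := by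
    have hleft : ∀ T, ((addLeft s * (addRight s)⁻¹) T = T ∧
        ((addTop s)⁻¹ * (addLeft s * (addRight s)⁻¹) * (addTop s)⁻¹⁻¹) T = T) →
        ((addLeft s * (addRight s)⁻¹) (addLeft s T) = addLeft s T ∧
        ((addTop s)⁻¹ * (addLeft s * (addRight s)⁻¹) * (addTop s)⁻¹⁻¹) (addLeft s T) =
          addLeft s T) := by
      rintro T ⟨h1, h2⟩
      generalize (addTop s)⁻¹ * (addLeft s * (addRight s)⁻¹) * (addTop s)⁻¹⁻¹ = c at *
      generalize addLeft s * (addRight s)⁻¹ = a at *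
      constructor
      · rw [← Equiv.Perm.mul_apply, hc', Equiv.Perm.mul_apply, h1]
      · have := congrArg (fun f => f T) c1
        simp only [Equiv.Perm.mul_apply, h1, h2] at this
        exact Equiv.Perm.inv_eq_iff_eq.1 this
    induction h with
    | crossing =>
      rw [← addLeft_one]
      refine hleft 1 ?_
      have h0 : (addLeft s * (addRight s)⁻¹) 1 = 1 := by
        have e : addLeft s 1 = addRight s 1 := by simp [addLeft_apply, addRight_apply]
        rw [(Commute.inv_right hc : Commute (addLeft s) (addRight s)⁻¹).eq, Equiv.Perm.mul_apply,
          Equiv.Perm.inv_eq_iff_eq, e]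
      refine ⟨h0, ?_⟩
      rw [inv_inv, Equiv.Perm.mul_apply, addTop_one, Equiv.Perm.mul_apply, h0, addTop_inv,
        addTop_one]
    | left _ ih => exact hleft _ ih
    | @top T n d _ ih =>
      obtain ⟨h1, h2⟩ := ih
      generalize addLeft s * (addRight s)⁻¹ = a at *
      -- Invariance of `T` under the conjugate is invariance of `v⁻¹ T` under `a`; invariance of
      -- `v⁻¹ T` under `c` comes from `v c v⁻¹ = c a⁻¹ c`.
      have e : a (addTop s T) = addTop s T := by
        rw [inv_inv, Equiv.Perm.mul_apply, Equiv.Perm.mul_apply] at h2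
        exact Equiv.Perm.inv_eq_iff_eq.1 h2
      refine ⟨e, ?_⟩
      have := congrArg (fun f => f T) c2
      simp only [Equiv.Perm.mul_apply, inv_inv] at this h2 ⊢
      simp only [h1, h2, Equiv.Perm.inv_eq_iff_eq.2 h1.symm] at this
      exact Equiv.Perm.inv_eq_iff_eq.1 this
  have := key.1
  rwa [(Commute.inv_right hc : Commute (addLeft s) (addRight s)⁻¹).eq, Equiv.Perm.mul_apply,
    Equiv.Perm.inv_eq_iff_eq] at this

theorem commute (h : Pos s T n d) : Commute (Tangle.crossing s) T := h.addLeft_eq_addRight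

/-- Rotation by a quarter turn exchanges positive rational tangles of opposite signs. -/
theorem addLeft_addTop_not (h : Pos (!s) T n d) :
    ∃ T', Pos s T' d n ∧ addLeft s (addTop (!s) T) = addTop s T' := by
  have hl := braid_left s
  have hT : addTop (!s) = (addTop s)⁻¹ := (addTop_inv s).symm
  have hL : addLeft (!s) = (addLeft s)⁻¹ := (addLeft_inv s).symm
  -- The half twist `v l v = l v l` of the braid group on three strands interchanges `l` and `v` by
  -- conjugation. Applied to a tangle built with one sign, it swaps left and top crossings and
  -- reverses their sign.
  suffices H : ∃ T', Pos s T' d n ∧ ((addTop s)⁻¹ * addLeft s * (addTop s)⁻¹) T = T' by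
    obtain ⟨T', hT', rfl⟩ := H
    exact ⟨_, hT', by simp [hT, Equiv.Perm.mul_apply]⟩
  induction h with
  | crossing =>
    refine ⟨_, .crossing, ?_⟩
    rw [← addLeft_one, hL, ← hl, ← Equiv.Perm.mul_apply, mul_inv_cancel_right,
      Equiv.Perm.mul_apply, ← hT, addTop_one, addLeft_one]
  | left _ ih =>
    obtain ⟨T', hT', rfl⟩ := ih
    refine ⟨_, add_comm (_ : ℕ) _ ▸ hT'.top, ?_⟩
    rw [hL, ← Equiv.Perm.mul_apply, ← Equiv.Perm.mul_apply]
    congr 1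
    nth_rw 1 [← hl]
    group
  | top _ ih =>
    obtain ⟨T', hT', rfl⟩ := ih
    refine ⟨_, add_comm (_ : ℕ) _ ▸ hT'.left, ?_⟩
    rw [hT, ← Equiv.Perm.mul_apply, ← Equiv.Perm.mul_apply]
    congr 1
    nth_rw 1 [← hl]
    group

/-- Up to sign this is `n/(n+d) = 1 - d/(n+d)`. It is used to trade a tangle of fraction in `(0,1)`
for a crossing and a tangle of fraction in `(-1,0)`. -/
theorem addTop_eq (h : Pos s T n d) :
    ∃ T', Pos (!s) T' d n ∧ addTop s T = addLeft s (addTop (!s) T') := by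
  obtain ⟨T', hT'⟩ := exists_of_coprime (!s) h.pos.2 h.pos.1 h.coprime.symm
  obtain ⟨S, hS, e⟩ := hT'.addLeft_addTop_not
  exact ⟨T', hT', by rw [e, hS.unique h]⟩

end Pos

/-! ### Dots at the endpoints of a tangle -/

theorem runs_dot_zero : Runs 2 [⟨dot, 0⟩] 2 := by simp [Runs]

theorem runs_dot_one : Runs 2 [⟨dot, 1⟩] 2 := by simp [Runs]

/-- A dot at the upper left endpoint. -/
def nw : Tangle → Tangle := onTop [⟨dot, 0⟩] runs_dot_zero

/-- A dot at the upper right endpoint. -/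
def ne : Tangle → Tangle := onTop [⟨dot, 1⟩] runs_dot_one

/-- A dot at the lower left endpoint. -/
def sw : Tangle → Tangle := below [⟨dot, 0⟩] runs_dot_zero

/-- A dot at the lower right endpoint. -/
def se : Tangle → Tangle := below [⟨dot, 1⟩] runs_dot_one

section dots

variable (s : Bool) (T S : Tangle)

@[simp] theorem nw_nw : nw (nw T) = T := by
  rw [nw, onTop_onTop _ _ (w := []) rfl (isotopic_dot_dot (by norm_num)), onTop_nil]

@[simp] theorem ne_ne : ne (ne T) = T := by
  rw [ne, onTop_onTop _ _ (w := []) rfl (isotopic_dot_dot (by norm_num)), onTop_nil]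

@[simp] theorem sw_sw : sw (sw T) = T := by
  rw [sw, below_below _ _ (w := []) rfl (isotopic_dot_dot (by norm_num)), below_nil]

theorem ne_nw : ne (nw T) = nw (ne T) := by
  rw [nw, ne, onTop_onTop _ _ (Runs.append runs_dot_zero runs_dot_one) isotopic_dot_comm.symm,
    ← onTop_onTop _ _ _ (.refl _)]

theorem se_sw : se (sw T) = sw (se T) := by
  rw [sw, se, below_below _ _ (Runs.append runs_dot_one runs_dot_zero) isotopic_dot_comm,
    ← below_below _ _ _ (.refl _)]

theorem sw_nw : sw (nw T) = nw (sw T) := (onTop_below _ _ _).symm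

theorem sw_ne : sw (ne T) = ne (sw T) := (onTop_below _ _ _).symm

theorem nw_addTop : nw (addTop s T) = addTop s (ne T) := by
  have h1 := onTop_onTop runs_dot_zero (runs_xing s)
    (Runs.append (runs_xing s) runs_dot_one) (isotopic_dot_xing s) T
  exact h1.trans (onTop_onTop (runs_xing s) _ _ (.refl _) _).symm

theorem ne_addTop : ne (addTop s T) = addTop s (nw T) := by
  have h1 := onTop_onTop runs_dot_one (runs_xing s)
    (Runs.append (runs_xing s) runs_dot_zero) (isotopic_dot_xing_right s) T
  exact h1.trans (onTop_onTop (runs_xing s) _ _ (.refl _) _).symm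

theorem sw_addTop : sw (addTop s T) = addTop s (sw T) :=
  (onTop_below (runs_xing s) runs_dot_zero T).symm

theorem se_addTop : se (addTop s T) = addTop s (se T) :=
  (onTop_below (runs_xing s) runs_dot_one T).symm

theorem nw_crossing : nw (crossing s) = se (crossing s) := mk_eq _ _ (isotopic_dot_xing s)

theorem ne_crossing : ne (crossing s) = sw (crossing s) := mk_eq _ _ (isotopic_dot_xing_right s)

theorem nw_one : nw 1 = ne 1 := mk_eq _ _ isotopic_dot_zero

theorem nw_mul : nw (T * S) = nw T * S := by
  induction T using ind with | _ w hw
  induction S using ind with | _ z hz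
  exact (mk_eq _ _ (isotopic_dot_upper_left hw hz)).symm

theorem ne_mul : ne (T * S) = T * ne S := by
  induction T using ind with | _ w hw
  induction S using ind with | _ z hz
  exact (mk_eq _ _ (isotopic_dot_upper_right hw hz)).symm

theorem sw_mul : sw (T * S) = sw T * S := by
  induction T using ind with | _ w hw
  induction S using ind with | _ z hz
  exact (mk_eq _ _ (isotopic_dot_lower_left hw hz)).symm

theorem se_mul : se (T * S) = T * se S := by
  induction T using ind with | _ w hw
  induction S using ind with | _ z hz
  exact (mk_eq _ _ (isotopic_dot_lower_right hw hz)).symm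

theorem ne_mul_eq : ne T * S = T * nw S := by
  induction T using ind with | _ w hw
  induction S using ind with | _ z hz
  exact mk_eq _ _ (isotopic_dot_upper_middle hw hz)

theorem se_mul_eq : se T * S = T * sw S := by
  induction T using ind with | _ w hw
  induction S using ind with | _ z hz
  exact mk_eq _ _ (isotopic_dot_lower_middle hw hz)

theorem nw_addLeft : nw (addLeft s T) = addLeft s (sw T) := by
  rw [addLeft_apply, nw_mul, nw_crossing, se_mul_eq]; rfl

theorem sw_addLeft : sw (addLeft s T) = addLeft s (nw T) := by
  rw [addLeft_apply, sw_mul, ← ne_crossing, ne_mul_eq]; rfl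

theorem ne_addLeft : ne (addLeft s T) = addLeft s (ne T) := ne_mul (crossing s) T

theorem se_addLeft : se (addLeft s T) = addLeft s (se T) := se_mul (crossing s) T

end dots

/-- The dots at the two lower endpoints of a positive rational tangle can be moved to the upper
endpoints. -/
theorem Pos.sw_se {s : Bool} {T : Tangle} {n d : ℕ} (h : Pos s T n d) :
    sw (se T) = nw (ne T) := by
  induction h with
  | crossing => rw [← nw_crossing, sw_nw, ← ne_crossing]
  | @left T _ _ _ ih =>
    have e : nw (se T) = sw (ne T) := by
      have := congrArg (fun X => nw (sw X)) ih
      simp only [sw_sw] at this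
      rw [this, sw_nw, nw_nw]
    rw [se_addLeft, sw_addLeft, ne_addLeft, nw_addLeft, e]
  | top _ ih =>
    rw [se_addTop, sw_addTop, ne_addTop, nw_addTop, ih, ne_nw]

/-- Patterns of an even number of dots at the endpoints of a tangle: no dots, dots at the two
left endpoints, at the two upper endpoints, or at the upper right and lower left endpoints. -/
inductive Dots
  | none
  | left
  | top
  | diagonal

namespace Dots

/-- A tangle with dots. -/
def on : Dots → Tangle → Tangle
  | none, T => T
  | left, T => nw (sw T)
  | top, T => nw (ne T)
  | diagonal, T => ne (sw T)

/-- The pattern of dots after moving the dots through a crossing on the left. -/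
def throughLeft : Dots → Dots
  | none => none
  | left => left
  | top => diagonal
  | diagonal => top

/-- The pattern of dots after moving the dots through a crossing above. -/
def throughTop : Dots → Dots
  | none => none
  | left => diagonal
  | top => top
  | diagonal => left

@[simp] theorem throughLeft_throughLeft (P : Dots) : P.throughLeft.throughLeft = P := by
  cases P <;> rfl

@[simp] theorem throughTop_throughTop (P : Dots) : P.throughTop.throughTop = P := by
  cases P <;> rfl

theorem on_addLeft (P : Dots) (s : Bool) (T : Tangle) :
    P.on (addLeft s T) = addLeft s (P.throughLeft.on T) := by
  cases P
  · rfl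
  · simp only [on, throughLeft, sw_addLeft, nw_addLeft, sw_nw]
  · simp only [on, throughLeft, ne_addLeft, nw_addLeft, sw_ne]
  · simp only [on, throughLeft, sw_addLeft, ne_addLeft, ne_nw]

theorem on_addTop (P : Dots) (s : Bool) (T : Tangle) :
    P.on (addTop s T) = addTop s (P.throughTop.on T) := by
  cases P
  · rfl
  · simp only [on, throughTop, sw_addTop, nw_addTop]
  · simp only [on, throughTop, ne_addTop, nw_addTop, ne_nw]
  · simp only [on, throughTop, sw_addTop, ne_addTop]

theorem addLeft_on (P : Dots) (s : Bool) (T : Tangle) :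
    addLeft s (P.on T) = P.throughLeft.on (addLeft s T) := by
  rw [on_addLeft, throughLeft_throughLeft]

/-- The flype survives dots: a crossing on the left moves the dots across the left endpoints, one on
the right across the right endpoints, and `Pos.sw_se` identifies the resulting patterns. -/
theorem commute_on (P : Dots) {s : Bool} {T : Tangle} {n d : ℕ} (h : Pos s T n d) :
    Commute (crossing s) (P.on T) := by
  have hc := h.commute.eq
  have h4 := h.sw_se
  change addLeft s (P.on T) = P.on T * crossing s
  rw [addLeft_on, addLeft_apply, hc]
  cases P
  · rfl
  · simp only [on, throughLeft, sw_mul, nw_mul]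
  · simp only [on, throughLeft]
    rw [sw_mul, ne_mul, ne_crossing, ← se_mul_eq, se_sw, h4]
  · simp only [on, throughLeft]
    rw [ne_mul, ne_crossing, ← se_mul_eq, nw_mul]
    have := congrArg (fun X => nw (sw X)) h4
    simp only [sw_sw] at this
    rw [this, sw_nw, nw_nw, sw_ne]

end Dots

/-! ### Closures -/

theorem runs_closure {w : List Slice} (h : Runs 2 w 2) :
    Runs 0 ([⟨cap, 0⟩] ++ w ++ [⟨cup, 0⟩]) 0 :=
  Runs.append (k := 2) (Runs.append (k := 2) (by simp [Runs]) h) (by simp [Runs])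

/-- The link obtained from a tangle by joining the upper endpoints and the lower endpoints. -/
def closure : Tangle → MarkedLink :=
  Quotient.lift (fun w => Diagram.link ⟨[⟨cap, 0⟩] ++ w.1 ++ [⟨cup, 0⟩], runs_closure w.2⟩)
    fun _ _ h => link_eq_of_isotopic _ _ (h.mid _ _ (by simp [Runs]) (by simp [Runs]))

theorem closure_mk {w : List Slice} (h : Runs 2 w 2) :
    closure (mk w h) = Diagram.link ⟨[⟨cap, 0⟩] ++ w ++ [⟨cup, 0⟩], runs_closure h⟩ := rfl

theorem closure_addTop_mul (s : Bool) (A B : Tangle) :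
    closure (addTop s A * B) = closure (A * addTop s B) := by
  induction A using ind with | _ a ha
  induction B using ind with | _ b hb
  exact link_eq_of_isotopic _ _ (isotopic_closure_transfer s ha hb)

theorem closure_addTop (s : Bool) (A : Tangle) : closure (addTop s A) = closure A := by
  have := closure_addTop_mul s A 1
  rwa [mul_one, addTop_one, mul_one] at this

theorem closure_nw (T : Tangle) : closure (nw T) = closure (ne T) := by
  induction T using ind with | _ w hw
  refine link_eq_of_isotopic _ _ ?_
  have m1 : Isotopic 0 2 [⟨cap, 0⟩, ⟨dot, 0⟩] [⟨cap, 0⟩, ⟨dot, 1⟩] := by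
    refine .of_move (LocalMove.dotCap 0) ?_ ?_ <;> simp [Runs]
  simpa using m1.right (w ++ [⟨cup, 0⟩]) (hw.append (m := 0) (by simp [Runs]))

theorem sw_infinity : sw infinity = nw infinity := rfl

/-- The closure is a single circle, on which the two dots meet and cancel. -/
theorem isTQA_closure_on_infinity (P : Dots) : IsTQA (closure (P.on infinity)) := by
  have h : closure (P.on infinity) = closure infinity := by
    cases P
    · rfl
    · simp [Dots.on, sw_infinity]
    · rw [Dots.on, closure_nw, ne_ne]
    · rw [Dots.on, ← closure_nw, sw_infinity, nw_nw]
  rw [h]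
  exact IsTQA.unknot

theorem isTQA_closure_on_crossing (P : Dots) (s : Bool) : IsTQA (closure (P.on (crossing s))) := by
  rw [← addTop_infinity, Dots.on_addTop, closure_addTop]
  exact isTQA_closure_on_infinity _

/-- The closure of the zero tangle is two disjoint circles, with one dot on each. All uses of the
splitting rule go through this link. -/
theorem isTQA_closure_left_on_one : IsTQA (closure (Dots.left.on 1)) :=
  IsTQA.split ⟨[⟨cap, 0⟩, ⟨dot, 0⟩, ⟨cup, 0⟩], by simp [Runs]⟩
    ⟨[⟨cap, 0⟩, ⟨dot, 0⟩, ⟨cup, 0⟩], by simp [Runs]⟩ (by simp [dotCount, dots])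
    (by simp [dotCount, dots])

end Tangle

/-! ### Colourings of tangle diagrams -/

section Colourings

variable {A : Type} [AddCommGroup A]

/-- The relation between the colours above and below an elementary piece. -/
inductive PieceColours : Piece → List A → List A → Prop
  | cap (a : A) : PieceColours cap [] [a, a]
  | cup (a : A) : PieceColours cup [a, a] []
  | crossOver (a b : A) : PieceColours crossOver [a, b] [a + a - b, a]
  | crossUnder (a b : A) : PieceColours crossUnder [a, b] [b, b + b - a]
  | dot (a : A) : PieceColours dot [a] [a]

theorem PieceColours.length {g : Piece} {p q : List A} (h : PieceColours g p q) :
    p.length = g.ins ∧ q.length = g.outs := by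
  cases h <;> exact ⟨rfl, rfl⟩

/-- The relation between the colours above and below a slice. -/
def SliceColours (s : Slice) (x z : List A) : Prop :=
  ∃ l p q r, l.length = s.pos ∧ x = l ++ p ++ r ∧ z = l ++ q ++ r ∧ PieceColours s.piece p q

/-- `IsColouring w x c y`: the lists `c` are the colours below the slices of `w` in a colouring of
`w` with upper colours `x` and lower colours `y`. -/
def IsColouring : List Slice → List A → List (List A) → List A → Prop
  | [], x, c, y => c = [] ∧ x = y
  | s :: w, x, c, y => ∃ z c', c = z :: c' ∧ SliceColours s x z ∧ IsColouring w z c' y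

theorem isColouring_append {u v : List Slice} {x y : List A} {c : List (List A)} :
    IsColouring (u ++ v) x c y ↔
      ∃ c₁ z c₂, c = c₁ ++ c₂ ∧ IsColouring u x c₁ z ∧ IsColouring v z c₂ y := by
  induction u generalizing x c with
  | nil =>
    constructor
    · intro h; exact ⟨[], x, c, rfl, ⟨rfl, rfl⟩, h⟩
    · rintro ⟨_, _, c₂, rfl, ⟨rfl, rfl⟩, h⟩; exact h
  | cons s u ih =>
    constructor
    · rintro ⟨z, c', rfl, hs, h⟩
      obtain ⟨c₁, z', c₂, rfl, h1, h2⟩ := ih.1 h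
      exact ⟨z :: c₁, z', c₂, rfl, ⟨z, c₁, rfl, hs, h1⟩, h2⟩
    · rintro ⟨_, z', c₂, rfl, ⟨z, c₁, rfl, hs, h1⟩, h2⟩
      exact ⟨z, c₁ ++ c₂, rfl, hs, ih.2 ⟨c₁, z', c₂, rfl, h1, h2⟩⟩

theorem IsColouring.length_eq {w : List Slice} {x y : List A} {c : List (List A)}
    (h : IsColouring w x c y) : c.length = w.length := by
  induction w generalizing x c with
  | nil => rw [h.1]; rfl
  | cons s w ih =>
    obtain ⟨z, c', rfl, _, h⟩ := h
    simp [ih h]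

theorem SliceColours.length_eq {s : Slice} {x z : List A} (h : SliceColours s x z) :
    z.length = x.length - s.piece.ins + s.piece.outs := by
  obtain ⟨l, p, q, r, hl, rfl, rfl, hp⟩ := h
  have := hp.length
  simp only [List.length_append]
  omega

/-- The bound `hx` keeps the piece inside `x`, so the frame `l`, `r` is untouched. The branches of
the list splitting that contradict this survive only when the overlap is empty. -/
theorem sliceColours_frame {g : Piece} {i k : ℕ} {l x r Z : List A} (hl : l.length = k)
    (hx : i + g.ins ≤ x.length) :
    SliceColours ⟨g, k + i⟩ (l ++ x ++ r) Z ↔ ∃ z, Z = l ++ z ++ r ∧ SliceColours ⟨g, i⟩ x z := by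
  constructor
  · rintro ⟨l', p, q, r', hl', e, rfl, hp⟩
    have hpl := hp.length
    simp only at hl' hpl hp
    rw [List.append_assoc, List.append_assoc, List.append_eq_append_iff] at e
    obtain ⟨l₁, rfl, e⟩ | ⟨l₁, e1, e2⟩ := e
    · have hl₁ : l₁.length = i := by simp at hl'; omega
      rw [← List.append_assoc, List.append_eq_append_iff] at e
      obtain ⟨b, e1, rfl⟩ | ⟨b, rfl, rfl⟩ := e
      · have : b = [] := by
          have := congrArg List.length e1
          simp at this
          exact List.eq_nil_of_length_eq_zero (by omega)
        subst this
        simp only [List.append_nil] at e1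
        subst e1
        exact ⟨l₁ ++ q, by simp, l₁, p, q, [], hl₁, by simp, by simp, hp⟩
      · exact ⟨l₁ ++ q ++ b, by simp, l₁, p, q, b, hl₁, by simp, by simp, hp⟩
    · have : l₁ = [] ∧ i = 0 := by
        have := congrArg List.length e1
        simp at this
        exact ⟨List.eq_nil_of_length_eq_zero (by omega), by omega⟩
      obtain ⟨rfl, rfl⟩ := this
      simp only [List.append_nil, List.nil_append] at e1 e2
      subst e1
      rw [List.append_eq_append_iff] at e2
      obtain ⟨b, rfl, e⟩ | ⟨b, e1, rfl⟩ := e2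
      · refine ⟨q ++ b, ?_, [], p, q, b, rfl, ?_, ?_, hp⟩ <;> simp_all
      · have : b = [] := by
          have := congrArg List.length e1
          simp at this
          exact List.eq_nil_of_length_eq_zero (by omega)
        subst this
        simp only [List.append_nil] at e1
        subst e1
        exact ⟨q, by simp, [], p, q, [], rfl, by simp, by simp, hp⟩
  · rintro ⟨z, rfl, l', p, q, r', hl', rfl, rfl, hp⟩
    exact ⟨l ++ l', p, q, r' ++ r, by simp_all, by simp, by simp, hp⟩

theorem isColouring_frame {w : List Slice} {n m k : ℕ} (hw : Runs n w m) {l x r Y : List A}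
    {c : List (List A)} (hl : l.length = k) (hx : x.length = n) :
    IsColouring (shift k w) (l ++ x ++ r) c Y ↔
      ∃ c' y, c = c'.map (fun z => l ++ z ++ r) ∧ Y = l ++ y ++ r ∧ IsColouring w x c' y := by
  induction w generalizing n x c with
  | nil =>
    constructor
    · rintro ⟨rfl, rfl⟩; exact ⟨[], x, rfl, rfl, rfl, rfl⟩
    · rintro ⟨_, _, rfl, rfl, rfl, rfl⟩; exact ⟨rfl, rfl⟩
  | cons s w ih =>
    obtain ⟨g, i⟩ := s
    obtain ⟨h1, h2⟩ := hw
    simp only at h1 h2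
    have hf := fun Z => sliceColours_frame (Z := Z) (r := r) (g := g) (i := i) hl (hx ▸ h1)
    constructor
    · rintro ⟨Z, c', rfl, hs, h⟩
      obtain ⟨z, rfl, hz⟩ := (hf Z).1 hs
      obtain ⟨c'', y, rfl, rfl, h'⟩ := (ih h2 (by rw [hz.length_eq, hx])).1 h
      exact ⟨z :: c'', y, rfl, rfl, z, c'', rfl, hz, h'⟩
    · rintro ⟨_, y, rfl, rfl, z, c'', rfl, hz, h'⟩
      exact ⟨l ++ z ++ r, _, rfl, (hf _).2 ⟨z, rfl, hz⟩,
        (ih h2 (by rw [hz.length_eq, hx])).2 ⟨c'', y, rfl, rfl, h'⟩⟩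

/-- The colourings of a tangle diagram are parametrised by the colour of the upper left endpoint
and a parameter in `I`; the functions `u` and `v` give the differences of the colours of the
endpoints in the horizontal and in the vertical direction. -/
def Colours (w : List Slice) {I : Type} (u v : I → A) : Prop :=
  ∃ φ : A → I → List (List A),
    (∀ a i j, u i = u j → v i = v j → φ a i = φ a j → i = j) ∧
    ∀ x c y, IsColouring w x c y ∧ x.length = 2 ↔
      ∃ a i, x = [a, a - u i] ∧ c = φ a i ∧ y = [a - v i, a - v i - u i]

namespace Colours

variable {I J : Type} {u v : I → A} {u' v' : J → A} {w w' : List Slice}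

theorem congr (h : Colours w u v) (e : J ≃ I) (hu : ∀ j, u' j = u (e j))
    (hv : ∀ j, v' j = v (e j)) : Colours w u' v' := by
  obtain ⟨φ, h1, h2⟩ := h
  refine ⟨fun a j => φ a (e j), fun a i j hij hij' h => e.injective ?_, fun x c y => ?_⟩
  · exact h1 a _ _ (by rw [← hu, ← hu, hij]) (by rw [← hv, ← hv, hij']) h
  · rw [h2]
    constructor
    · rintro ⟨a, i, rfl, rfl, rfl⟩
      exact ⟨a, e.symm i, by simp [hu], by simp, by simp [hu, hv]⟩
    · rintro ⟨a, i, rfl, rfl, rfl⟩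
      exact ⟨a, e i, by simp [hu], by simp, by simp [hu, hv]⟩

theorem infinity : Colours (A := A) [] (fun g : A => g) (fun _ => 0) := by
  refine ⟨fun _ _ => [], fun a i j h _ _ => h, fun x c y => ?_⟩
  constructor
  · rintro ⟨⟨rfl, rfl⟩, hx⟩
    obtain ⟨a, b, rfl⟩ := List.length_eq_two.1 hx
    exact ⟨a, a - b, by simp, rfl, by simp⟩
  · rintro ⟨a, i, rfl, rfl, rfl⟩
    exact ⟨⟨rfl, by simp⟩, rfl⟩

theorem sliceColours_cup {a b : A} {r z : List A} :
    SliceColours ⟨cup, 0⟩ (a :: b :: r) z ↔ a = b ∧ z = r := by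
  constructor
  · rintro ⟨l, p, q, r', hl, e, rfl, hp⟩
    obtain rfl := List.eq_nil_of_length_eq_zero hl
    cases hp with
    | cup c => simp at e; obtain ⟨rfl, rfl, rfl⟩ := e; simp
  · rintro ⟨rfl, rfl⟩
    exact ⟨[], [a, a], [], z, rfl, by simp, by simp, .cup a⟩

theorem sliceColours_cap {r z : List A} :
    SliceColours ⟨cap, 0⟩ r z ↔ ∃ a, z = a :: a :: r := by
  constructor
  · rintro ⟨l, p, q, r', hl, rfl, rfl, hp⟩
    obtain rfl := List.eq_nil_of_length_eq_zero hl
    cases hp with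
    | cap c => exact ⟨c, by simp⟩
  · rintro ⟨a, rfl⟩
    exact ⟨[], [], [a, a], r, rfl, by simp, by simp, .cap a⟩

theorem zero : Colours (A := A) zeroTangle (fun _ : A => 0) (fun g => -g) := by
  refine ⟨fun a g => [[], [a + g, a + g]], fun a i j _ h _ => neg_injective h, fun x c y => ?_⟩
  constructor
  · rintro ⟨⟨z, c', rfl, hz, z', c'', rfl, hz', rfl, rfl⟩, hx⟩
    obtain ⟨a, b, rfl⟩ := List.length_eq_two.1 hx
    obtain ⟨rfl, rfl⟩ := sliceColours_cup.1 hz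
    obtain ⟨b, rfl⟩ := sliceColours_cap.1 hz'
    exact ⟨a, b - a, by simp, by simp, by simp⟩
  · rintro ⟨a, i, rfl, rfl, rfl⟩
    exact ⟨⟨_, _, rfl, sliceColours_cup.2 ⟨by simp, rfl⟩, _, _, rfl,
      sliceColours_cap.2 ⟨a + i, rfl⟩, rfl, by simp⟩, rfl⟩

/-- The sign `1` or `-1` of a crossing. -/
def _root_.TwoFold.sign : Bool → ℤ
  | true => 1
  | false => -1

theorem sliceColours_xing (s : Bool) {a b : A} {r z : List A} :
    SliceColours ⟨xing s, 0⟩ (a :: b :: r) z ↔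
      z = (a + sign s • (a - b)) :: (b + sign s • (a - b)) :: r := by
  constructor
  · rintro ⟨l, p, q, r', hl, e, rfl, hp⟩
    obtain rfl := List.eq_nil_of_length_eq_zero hl
    cases s
    · cases hp with
      | crossUnder c d =>
        simp at e; obtain ⟨rfl, rfl, rfl⟩ := e; simp [sign]; abel
    · cases hp with
      | crossOver c d => simp at e; obtain ⟨rfl, rfl, rfl⟩ := e; simp [sign]; abel
  · rintro rfl
    cases s
    · refine ⟨[], [a, b], _, r, rfl, by simp, ?_, .crossUnder a b⟩
      simp [sign]; abel
    · refine ⟨[], [a, b], _, r, rfl, by simp, ?_, .crossOver a b⟩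
      simp [sign]; abel

/-- A crossing preserves the difference of its two colours and translates both by plus or minus that
difference; so `u` stays and `v` shifts by it. -/
theorem addTop (h : Colours w u v) (s : Bool) :
    Colours (⟨xing s, 0⟩ :: w) u (fun i => v i - sign s • u i) := by
  obtain ⟨φ, h1, h2⟩ := h
  refine ⟨fun a i => [a + sign s • u i, a - u i + sign s • u i] :: φ (a + sign s • u i) i,
    fun a i j hu hv hφ => ?_, fun x c y => ?_⟩
  · simp only [List.cons.injEq, hu] at hφ hv
    exact h1 _ i j hu (by simpa using hv) hφ.2
  constructor
  · rintro ⟨⟨z, c', rfl, hz, hw⟩, hx⟩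
    obtain ⟨a, b, rfl⟩ := List.length_eq_two.1 hx
    rw [sliceColours_xing] at hz
    subst hz
    obtain ⟨a', i, e, rfl, rfl⟩ := (h2 _ _ _).1 ⟨hw, rfl⟩
    simp only [List.cons.injEq, and_true] at e
    obtain ⟨rfl, e⟩ := e
    have e' : u i = a - b := by
      have : u i = (a + sign s • (a - b)) - (b + sign s • (a - b)) := by rw [e]; abel
      rw [this]; abel
    refine ⟨a, i, by simp [e'], by simp [e'], ?_⟩
    simp only [List.cons.injEq, and_true, e']
    constructor <;> abel
  · rintro ⟨a, i, rfl, rfl, rfl⟩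
    refine ⟨⟨_, _, rfl, (sliceColours_xing s).2 (by simp), ?_⟩, rfl⟩
    refine ((h2 _ _ _).2 ⟨a + sign s • u i, i, ?_, rfl, ?_⟩).1 <;>
    · simp only [List.cons.injEq, and_true]
      generalize sign s • u i = q
      constructor <;> first | trivial | abel

theorem sliceColours_dot {i : ℕ} {x z : List A} (hi : i < x.length) :
    SliceColours ⟨dot, i⟩ x z ↔ z = x := by
  constructor
  · rintro ⟨l, p, q, r, hl, rfl, rfl, hp⟩
    cases hp; rfl
  · rintro rfl
    refine ⟨z.take i, [z[i]], [z[i]], z.drop (i + 1), by simp; omega, ?_, ?_, .dot _⟩ <;> simp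

theorem dotTop (h : Colours w u v) {i : ℕ} (hi : i < 2) : Colours (⟨dot, i⟩ :: w) u v := by
  obtain ⟨φ, h1, h2⟩ := h
  refine ⟨fun a j => [a, a - u j] :: φ a j, fun a i j hu hv hφ => ?_, fun x c y => ?_⟩
  · exact h1 _ i j hu hv (List.cons.inj hφ).2
  constructor
  · rintro ⟨⟨z, c', rfl, hz, hw⟩, hx⟩
    rw [sliceColours_dot (by omega)] at hz
    subst hz
    obtain ⟨a, i, rfl, rfl, rfl⟩ := (h2 _ _ _).1 ⟨hw, hx⟩
    exact ⟨a, i, rfl, rfl, rfl⟩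
  · rintro ⟨a, j, rfl, rfl, rfl⟩
    exact ⟨⟨_, _, rfl, (sliceColours_dot (by exact hi)).2 rfl, ((h2 _ _ _).2 ⟨a, j, rfl, rfl, rfl⟩).1⟩,
      rfl⟩

theorem dotBottom (h : Colours w u v) {i : ℕ} (hi : i < 2) : Colours (w ++ [⟨dot, i⟩]) u v := by
  obtain ⟨φ, h1, h2⟩ := h
  refine ⟨fun a j => φ a j ++ [[a - v j, a - v j - u j]], fun a i j hu hv hφ => ?_,
    fun x c y => ?_⟩
  · exact h1 _ i j hu hv (List.append_inj_left' hφ rfl)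
  rw [isColouring_append]
  constructor
  · rintro ⟨⟨c₁, z, c₂, rfl, hw, ⟨z', c', rfl, hz, rfl, rfl⟩⟩, hx⟩
    obtain ⟨a, j, rfl, rfl, rfl⟩ := (h2 _ _ _).1 ⟨hw, hx⟩
    rw [sliceColours_dot (by exact hi)] at hz
    subst hz
    exact ⟨a, j, rfl, rfl, rfl⟩
  · rintro ⟨a, j, rfl, rfl, rfl⟩
    exact ⟨⟨_, _, _, rfl, ((h2 _ _ _).2 ⟨a, j, rfl, rfl, rfl⟩).1, _, _, rfl,
      (sliceColours_dot (by exact hi)).2 rfl, rfl, rfl⟩, rfl⟩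

/-- The upper connecting arc only fixes the base colour `a - u` of the second tangle. The lower one
imposes the single condition that the vertical differences agree. -/
theorem sum (h : Colours w u v) (h' : Colours w' u' v') (hw : Runs 2 w 2) (hw' : Runs 2 w' 2) :
    Colours (tangleSum w w') (I := {p : I × J // v p.1 = v' p.2})
      (fun p => u p.1.1 + u' p.1.2) (fun p => v p.1.1) := by
  obtain ⟨φ, h1, h2⟩ := h
  obtain ⟨φ', h1', h2'⟩ := h'
  have hlen : ∀ a i, (φ a i).length = w.length := fun a i =>
    ((h2 _ _ _).2 ⟨a, i, rfl, rfl, rfl⟩).1.length_eq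
  have hlen' : ∀ a i, (φ' a i).length = w'.length := fun a i =>
    ((h2' _ _ _).2 ⟨a, i, rfl, rfl, rfl⟩).1.length_eq
  have hcap : ∀ (a b : A) z, SliceColours ⟨cap, 1⟩ [a, b] z ↔ ∃ m, z = [a, m, m, b] := by
    intro a b z
    have := sliceColours_frame (g := cap) (i := 0) (k := 1) (l := [a]) (x := []) (r := [b])
      (Z := z) rfl (by simp)
    simp only [List.append_nil, List.cons_append, List.nil_append, sliceColours_cap] at this
    rw [this]
    exact ⟨fun ⟨z', e, m, e'⟩ => ⟨m, by rw [e, e']; rfl⟩, fun ⟨m, e⟩ => ⟨[m, m], by rw [e]; rfl, m, rfl⟩⟩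
  have hcup : ∀ (a b c d : A) z, SliceColours ⟨cup, 1⟩ [a, b, c, d] z ↔ b = c ∧ z = [a, d] := by
    intro a b c d z
    have := sliceColours_frame (g := cup) (i := 0) (k := 1) (l := [a]) (x := [b, c]) (r := [d])
      (Z := z) rfl (by simp)
    simp only [List.append_nil, List.cons_append, List.nil_append, sliceColours_cup] at this
    rw [this]
    exact ⟨fun ⟨z', e, m, e'⟩ => ⟨m, by rw [e, e']; rfl⟩, fun ⟨m, e⟩ => ⟨[], by rw [e]; rfl, m, rfl⟩⟩
  -- The four blocks are the levels below the cap, in the first tangle with the second at rest, in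
  -- the second with the first finished, and below the cup.
  refine ⟨fun a p => [[a, a - u p.1.1, a - u p.1.1, a - u p.1.1 - u' p.1.2]] ++
    (φ a p.1.1).map (fun z => [] ++ z ++ [a - u p.1.1, a - u p.1.1 - u' p.1.2]) ++
    (φ' (a - u p.1.1) p.1.2).map (fun z => [a - v p.1.1, a - v p.1.1 - u p.1.1] ++ z ++ []) ++
    [[a - v p.1.1, a - v p.1.1 - u p.1.1 - u' p.1.2]], ?_, fun x c y => ?_⟩
  · rintro a ⟨⟨i, j⟩, hij⟩ ⟨⟨i', j'⟩, hij'⟩ hu hv hφ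
    simp only at hij hij' hu hv hφ
    have hφ := List.append_inj_left' hφ rfl
    have k2 := List.append_inj_right' hφ (by simp [hlen'])
    have hφ := List.append_inj_left' hφ (by simp [hlen'])
    have k1 := List.append_inj_right' hφ (by simp [hlen])
    have hφ := List.append_inj_left' hφ (by simp [hlen])
    simp only [List.cons.injEq, sub_right_inj, and_true, true_and] at hφ
    obtain ⟨e, -, e'⟩ := hφ
    simp only [e, sub_right_inj] at e'
    simp only [e, e', hv] at k1 k2
    have k1 := List.map_injective_iff.2 (fun z z' h => by simpa using h) k1
    have k2 := List.map_injective_iff.2 (fun z z' h => by simpa using h) k2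
    obtain rfl := h1 _ _ _ e hv k1
    obtain rfl := h1' _ _ _ e' (hij.symm.trans hij') k2
    rfl
  · have hx2 : ∀ (a b : A) c z, IsColouring w [a, b] c z ↔ _ := fun a b c z =>
      (and_iff_left rfl).symm.trans (h2 [a, b] c z)
    have hx2' : ∀ (a b : A) c z, IsColouring w' [a, b] c z ↔ _ := fun a b c z =>
      (and_iff_left rfl).symm.trans (h2' [a, b] c z)
    have f1 := fun (a b c d : A) C Z => isColouring_frame hw (k := 0) (l := []) (x := [a, b]) (r := [c, d])
      (Y := Z) (c := C) rfl rfl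
    have f2 := fun (a b c d : A) C Z => isColouring_frame hw' (k := 2) (l := [a, b]) (x := [c, d]) (r := [])
      (Y := Z) (c := C) rfl rfl
    simp only [shift_zero] at f1
    simp only [tangleSum, isColouring_append]
    constructor
    · rintro ⟨⟨_, _, _, rfl, ⟨_, _, _, rfl, ⟨_, _, _, rfl, ⟨_, _, rfl, k1, rfl, rfl⟩, k2⟩, k3⟩,
        ⟨_, _, rfl, k4, rfl, rfl⟩⟩, hx⟩
      obtain ⟨a, b, rfl⟩ := List.length_eq_two.1 hx
      obtain ⟨m, rfl⟩ := (hcap _ _ _).1 k1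
      obtain ⟨c1, y1, rfl, rfl, k2'⟩ := (f1 _ _ _ _ _ _).1 k2
      obtain ⟨a', i, e, rfl, rfl⟩ := (hx2 _ _ _ _).1 k2'
      simp only [List.cons.injEq, and_true] at e
      obtain ⟨rfl, rfl⟩ := e
      obtain ⟨c2, y2, rfl, rfl, k3'⟩ := (f2 _ _ _ _ _ _).1 k3
      obtain ⟨a', j, e, rfl, rfl⟩ := (hx2' _ _ _ _).1 k3'
      simp only [List.cons.injEq, and_true] at e
      obtain ⟨rfl, rfl⟩ := e
      obtain ⟨e, rfl⟩ := (hcup _ _ _ _ _).1 k4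
      have e' : v i = v' j := by
        rw [sub_right_comm, sub_right_inj] at e
        exact e
      refine ⟨a, ⟨(i, j), e'⟩, ?_, ?_, ?_⟩
      · simp [sub_sub]
      · simp [e', sub_right_comm]
      · simp only [List.cons.injEq, and_true, true_and, e']
        abel
    · rintro ⟨a, ⟨⟨i, j⟩, hij⟩, rfl, rfl, rfl⟩
      simp only at hij
      refine ⟨⟨_, [a - v i, a - v i - u i, a - u i - v' j, a - u i - v' j - u' j], _, rfl,
        ⟨_, [a - v i, a - v i - u i, a - u i, a - u i - u' j], _, rfl, ⟨_, _, _, rfl, ⟨_, _, rfl,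
        (hcap _ _ _).2 ⟨a - u i, by simp [sub_sub]⟩, rfl, rfl⟩, ?_⟩, ?_⟩,
        ⟨_, _, rfl, ?_, rfl, by simp [sub_sub, add_assoc]⟩⟩, rfl⟩
      · exact (f1 _ _ _ _ _ _).2 ⟨_, _, rfl, rfl, (hx2 _ _ _ _).2 ⟨a, i, rfl, rfl, rfl⟩⟩
      · exact (f2 _ _ _ _ _ _).2 ⟨_, _, rfl, rfl, (hx2' _ _ _ _).2 ⟨a - u i, j, rfl, rfl, rfl⟩⟩
      · refine (hcup _ _ _ _ _).2 ⟨by rw [hij]; abel, ?_⟩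
        simp only [List.cons.injEq, and_true, true_and, hij]
        abel

/-- The upper arc forces `u = 0`, and then the two lower endpoints have equal colours automatically.
-/
theorem closure (h : Colours w u v) (x : A) :
    Nat.card {c : List (List A) // IsColouring ([⟨cap, 0⟩] ++ w ++ [⟨cup, 0⟩]) [] c [] ∧
      c.head? = some [x, x]} = Nat.card {i // u i = 0} := by
  obtain ⟨φ, h1, h2⟩ := h
  symm
  refine Nat.card_congr (Equiv.ofBijective (fun i => ⟨[[x, x]] ++ φ x i.1 ++ [[]], ?_, rfl⟩)
    ⟨?_, ?_⟩)
  · simp only [isColouring_append]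
    refine ⟨_, _, _, rfl, ⟨_, _, _, rfl, ⟨_, _, rfl, sliceColours_cap.2 ⟨x, rfl⟩, rfl, rfl⟩,
      ((h2 _ _ _).2 ⟨x, i.1, by simp [i.2], rfl, rfl⟩).1⟩, _, _, rfl,
      sliceColours_cup.2 ⟨?_, rfl⟩, rfl, rfl⟩
    simp [i.2]
  · rintro ⟨i, hi⟩ ⟨j, hj⟩ hij
    simp only [Subtype.mk.injEq] at hij
    have hij := List.append_inj_left' hij rfl
    have hij := List.append_cancel_left hij
    have key : ∀ i, u i = 0 → IsColouring w [x, x] (φ x i) [x - v i, x - v i] := fun i hi =>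
      ((h2 _ _ _).2 ⟨x, i, by simp [hi], rfl, by simp [hi]⟩).1
    -- The levels determine the lower colours, hence `v`. This supplies the hypothesis under which
    -- `φ` is injective.
    have hfun : ∀ (w : List Slice) (x : List A) c y y', IsColouring w x c y →
        IsColouring w x c y' → y = y' := by
      intro w
      induction w with
      | nil => rintro x c y y' ⟨_, rfl⟩ ⟨_, rfl⟩; rfl
      | cons s w ih =>
        rintro x c y y' ⟨z, c', rfl, _, hz⟩ ⟨z', c'', e, _, hz'⟩
        simp only [List.cons.injEq] at e
        obtain ⟨rfl, rfl⟩ := e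
        exact ih _ _ _ _ hz hz'
    have e := hfun _ _ _ _ _ (key i hi) (hij ▸ key j hj)
    have e' : v i = v j := by simpa using e
    exact Subtype.ext (h1 x i j (hi.trans hj.symm) e' hij)
  · rintro ⟨c, hc, hx⟩
    simp only [isColouring_append] at hc
    obtain ⟨_, _, _, rfl, ⟨_, _, _, rfl, ⟨_, _, rfl, k1, rfl, rfl⟩, k2⟩, _, _, rfl, k3, rfl, rfl⟩ :=
      hc
    obtain ⟨a, rfl⟩ := sliceColours_cap.1 k1
    obtain rfl : a = x := by simpa using hx
    obtain ⟨a', i, e, rfl, rfl⟩ := (h2 _ _ _).1 ⟨k2, rfl⟩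
    simp only [List.cons.injEq, and_true] at e
    obtain ⟨rfl, e⟩ := e
    exact ⟨⟨i, by simpa using e.symm⟩, rfl⟩

end Colours

end Colourings

/-! ### Counting homomorphisms -/

/-- The map is `q ↦ exp (2πiq)`. It transports the characters with values in `ℚ/ℤ`, known to
separate points, to `ℂˣ`. -/
theorem exists_injective_addCircle : ∃ f : AddCircle (1 : ℚ) →+ Additive ℂˣ,
    Function.Injective f := by
  let g : ℚ →+ Additive ℂˣ :=
    { toFun := fun q => Additive.ofMul (Units.mk0 (Complex.exp (2 * Real.pi * Complex.I * q))
        (Complex.exp_ne_zero _))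
      map_zero' := by
        apply Additive.toMul.injective
        ext
        simp
      map_add' := fun p q => by
        apply Additive.toMul.injective
        ext
        simp [mul_add, Complex.exp_add] }
  have hg : ∀ q, g q = 0 ↔ q ∈ AddSubgroup.zmultiples (1 : ℚ) := by
    intro q
    have h1 : g q = 0 ↔ Complex.exp (2 * Real.pi * Complex.I * q) = 1 := by
      constructor
      · intro h
        have := congrArg (fun x : Additive ℂˣ => ((Additive.toMul x : ℂˣ) : ℂ)) h
        simpa [g] using this
      · intro h
        apply Additive.toMul.injective
        ext
        simpa [g] using h
    rw [h1, Complex.exp_eq_one_iff, AddSubgroup.mem_zmultiples_iff]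
    have hpi : (2 * Real.pi * Complex.I : ℂ) ≠ 0 := Complex.two_pi_I_ne_zero
    constructor
    · rintro ⟨n, hn⟩
      refine ⟨n, ?_⟩
      rw [mul_comm] at hn
      have := mul_right_cancel₀ hpi hn
      have : q = n := by exact_mod_cast this
      simp [this]
    · rintro ⟨n, rfl⟩
      exact ⟨n, by simp [mul_comm]⟩
  refine ⟨QuotientAddGroup.lift _ g fun x hx => (hg x).2 hx, ?_⟩
  rw [injective_iff_map_eq_zero]
  intro a
  induction a using QuotientAddGroup.induction_on with
  | H q =>
    intro h
    have h : g q = 0 := h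
    exact (QuotientAddGroup.eq_zero_iff q).2 ((hg q).1 h)

theorem card_nsmul_eq {k : ℕ} (hk : 0 < k) (b : Additive ℂˣ) :
    Nat.card {a : Additive ℂˣ // k • a = b} = k := by
  have : NeZero k := ⟨hk.ne'⟩
  obtain ⟨z, hz⟩ := IsAlgClosed.exists_pow_nat_eq ((Additive.toMul b : ℂˣ) : ℂ) hk
  have hz0 : z ≠ 0 := by
    rintro rfl
    rw [zero_pow hk.ne'] at hz
    exact (Additive.toMul b).ne_zero hz.symm
  let z' : Additive ℂˣ := Additive.ofMul (Units.mk0 z hz0)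
  have hz' : k • z' = b := by
    apply Additive.toMul.injective
    ext
    simpa [z'] using hz
  have e : {a : Additive ℂˣ // k • a = b} ≃ rootsOfUnity k ℂ :=
    { toFun := fun a => ⟨Additive.toMul (a.1 - z'), by
        rw [mem_rootsOfUnity, ← toMul_nsmul, smul_sub, a.2, hz', sub_self]; rfl⟩
      invFun := fun r => ⟨Additive.ofMul r.1 + z', by
        rw [nsmul_add, hz', ← ofMul_pow, (mem_rootsOfUnity k r.1).1 r.2]; simp⟩
      left_inv := fun a => by ext; simp
      right_inv := fun r => by ext; simp }
  rw [Nat.card_congr e]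
  exact HasEnoughRootsOfUnity.natCard_rootsOfUnity ℂ k

/-- For finite groups this is duality. An infinite group has infinitely many characters, so both
cardinals are `0`, in agreement with the convention for infinite homology. -/
theorem natCard_addMonoidHom (G : Type) [AddCommGroup G] :
    Nat.card (G →+ Additive ℂˣ) = Nat.card G := by
  cases finite_or_infinite G with
  | inl hG =>
    rw [Nat.card_congr (AddMonoidHom.toMultiplicativeLeft (α := G) (β := ℂˣ))]
    exact CommGroup.card_monoidHom_of_hasEnoughRootsOfUnity (Multiplicative G) ℂ
  | inr hG =>
    rw [Nat.card_eq_zero_of_infinite (α := G)]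
    by_contra h
    have hpos : 0 < Nat.card (G →+ Additive ℂˣ) := Nat.pos_of_ne_zero h
    have hfin : Finite (G →+ Additive ℂˣ) := Nat.finite_of_card_ne_zero h
    have htor : Finite {a : Additive ℂˣ // Nat.card (G →+ Additive ℂˣ) • a = 0} :=
      Nat.finite_of_card_ne_zero (by rw [card_nsmul_eq hpos]; exact h)
    -- If there were only finitely many characters, their number would kill every character, so all
    -- values would lie in a finite group of roots of unity. As characters separate points,
    -- evaluation would embed `G` in a finite set.
    let ev : G → ((G →+ Additive ℂˣ) → {a : Additive ℂˣ // Nat.card (G →+ Additive ℂˣ) • a = 0}) :=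
      fun x φ => ⟨φ x, by
        exact DFunLike.congr_fun (card_nsmul_eq_zero' (x := φ)) x⟩
    obtain ⟨f, hf⟩ := exists_injective_addCircle
    have hev : Function.Injective ev := by
      intro x y hxy
      by_contra hne
      obtain ⟨c, hc⟩ := CharacterModule.exists_character_apply_ne_zero_of_ne_zero
        (sub_ne_zero.2 hne)
      let c' : G →+ AddCircle (1 : ℚ) := c
      have := congrArg Subtype.val (congrFun hxy (f.comp c'))
      simp only [ev, AddMonoidHom.comp_apply] at this
      have : c' x = c' y := hf this
      exact hc (show c' (x - y) = 0 by rw [map_sub, this, sub_self])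
    exact not_finite_iff_infinite.2 hG (Finite.of_injective ev hev)

/-! ### The determinant and colourings -/

/-- The colourings of the points of a diagram. -/
def Diagram.IsColouring (D : Diagram) {A : Type} [AddCommGroup A] (f : D.Node → A) : Prop :=
  (∀ a b : D.Node, Joined D.word a.1 b.1 → f a = f b) ∧
    ∀ a o b : D.Node, PassesUnder D.word a.1 o.1 b.1 → f a + f b = f o + f o

/-- A character of the group of colour differences is the same as a colouring by `ℂˣ` normalised at
one point, and a group has as many characters as elements. -/
theorem Diagram.det_eq_natCard (D : Diagram) (n₀ : D.Node) :
    D.det = Nat.card {f : D.Node → Additive ℂˣ // D.IsColouring f ∧ f n₀ = 0} := by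
  classical
  rw [Diagram.det, ← natCard_addMonoidHom,
    Nat.card_congr (addMonoidHomLequivInt ℤ (A := D.reducedColouringGroup)
      (B := Additive ℂˣ)).toEquiv]
  symm
  have hker : ∀ f : D.Node → Additive ℂˣ, D.IsColouring f →
      Submodule.span ℤ D.colouringRelations ≤
        LinearMap.ker (Finsupp.lift (Additive ℂˣ) ℤ D.Node f) := by
    rintro f ⟨h1, h2⟩
    rw [Submodule.span_le]
    rintro x (⟨a, b, h, rfl⟩ | ⟨a, o, b, h, rfl⟩)
    · simp only [SetLike.mem_coe, LinearMap.mem_ker, map_sub, Finsupp.lift_apply,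
        Finsupp.sum_single_index, zero_smul, one_smul, h1 a b h, sub_self]
    · have := h2 a o b h
      simp only [SetLike.mem_coe, LinearMap.mem_ker, map_sub, map_add, map_nsmul,
        Finsupp.lift_apply, Finsupp.sum_single_index, zero_smul, one_smul, two_smul, this, sub_self]
  let Φ : {f : D.Node → Additive ℂˣ // D.IsColouring f ∧ f n₀ = 0} →
      (D.reducedColouringGroup →ₗ[ℤ] Additive ℂˣ) := fun f =>
    ((Submodule.span ℤ D.colouringRelations).liftQ _ (hker f.1 f.2.1)).comp
      D.reducedColouringGroup.subtype
  have hmem : ∀ a b : D.Node, (Submodule.Quotient.mk (Finsupp.single a 1 - Finsupp.single b 1) :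
      D.ColouringGroup) ∈ D.reducedColouringGroup := fun a b =>
    Submodule.subset_span ⟨(a, b), rfl⟩
  have hΦ : ∀ f a b, Φ f ⟨_, hmem a b⟩ = f.1 a - f.1 b := by
    intro f a b
    simp [Φ]
  refine Nat.card_congr (Equiv.ofBijective Φ ⟨?_, ?_⟩)
  · intro f g h
    refine Subtype.ext (funext fun a => ?_)
    have := hΦ f a n₀
    rw [h, hΦ, f.2.2, g.2.2, sub_zero, sub_zero] at this
    exact this.symm
  · intro φ
    have hrel : ∀ x ∈ D.colouringRelations,
        (Submodule.Quotient.mk x : D.ColouringGroup) = 0 := fun x hx =>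
      (Submodule.Quotient.mk_eq_zero _).2 (Submodule.subset_span hx)
    let f : D.Node → Additive ℂˣ := fun a => φ ⟨_, hmem a n₀⟩
    have hf : ∀ a b, φ ⟨_, hmem a b⟩ = f a - f b := by
      intro a b
      simp only [f, ← map_sub]
      congr 1
      ext
      simp only [AddSubgroupClass.coe_sub, ← Submodule.Quotient.mk_sub]
      congr 1
      abel
    have hcol : D.IsColouring f := by
      constructor
      · intro a b h
        rw [← sub_eq_zero, ← hf]
        have := hrel _ (Or.inl ⟨a, b, h, rfl⟩)
        simp only [this]
        exact map_zero φ
      · intro a o b h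
        rw [← sub_eq_zero, add_sub_add_comm, ← hf, ← hf, ← map_add]
        have := hrel _ (Or.inr ⟨a, o, b, h, rfl⟩)
        convert map_zero φ
        ext
        simp only [Submodule.coe_add, ZeroMemClass.coe_zero, ← Submodule.Quotient.mk_add]
        rw [← this]
        congr 1
        rw [two_smul]
        abel
    have hf0 : f n₀ = 0 := by
      exact (hf n₀ n₀).trans (sub_self _)
    refine ⟨⟨f, hcol, hf0⟩, ?_⟩
    ext ⟨x, hx⟩
    have : Φ ⟨f, hcol, hf0⟩ ⟨x, hx⟩ = φ ⟨x, hx⟩ := by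
      induction hx using Submodule.span_induction with
      | mem x hx =>
        obtain ⟨⟨a, b⟩, rfl⟩ := hx
        exact (hΦ _ a b).trans (hf a b).symm
      | zero => exact (map_zero _).trans (map_zero _).symm
      | add x y hx hy h1 h2 =>
        have e : (⟨x + y, add_mem hx hy⟩ : D.reducedColouringGroup) = ⟨x, hx⟩ + ⟨y, hy⟩ := rfl
        rw [e, map_add, map_add, h1, h2]
      | smul r x hx h1 =>
        have e : (⟨r • x, Submodule.smul_mem _ r hx⟩ : D.reducedColouringGroup) = r • ⟨x, hx⟩ := rfl
        rw [e, map_smul, map_smul, h1]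
    rw [this]

/-! ### Colourings of points and colourings by levels -/

theorem strandsAfter_append (n : ℕ) (u v : List Slice) :
    strandsAfter n (u ++ v) = strandsAfter (strandsAfter n u) v := by
  induction u generalizing n with
  | nil => rfl
  | cons s u ih => exact ih _

theorem strandsAfter_take_succ (n : ℕ) {w : List Slice} {k : ℕ} {s : Slice}
    (hk : w[k]? = some s) :
    strandsAfter n (w.take (k + 1)) =
      strandsAfter n (w.take k) - s.piece.ins + s.piece.outs := by
  rw [List.take_add_one, strandsAfter_append, hk]
  rfl

theorem Runs.strandsAfter_eq {n m : ℕ} {w : List Slice} (h : Runs n w m) :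
    strandsAfter n w = m := by
  induction w generalizing n with
  | nil => exact h
  | cons s w ih => exact ih h.2

theorem Runs.pos_add_ins_le {n m k : ℕ} {w : List Slice} {s : Slice} (h : Runs n w m)
    (hk : w[k]? = some s) : s.pos + s.piece.ins ≤ strandsAfter n (w.take k) := by
  induction w generalizing n k with
  | nil => simp at hk
  | cons t w ih =>
    cases k with
    | zero => simp at hk; subst hk; exact h.1
    | succ k => exact ih h.2 hk

/-- The list of the first `n` values of a function. -/
def valueList {A : Type} (F : ℕ → A) (n : ℕ) : List A := (List.range n).map F

theorem valueList_add {A : Type} (F : ℕ → A) (n m : ℕ) :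
    valueList F (n + m) = valueList F n ++ valueList (fun j => F (n + j)) m := by
  simp [valueList, List.range_add, Function.comp_def]

theorem valueList_congr {A : Type} {F G : ℕ → A} {n : ℕ} (h : ∀ j < n, F j = G j) :
    valueList F n = valueList G n :=
  List.map_congr_left fun j hj => h j (List.mem_range.1 hj)

section

variable {A : Type} [AddCommGroup A]

/-- Prepending the upper colours `x` makes entry `k` the level below the first `k` slices, which
matches the indexing of the points of a diagram. -/
theorem isColouring_iff {w : List Slice} {x y : List A} {c : List (List A)} :
    IsColouring w x c y ↔ c.length = w.length ∧
      (∀ k s, w[k]? = some s →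
        SliceColours s ((x :: c).getD k []) ((x :: c).getD (k + 1) [])) ∧
      (x :: c).getD w.length [] = y := by
  induction w generalizing x c with
  | nil =>
    constructor
    · rintro ⟨rfl, rfl⟩; simp
    · rintro ⟨h, _, h'⟩; exact ⟨List.eq_nil_of_length_eq_zero h, by simpa using h'⟩
  | cons t w ih =>
    constructor
    · rintro ⟨z, c', rfl, hs, h⟩
      obtain ⟨h1, h2, h3⟩ := ih.1 h
      refine ⟨by simp [h1], fun k s hk => ?_, by simpa using h3⟩
      cases k with
      | zero => simp at hk; subst hk; simpa using hs
      | succ k => exact h2 k s hk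
    · rintro ⟨h1, h2, h3⟩
      cases c with
      | nil => simp at h1
      | cons z c' =>
        refine ⟨z, c', rfl, by simpa using h2 0 t rfl, ih.2 ⟨by simpa using h1, fun k s hk => ?_,
          by simpa using h3⟩⟩
        exact h2 (k + 1) s hk

theorem IsColouring.length_level {w : List Slice} {x y : List A} {c : List (List A)}
    (h : IsColouring w x c y) {k : ℕ} (hk : k ≤ w.length) :
    ((x :: c).getD k []).length = strandsAfter x.length (w.take k) := by
  obtain ⟨_, h2, _⟩ := isColouring_iff.1 h
  induction k with
  | zero => simp [strandsAfter]
  | succ k ih =>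
    have hs : w[k]? = some w[k] := List.getElem?_eq_getElem (by omega)
    rw [(h2 k _ hs).length_eq, ih (by omega), strandsAfter_take_succ _ hs]

theorem Joined.colours_eq {w : List Slice} {L : ℕ → List A}
    (hL : ∀ k s, w[k]? = some s → SliceColours s (L k) (L (k + 1))) {a b : ℕ × ℕ}
    (h : Joined w a b) : (L a.1).getD a.2 0 = (L b.1).getD b.2 0 := by
  cases h with
  | left h hj =>
    obtain ⟨l, p, q, r, hl, e, e', hp⟩ := hL _ _ h
    simp only at hl
    subst hl
    simp only [e, e', List.append_assoc]
    rw [List.getD_append _ _ _ _ hj, List.getD_append _ _ _ _ hj]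
  | right j h =>
    obtain ⟨l, p, q, r, hl, e, e', hp⟩ := hL _ _ h
    have := hp.length
    simp only at hl this
    simp only [e, e']
    rw [List.getD_append_right _ _ _ _ (by simp; omega), List.getD_append_right _ _ _ _ (by simp; omega)]
    congr 1
    simp only [List.length_append]
    omega
  | cap h =>
    obtain ⟨l, p, q, r, hl, e, e', hp⟩ := hL _ _ h
    cases hp
    simp only at hl
    subst hl
    simp [e', List.getD_append_right]
  | cup h =>
    obtain ⟨l, p, q, r, hl, e, e', hp⟩ := hL _ _ h
    cases hp
    simp only at hl
    subst hl
    simp [e, List.getD_append_right]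
  | dot h =>
    obtain ⟨l, p, q, r, hl, e, e', hp⟩ := hL _ _ h
    cases hp
    simp [e, e']
  | crossOver h =>
    obtain ⟨l, p, q, r, hl, e, e', hp⟩ := hL _ _ h
    cases hp
    simp only at hl
    subst hl
    simp [e, e', List.getD_append_right]
  | crossUnder h =>
    obtain ⟨l, p, q, r, hl, e, e', hp⟩ := hL _ _ h
    cases hp
    simp only at hl
    subst hl
    simp [e, e', List.getD_append_right]

theorem PassesUnder.colours_eq {w : List Slice} {L : ℕ → List A}
    (hL : ∀ k s, w[k]? = some s → SliceColours s (L k) (L (k + 1))) {a o b : ℕ × ℕ}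
    (h : PassesUnder w a o b) : (L a.1).getD a.2 0 + (L b.1).getD b.2 0 =
      (L o.1).getD o.2 0 + (L o.1).getD o.2 0 := by
  cases h with
  | crossOver h =>
    obtain ⟨l, p, q, r, hl, e, e', hp⟩ := hL _ _ h
    cases hp
    simp only at hl
    subst hl
    simp [e, e', List.getD_append_right]
  | crossUnder h =>
    obtain ⟨l, p, q, r, hl, e, e', hp⟩ := hL _ _ h
    cases hp
    simp only at hl
    subst hl
    simp [e, e', List.getD_append_right]

theorem getD_valueList (F : ℕ → A) {n j : ℕ} (h : j < n) : (valueList F n).getD j 0 = F j := by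
  simp [valueList, List.getD_eq_getElem?_getD, h]

theorem eq_of_getD_eq {x y : List A} (h : x.length = y.length)
    (h' : ∀ j < x.length, x.getD j 0 = y.getD j 0) : x = y := by
  refine List.ext_getElem h fun j h1 h2 => ?_
  have := h' j h1
  rwa [List.getD_eq_getElem _ _ h1, List.getD_eq_getElem _ _ h2] at this

/-- The passage from a colouring of points back to lists of levels. `F` is total for convenience,
and its values outside the diagram are never read. -/
theorem Diagram.sliceColours_valueList (D : Diagram) (F : ℕ → ℕ → A)
    (h1 : ∀ a b : D.Node, Joined D.word a.1 b.1 → F a.1.1 a.1.2 = F b.1.1 b.1.2)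
    (h2 : ∀ a o b : D.Node, PassesUnder D.word a.1 o.1 b.1 →
      F a.1.1 a.1.2 + F b.1.1 b.1.2 = F o.1.1 o.1.2 + F o.1.1 o.1.2)
    {k : ℕ} {s : Slice} (hk : D.word[k]? = some s) :
    SliceColours s (valueList (F k) (strandsAfter 0 (D.word.take k)))
      (valueList (F (k + 1)) (strandsAfter 0 (D.word.take (k + 1)))) := by
  obtain ⟨g, i⟩ := s
  have hle := D.closed.pos_add_ins_le hk
  have hsucc := strandsAfter_take_succ 0 hk
  simp only at hle hsucc
  obtain ⟨R, hR⟩ := Nat.exists_eq_add_of_le hle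
  have hR' : strandsAfter 0 (D.word.take (k + 1)) = i + g.outs + R := by omega
  have h1' : ∀ {a b : ℕ × ℕ}, Joined D.word a b → a.2 < strandsAfter 0 (D.word.take a.1) →
      b.2 < strandsAfter 0 (D.word.take b.1) → F a.1 a.2 = F b.1 b.2 := fun h ha hb =>
    h1 ⟨_, ha⟩ ⟨_, hb⟩ h
  have h2' : ∀ {a o b : ℕ × ℕ}, PassesUnder D.word a o b →
      a.2 < strandsAfter 0 (D.word.take a.1) → o.2 < strandsAfter 0 (D.word.take o.1) →
      b.2 < strandsAfter 0 (D.word.take b.1) →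
      F a.1 a.2 + F b.1 b.2 = F o.1 o.2 + F o.1 o.2 := fun h ha ho hb =>
    h2 ⟨_, ha⟩ ⟨_, ho⟩ ⟨_, hb⟩ h
  rw [hR, hR', valueList_add, valueList_add, valueList_add, valueList_add]
  refine ⟨valueList (F k) i, valueList (fun j => F k (i + j)) g.ins,
    valueList (fun j => F (k + 1) (i + j)) g.outs, valueList (fun j => F k (i + g.ins + j)) R,
    by simp [valueList], rfl, ?_, ?_⟩
  · congr 1
    · congr 1
      refine (valueList_congr fun j hj => ?_).symm
      exact h1' (.left hk hj) (by simp only; omega) (by simp only; omega)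
    · refine (valueList_congr fun j hj => ?_).symm
      exact h1' (.right j hk) (by simp only; omega) (by simp only; omega)
  · clear h1 h2 hle hsucc
    cases g <;> simp only [ins, outs] at hR hR'
    · have e := h1' (.cap hk) (by simp only; omega) (by simp only; omega)
      simp only at e
      simp only [valueList, ins, outs, List.range_succ, List.range_zero, List.map_nil,
        List.nil_append, List.cons_append, List.map_cons, add_zero, ← e]
      exact .cap _
    · have e := h1' (.cup hk) (by simp only; omega) (by simp only; omega)
      simp only at e
      simp only [valueList, ins, outs, List.range_succ, List.range_zero, List.map_nil,
        List.nil_append, List.cons_append, List.map_cons, add_zero, ← e]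
      exact .cup _
    · have e1 := h1' (.crossOver hk) (by simp only; omega)
        (by simp only; omega)
      have e2 := h2' (.crossOver hk) (by simp only; omega)
        (by simp only; omega) (by simp only; omega)
      simp only at e1 e2
      simp only [valueList, ins, outs, List.range_succ, List.range_zero, List.map_nil,
        List.nil_append, List.cons_append, List.map_cons, add_zero, ← e1]
      rw [← eq_sub_iff_add_eq'] at e2
      rw [e2]
      exact .crossOver _ _
    · have e1 := h1' (.crossUnder hk) (by simp only; omega)
        (by simp only; omega)
      have e2 := h2' (.crossUnder hk) (by simp only; omega)
        (by simp only; omega) (by simp only; omega)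
      simp only at e1 e2
      simp only [valueList, ins, outs, List.range_succ, List.range_zero, List.map_nil,
        List.nil_append, List.cons_append, List.map_cons, add_zero, ← e1]
      rw [← eq_sub_iff_add_eq'] at e2
      rw [e2]
      exact .crossUnder _ _
    · have e := h1' (.dot hk) (by simp only; omega) (by simp only; omega)
      simp only at e
      simp only [valueList, ins, outs, List.range_succ, List.range_zero, List.map_nil,
        List.nil_append, List.cons_append, List.map_cons, add_zero, ← e]
      exact .dot _

end

/-- Normalising at the left end of the top cap makes colourings of points correspond to colourings
by levels starting with `[0, 0]`, which `Colours.closure` counts. -/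
theorem det_closure_eq {w : List Slice} (hw : Runs 2 w 2) {I : Type} {u v : I → Additive ℂˣ}
    (h : Colours w u v) :
    (⟨[⟨cap, 0⟩] ++ w ++ [⟨cup, 0⟩], Tangle.runs_closure hw⟩ : Diagram).det =
      Nat.card {i // u i = 0} := by
  rw [← h.closure 0]
  set D : Diagram := ⟨[⟨cap, 0⟩] ++ w ++ [⟨cup, 0⟩], Tangle.runs_closure hw⟩ with hD
  have hword : D.word = [⟨cap, 0⟩] ++ w ++ [⟨cup, 0⟩] := rfl
  let n₀ : D.Node := ⟨(1, 0), by simp [hword, strandsAfter]⟩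
  rw [D.det_eq_natCard n₀, ← hword]
  symm
  -- A closed diagram has no strands above its first slice, nor from the end of the word onwards.
  have hnode : ∀ a : D.Node, 1 ≤ a.1.1 ∧ a.1.1 ≤ D.word.length := by
    rintro ⟨⟨k, j⟩, h⟩
    simp only at h ⊢
    constructor
    · by_contra h'
      obtain rfl : k = 0 := by omega
      simp [strandsAfter] at h
    · by_contra h'
      rw [List.take_of_length_le (by omega), D.closed.strandsAfter_eq] at h
      omega
  let Ψ : {c : List (List (Additive ℂˣ)) // IsColouring D.word [] c [] ∧ c.head? = some [0, 0]} →
      {f : D.Node → Additive ℂˣ // D.IsColouring f ∧ f n₀ = 0} := fun c =>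
    ⟨fun a => (([] :: c.1).getD a.1.1 []).getD a.1.2 0, by
      have h2 := (isColouring_iff.1 c.2.1).2.1
      refine ⟨⟨fun a b h => ?_, fun a o b h => ?_⟩, ?_⟩
      · exact h.colours_eq (L := fun k => ([] :: c.1).getD k []) h2
      · exact h.colours_eq (L := fun k => ([] :: c.1).getD k []) h2
      · obtain ⟨c, h, hc⟩ := c
        cases c with
        | nil => simp at hc
        | cons z c => simp at hc; subst hc; simp [n₀]⟩
  refine Nat.card_congr (Equiv.ofBijective Ψ ⟨?_, ?_⟩)
  · rintro ⟨c, h, hc⟩ ⟨c', h', hc'⟩ e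
    refine Subtype.ext (List.ext_getElem (h.length_eq.trans h'.length_eq.symm) fun k h1 h2 => ?_)
    simp only at h1 h2 ⊢
    have hk : k + 1 ≤ D.word.length := by rw [← h.length_eq]; omega
    have l1 := h.length_level hk
    have l2 := h'.length_level hk
    have g1 : ([] :: c).getD (k + 1) [] = (c)[k] := by simp [h1]
    have g2 : ([] :: c').getD (k + 1) [] = (c')[k] := by simp [h2]
    rw [g1] at l1
    rw [g2] at l2
    refine eq_of_getD_eq (l1.trans l2.symm) fun j hj => ?_
    have := congrFun (congrArg Subtype.val e) ⟨(k + 1, j), by rw [← List.length_nil, ← l1]; exact hj⟩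
    simp only [Ψ, g1, g2] at this
    exact this
  · rintro ⟨f, hf, hf0⟩
    classical
    let F : ℕ → ℕ → Additive ℂˣ := fun k j =>
      if h : j < strandsAfter 0 (D.word.take k) then f ⟨(k, j), h⟩ else 0
    have hF : ∀ a : D.Node, F a.1.1 a.1.2 = f a := fun a => dif_pos a.2
    let L : ℕ → List (Additive ℂˣ) := fun k => valueList (F k) (strandsAfter 0 (D.word.take k))
    let c : List (List (Additive ℂˣ)) := (List.range D.word.length).map fun k => L (k + 1)
    have hL0 : L 0 = [] := rfl
    have hL : ∀ k ≤ D.word.length, ([] :: c).getD k [] = L k := by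
      intro k hk
      cases k with
      | zero => rfl
      | succ k =>
        have : k < D.word.length := by omega
        simp [c, List.getD_eq_getElem?_getD, this]
    have hc : IsColouring D.word [] c [] := by
      refine isColouring_iff.2 ⟨by simp [c], fun k s hk => ?_, ?_⟩
      · have hk' : k < D.word.length := (List.getElem?_eq_some_iff.1 hk).1
        rw [hL k hk'.le, hL (k + 1) hk']
        refine D.sliceColours_valueList F ?_ ?_ hk
        · intro a b h
          rw [hF, hF]; exact hf.1 a b h
        · intro a o b h
          rw [hF, hF, hF]; exact hf.2 a o b h
      · rw [hL _ le_rfl]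
        simp [L, D.closed.strandsAfter_eq, valueList]
    have key : ∀ a : D.Node, (([] :: c).getD a.1.1 []).getD a.1.2 0 = f a := by
      intro a
      rw [hL _ (hnode a).2, ← hF]
      exact getD_valueList _ a.2
    refine ⟨⟨c, hc, ?_⟩, Subtype.ext (funext key)⟩
    have h0 := key n₀
    rw [hf0] at h0
    have hcap := (isColouring_iff.1 hc).2.1 0 ⟨cap, 0⟩ rfl
    rw [List.getD_cons_zero, Colours.sliceColours_cap] at hcap
    obtain ⟨a, ha⟩ := hcap
    have ha' : c.getD 0 [] = [a, a] := ha
    simp only [n₀, ha] at h0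
    simp only [List.getD_cons_zero] at h0
    rw [h0] at ha'
    rw [List.head?_eq_getElem?]
    have hlen : 0 < c.length := by simp [c, hword]
    rw [List.getD_eq_getElem _ _ hlen] at ha'
    rw [List.getElem?_eq_getElem hlen, ha']

/-! ### Counting colourings of sums of tangles -/

/-- The group in which colours are taken. -/
def ColourGroup : Type := Additive ℂˣ

instance : AddCommGroup ColourGroup := inferInstanceAs (AddCommGroup (Additive ℂˣ))

/-- The colours of the diagram are those of a rational tangle of fraction `n / d`. -/
def RationalColours (w : List Slice) (n d : ℤ) : Prop :=
  Colours w (fun g : ColourGroup => n • g) (fun g => -(d • g))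

/-- The numbers of colourings of the diagram are those of a tangle of fraction `N / D`. -/
def CountsColours (w : List Slice) (N D : ℤ) : Prop :=
  ∃ (I : Type) (u v : I → ColourGroup), Colours w u v ∧
    ∀ α β : ℤ, Nat.card {i // α • u i + β • v i = 0} = (α * N - β * D).natAbs

theorem card_nsmul_eq' {k : ℕ} (hk : 0 < k) (b : ColourGroup) :
    Nat.card {a : ColourGroup // k • a = b} = k := card_nsmul_eq hk b

instance : Infinite ColourGroup := by
  by_contra h
  rw [not_infinite_iff_finite] at h
  -- In a finite group of order `c` the equation `(c + 1) a = 0` would have `c + 1` solutions.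
  have h1 := card_nsmul_eq' (k := Nat.card ColourGroup + 1) (by omega) 0
  have h2 := Finite.card_subtype_le (fun a : ColourGroup => (Nat.card ColourGroup + 1) • a = 0)
  omega

theorem card_zsmul_eq {k : ℤ} (hk : k ≠ 0) (b : ColourGroup) :
    Nat.card {a : ColourGroup // k • a = b} = k.natAbs := by
  rcases Int.natAbs_eq k with h | h
  · rw [← card_nsmul_eq' (Int.natAbs_pos.2 hk) b]
    refine Nat.card_congr (Equiv.subtypeEquivRight fun a => ?_)
    rw [h, natCast_zsmul, Int.natAbs_natCast]
  · rw [← card_nsmul_eq' (Int.natAbs_pos.2 hk) (-b)]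
    refine Nat.card_congr (Equiv.subtypeEquivRight fun a => ?_)
    rw [h, Int.natAbs_neg, neg_smul, natCast_zsmul, Int.natAbs_natCast, neg_eq_iff_eq_neg]

theorem RationalColours.countsColours {w : List Slice} {n d : ℤ} (h : RationalColours w n d) :
    CountsColours w n d := by
  refine ⟨_, _, _, h, fun α β => ?_⟩
  have e : ∀ g : ColourGroup, α • n • g + β • (-(d • g)) = (α * n - β * d) • g := fun g => by
    rw [sub_smul, mul_smul, mul_smul, smul_neg]; abel
  simp only [e]
  -- When the coefficient vanishes every colour is a solution, and the infinite cardinal counts as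
  -- `0`.
  by_cases h0 : α * n - β * d = 0
  · rw [h0, Int.natAbs_zero, Nat.card_eq_zero]
    exact .inr (Infinite.of_injective (fun g : ColourGroup => ⟨g, by simp⟩)
      fun a b h => congrArg Subtype.val h)
  · exact card_zsmul_eq h0 0

/-- Counting solutions of the equations that govern the sum of a rational tangle and another
tangle. -/
theorem card_sum_solutions {J : Type} {u v : J → ColourGroup} {n d N D : ℤ} (hnd : n ≠ 0 ∨ d ≠ 0)
    (h : ∀ α β : ℤ, Nat.card {j // α • u j + β • v j = 0} = (α * N - β * D).natAbs) (α β : ℤ) :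
    Nat.card {p : ColourGroup × J // -(d • p.1) = v p.2 ∧
        α • (n • p.1 + u p.2) + β • v p.2 = 0} =
      (α * (n * D + d * N) - β * (d * D)).natAbs := by
  -- Here the parameter of the rational tangle is unconstrained, so the solution set is empty or
  -- infinite. Its cardinal is `0`, as is the right side.
  by_cases h0 : d = 0 ∧ α = 0
  · obtain ⟨rfl, rfl⟩ := h0
    have e : {p : ColourGroup × J // -((0 : ℤ) • p.1) = v p.2 ∧
        (0 : ℤ) • (n • p.1 + u p.2) + β • v p.2 = 0} ≃ ColourGroup × {j // v j = 0} :=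
      { toFun := fun p => (p.1.1, ⟨p.1.2, by simpa using p.2.1.symm⟩)
        invFun := fun p => ⟨(p.1, p.2.1), by simp [p.2.2]⟩
        left_inv := fun p => rfl
        right_inv := fun p => rfl }
    rw [Nat.card_congr e, Nat.card_prod, Nat.card_eq_zero_of_infinite]
    simp
  have hg : Int.gcd d (α * n) ≠ 0 := by
    intro hg
    rw [Int.gcd_eq_zero_iff] at hg
    obtain ⟨h1, h2⟩ := hg
    rcases mul_eq_zero.1 h2 with h2 | h2
    · exact h0 ⟨h1, h2⟩
    · exact hnd.elim (fun h => h h2) fun h => h h1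
  obtain ⟨d', hd'⟩ : ((Int.gcd d (α * n) : ℕ) : ℤ) ∣ d := Int.gcd_dvd_left _ _
  obtain ⟨m', hm'⟩ : ((Int.gcd d (α * n) : ℕ) : ℤ) ∣ α * n := Int.gcd_dvd_right _ _
  have hbez := Int.gcd_eq_gcd_ab d (α * n)
  generalize Int.gcdA d (α * n) = x at hbez
  generalize Int.gcdB d (α * n) = y at hbez
  generalize Int.gcd d (α * n) = c at *
  have hc : (c : ℤ) ≠ 0 := by exact_mod_cast hg
  have hb : d' * x + m' * y = 1 := by
    apply mul_left_cancel₀ hc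
    rw [mul_one]
    calc (c : ℤ) * (d' * x + m' * y) = (c * d') * x + (c * m') * y := by ring
      _ = c := by rw [← hd', ← hm', ← hbez]
  -- Elimination of `g`: with `c` the gcd and Bezout coefficients `x`, `y`, two equations for `g`
  -- become one compatibility condition without `g` and one equation `c g = x p + y q`.
  have key : ∀ (g p q : ColourGroup), (d • g = p ∧ (α * n) • g = q) ↔
      (d' • q = m' • p ∧ (c : ℤ) • g = x • p + y • q) := by
    intro g p q
    constructor
    · rintro ⟨rfl, rfl⟩
      constructor
      · rw [← mul_smul, ← mul_smul, hm']
        congr 1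
        rw [hd']
        ring
      · rw [← mul_smul, ← mul_smul, ← add_smul]
        congr 1
        rw [hbez]; ring
    · rintro ⟨h1, h2⟩
      have e1 : d • g = d' • ((c : ℤ) • g) := by rw [← mul_smul, mul_comm d', ← hd']
      have e2 : (α * n) • g = m' • ((c : ℤ) • g) := by rw [← mul_smul, mul_comm m', ← hm']
      constructor
      · rw [e1, h2, smul_add, ← mul_smul, smul_comm d' y q, h1, ← mul_smul, ← add_smul]
        rw [show d' * x + y * m' = 1 by linarith, one_smul]
      · rw [e2, h2, smul_add, smul_comm m' x p, ← h1, ← mul_smul, ← mul_smul, ← add_smul]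
        rw [show x * d' + m' * y = 1 by linarith, one_smul]
  let p : J → ColourGroup := fun j => -v j
  let q : J → ColourGroup := fun j => -(α • u j) - β • v j
  have e : {p : ColourGroup × J // -(d • p.1) = v p.2 ∧
        α • (n • p.1 + u p.2) + β • v p.2 = 0} ≃
      Σ j : {j // (α * d') • u j + (β * d' - m') • v j = 0},
        {g : ColourGroup // (c : ℤ) • g = x • p j + y • q j} := by
    have iff : ∀ g j, (-(d • g) = v j ∧ α • (n • g + u j) + β • v j = 0) ↔
        ((α * d') • u j + (β * d' - m') • v j = 0) ∧ (c : ℤ) • g = x • p j + y • q j := by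
      intro g j
      rw [neg_eq_iff_eq_neg, smul_add, ← mul_smul, add_assoc, add_eq_zero_iff_eq_neg]
      have : -(α • u j + β • v j) = q j := by simp only [q]; abel
      rw [this, key g (p j) (q j)]
      refine and_congr_left fun _ => ?_
      have : (α * d') • u j + (β * d' - m') • v j = -(d' • q j - m' • p j) := by
        simp only [p, q, sub_smul, mul_smul, smul_sub, smul_neg, smul_comm d' α, smul_comm d' β]
        abel
      rw [this, neg_eq_zero, sub_eq_zero]
    exact
      { toFun := fun z => ⟨⟨z.1.2, ((iff _ _).1 z.2).1⟩, z.1.1, ((iff _ _).1 z.2).2⟩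
        invFun := fun z => ⟨(z.2.1, z.1.1), (iff _ _).2 ⟨z.1.2, z.2.2⟩⟩
        left_inv := fun z => rfl
        right_inv := fun z => rfl }
  -- The compatibility condition is again a linear relation in `u`, `v`, which explains why the
  -- counting hypothesis is required for all coefficients. Each of its solutions leaves `c` choices
  -- of `g`.
  have hj := h (α * d') (β * d' - m')
  have hcard : ∀ b : ColourGroup, Nonempty ({g : ColourGroup // (c : ℤ) • g = b} ≃ Fin c) := by
    intro b
    have hb := card_zsmul_eq hc b
    have : Finite {g : ColourGroup // (c : ℤ) • g = b} := by
      refine Nat.finite_of_card_ne_zero ?_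
      rw [hb]; simpa using hg
    exact ⟨(Finite.equivFinOfCardEq (by rw [hb]; simp))⟩
  rw [Nat.card_congr (e.trans ((Equiv.sigmaCongrRight fun j => (hcard _).some).trans
    (Equiv.sigmaEquivProd _ _))), Nat.card_prod, hj, Nat.card_fin]
  have : α * (n * D + d * N) - β * (d * D) =
      (α * d' * N - (β * d' - m') * D) * c := by
    have : α * (n * D + d * N) - β * (d * D) = (α * n) * D + α * d * N - β * (d * D) := by ring
    rw [this, hm', hd']
    ring
  rw [this, Int.natAbs_mul, Int.natAbs_natCast]

section

variable {w w' : List Slice} {n d N D : ℤ}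

theorem RationalColours.sum_counts (h : RationalColours w n d) (hnd : n ≠ 0 ∨ d ≠ 0)
    (h' : CountsColours w' N D) (hw : Runs 2 w 2) (hw' : Runs 2 w' 2) :
    CountsColours (tangleSum w w') (n * D + d * N) (d * D) := by
  obtain ⟨J, u, v, hJ, hc⟩ := h'
  refine ⟨_, _, _, Colours.sum h hJ hw hw', fun α β => ?_⟩
  rw [← card_sum_solutions hnd hc]
  exact Nat.card_congr
    { toFun := fun z => ⟨z.1.1, z.1.2, by simpa only [← z.1.2] using z.2⟩
      invFun := fun z => ⟨⟨z.1, z.2.1⟩, by simpa only [z.2.1] using z.2.2⟩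
      left_inv := fun z => rfl
      right_inv := fun z => rfl }

theorem RationalColours.addTop (h : RationalColours w n d) (s : Bool) :
    RationalColours (⟨xing s, 0⟩ :: w) n (d + sign s * n) := by
  refine (Colours.addTop h s).congr (Equiv.refl _) (fun _ => rfl) fun g => ?_
  simp only [Equiv.refl_apply, add_smul, mul_smul]
  abel

theorem RationalColours.infinity : RationalColours [] 1 0 :=
  Colours.infinity.congr (Equiv.refl _) (fun g => by simp) fun g => by simp

theorem RationalColours.zero : RationalColours zeroTangle 0 1 :=
  Colours.zero.congr (Equiv.refl _) (fun g => by simp) fun g => by simp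

/-- A crossing is a crossing above `∞`, of fraction `1 / sign s`; rescaling the parameter by the
sign makes the denominator `1`. -/
theorem RationalColours.crossing (s : Bool) : RationalColours [⟨xing s, 0⟩] (sign s) 1 := by
  refine (RationalColours.infinity.addTop s).congr
    { toFun := fun g => sign s • g
      invFun := fun g => sign s • g
      left_inv := fun g => by cases s <;> simp [sign]
      right_inv := fun g => by cases s <;> simp [sign] } (fun g => ?_) fun g => ?_
  · simp
  · cases s <;> simp [sign]

theorem RationalColours.addLeft (h : RationalColours w n d) (s : Bool) (hw : Runs 2 w 2) :
    RationalColours (tangleSum [⟨xing s, 0⟩] w) (n + sign s * d) d := by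
  have h1 : Colours [⟨xing s, 0⟩] (fun g : ColourGroup => sign s • g) (fun g => -g) :=
    (RationalColours.crossing s).congr (Equiv.refl _) (fun g => by simp) fun g => by simp
  refine (h1.sum h (runs_xing s) hw).congr
    { toFun := fun g => ⟨(d • g, g), rfl⟩
      invFun := fun p => p.1.2
      left_inv := fun g => rfl
      right_inv := fun p => Subtype.ext (Prod.ext (by
        simpa using (p.2.symm)) rfl) } (fun g => ?_) fun g => ?_
  · simp only [Equiv.coe_fn_mk, add_smul, mul_smul]
    abel
  · simp

theorem RationalColours.dotTop (h : RationalColours w n d) {i : ℕ} (hi : i < 2) :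
    RationalColours (⟨dot, i⟩ :: w) n d := Colours.dotTop h hi

theorem RationalColours.dotBottom (h : RationalColours w n d) {i : ℕ} (hi : i < 2) :
    RationalColours (w ++ [⟨dot, i⟩]) n d := Colours.dotBottom h hi

theorem CountsColours.det_closure (h : CountsColours w N D) (hw : Runs 2 w 2) :
    (⟨[⟨cap, 0⟩] ++ w ++ [⟨cup, 0⟩], Tangle.runs_closure hw⟩ : Diagram).det = N.natAbs := by
  obtain ⟨I, u, v, hI, hc⟩ := h
  rw [det_closure_eq (I := I) (u := u) (v := v) hw hI]
  have h10 := hc 1 0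
  simp only [one_smul, zero_smul, add_zero, one_mul, zero_mul, sub_zero] at h10
  exact h10

end

namespace Tangle

/-! ### Fractions of tangles -/

/-- A tangle that is represented by a diagram with the colours of a rational tangle of fraction
`n / d`. -/
def Rational (T : Tangle) (n d : ℤ) : Prop :=
  (n ≠ 0 ∨ d ≠ 0) ∧ ∃ w hw, T = mk w hw ∧ RationalColours w n d

/-- A tangle that is represented by a diagram whose numbers of colourings are those of a tangle of
fraction `N / D`. -/
def HasFraction (T : Tangle) (N D : ℤ) : Prop :=
  ∃ w hw, T = mk w hw ∧ CountsColours w N D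

section

variable {T S : Tangle} {n d N D : ℤ}

theorem Rational.hasFraction (h : Rational T n d) : HasFraction T n d := by
  obtain ⟨-, w, hw, rfl, hc⟩ := h
  exact ⟨w, hw, rfl, hc.countsColours⟩

theorem Rational.one : Rational 1 0 1 := ⟨.inr one_ne_zero, _, _, rfl, .zero⟩

theorem Rational.crossing (s : Bool) : Rational (crossing s) (sign s) 1 :=
  ⟨.inr one_ne_zero, _, _, rfl, .crossing s⟩

theorem Rational.addTop (h : Rational T n d) (s : Bool) :
    Rational (addTop s T) n (d + sign s * n) := by
  obtain ⟨h0, w, hw, rfl, hc⟩ := h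
  refine ⟨?_, _, _, rfl, hc.addTop s⟩
  rcases eq_or_ne n 0 with rfl | hn
  · simpa using h0
  · exact .inl hn

theorem Rational.addLeft (h : Rational T n d) (s : Bool) :
    Rational (addLeft s T) (n + sign s * d) d := by
  obtain ⟨h0, w, hw, rfl, hc⟩ := h
  refine ⟨?_, _, _, rfl, hc.addLeft s hw⟩
  rcases eq_or_ne d 0 with rfl | hn
  · simpa using h0
  · exact .inr hn

theorem Rational.nw (h : Rational T n d) : Rational (nw T) n d := by
  obtain ⟨h0, w, hw, rfl, hc⟩ := h
  exact ⟨h0, _, _, rfl, hc.dotTop (by norm_num)⟩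

theorem Rational.ne (h : Rational T n d) : Rational (ne T) n d := by
  obtain ⟨h0, w, hw, rfl, hc⟩ := h
  exact ⟨h0, _, _, rfl, hc.dotTop (by norm_num)⟩

theorem Rational.sw (h : Rational T n d) : Rational (sw T) n d := by
  obtain ⟨h0, w, hw, rfl, hc⟩ := h
  exact ⟨h0, _, _, rfl, hc.dotBottom (by norm_num)⟩

theorem Rational.on (h : Rational T n d) (P : Dots) : Rational (P.on T) n d := by
  cases P
  exacts [h, h.sw.nw, h.ne.nw, h.sw.ne]

theorem Pos.rational {s : Bool} {n d : ℕ} (h : Pos s T n d) :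
    Rational T (sign s * n) d := by
  have hs : sign s * sign s = 1 := by cases s <;> rfl
  induction h with
  | crossing => simpa using Rational.crossing s
  | left _ ih =>
    have := ih.addLeft s
    rwa [← mul_add, ← Nat.cast_add] at this
  | @top T n d _ ih =>
    have := ih.addTop s
    rwa [← mul_assoc, hs, one_mul, add_comm (d : ℤ), ← Nat.cast_add] at this

theorem Rational.mul_hasFraction (h : Rational T n d) (h' : HasFraction S N D) :
    HasFraction (T * S) (n * D + d * N) (d * D) := by
  obtain ⟨h0, w, hw, rfl, hc⟩ := h
  obtain ⟨w', hw', rfl, hc'⟩ := h'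
  exact ⟨_, _, rfl, hc.sum_counts h0 hc' hw hw'⟩

end

/-! ### Tangles with a hole -/

/-- `IsContext G N₁ N₂`: the operation `G` is given by inserting a tangle into a fixed diagram, and
inserting a rational tangle of fraction `n / d` yields a tangle with fraction of numerator
`N₁ n + N₂ d` (and denominator `D₁ n + D₂ d`). -/
def IsContext (G : Tangle → Tangle) (N₁ N₂ D₁ D₂ : ℤ) : Prop :=
  ∃ (a b : List Slice) (k r : ℕ), ∃ ha : Runs 2 a (k + 2 + r), ∃ hb : Runs (k + 2 + r) b 2,
    (∀ w (hw : Runs 2 w 2),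
      G (mk w hw) = mk (a ++ shift k w ++ b) ((ha.append (hw.frame k r)).append hb)) ∧
    ∀ w n d, Runs 2 w 2 → (n ≠ 0 ∨ d ≠ 0) → RationalColours w n d →
      CountsColours (a ++ shift k w ++ b) (N₁ * n + N₂ * d) (D₁ * n + D₂ * d)

namespace IsContext

variable {G : Tangle → Tangle} {N₁ N₂ D₁ D₂ : ℤ}

theorem id : IsContext (fun T => T) 1 0 0 1 := by
  refine ⟨[], [], 0, 0, rfl, rfl, fun w hw => ?_, fun w n d _ _ h => ?_⟩
  · simp
  · simpa using h.countsColours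

theorem mul_left (h : IsContext G N₁ N₂ D₁ D₂) {S : Tangle} {n d : ℤ} (hS : Rational S n d) :
    IsContext (fun T => S * G T) (n * D₁ + d * N₁) (n * D₂ + d * N₂) (d * D₁) (d * D₂) := by
  obtain ⟨a, b, k, r, ha, hb, h1, h2⟩ := h
  obtain ⟨h0, u, hu, rfl, hc⟩ := hS
  refine ⟨[⟨cap, 1⟩] ++ u ++ shift 2 a, shift 2 b ++ [⟨cup, 1⟩], 2 + k, r, ?_, ?_,
    fun w hw => ?_, fun w n' d' hw hnd hcw => ?_⟩
  · have h1 : Runs 2 [⟨cap, 1⟩] 4 := by simp [Runs, Piece.ins, Piece.outs]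
    have := (h1.append (hu.addRight 2)).append (ha.shift 2)
    rwa [show 2 + (k + 2 + r) = 2 + k + 2 + r by ring] at this
  · have h2 : Runs 4 [⟨cup, 1⟩] 2 := by simp [Runs, Piece.ins, Piece.outs]
    have := (hb.shift 2).append h2
    rwa [show 2 + (k + 2 + r) = 2 + k + 2 + r by ring] at this
  · simp only [h1, mk_mul]
    congr 1
    simp [tangleSum, shift_shift]
  · have := hc.sum_counts h0 (h2 w n' d' hw hnd hcw) hu
      ((ha.append (hw.frame k r)).append hb)
    convert this using 1
    · simp [tangleSum, shift_shift]
    · ring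
    · ring

theorem mul_right {S : Tangle} {N D : ℤ} (hS : HasFraction S N D) :
    IsContext (fun T => T * S) D N 0 D := by
  obtain ⟨u, hu, rfl, hc⟩ := hS
  refine ⟨[⟨cap, 1⟩], shift 2 u ++ [⟨cup, 1⟩], 0, 2, ?_, ?_,
    fun w hw => ?_, fun w n' d' hw hnd hcw => ?_⟩
  · simp [Runs, Piece.ins, Piece.outs]
  · have h2 : Runs 4 [⟨cup, 1⟩] 2 := by simp [Runs, Piece.ins, Piece.outs]
    exact (hu.shift 2).append h2
  · simp only [mk_mul]
    congr 1
    simp [tangleSum, shift_shift]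
  · have := hcw.sum_counts hnd hc hw hu
    convert this using 1
    · simp [tangleSum, shift_shift]
    · ring
    · ring

theorem comp_addTop (h : IsContext G N₁ N₂ D₁ D₂) (s : Bool) :
    IsContext (fun T => G (addTop s T)) (N₁ + sign s * N₂) N₂ (D₁ + sign s * D₂) D₂ := by
  obtain ⟨a, b, k, r, ha, hb, h1, h2⟩ := h
  refine ⟨a ++ shift k [⟨xing s, 0⟩], b, k, r, ha.append ((runs_xing s).frame k r), hb,
    fun w hw => ?_, fun w n' d' hw hnd hcw => ?_⟩
  · simp only [addTop_mk, h1]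
    congr 1
    simp
  · have hw' : Runs 2 (⟨xing s, 0⟩ :: w) 2 := (runs_xing s).append hw
    have := h2 _ n' (d' + sign s * n') hw' ?_ (hcw.addTop s)
    · convert this using 1
      · simp
      · ring
      · ring
    · rcases eq_or_ne n' 0 with rfl | hn
      · simpa using hnd
      · exact .inl hn

theorem comp_addLeft (h : IsContext G N₁ N₂ D₁ D₂) (s : Bool) :
    IsContext (fun T => G (addLeft s T)) N₁ (N₂ + sign s * N₁) D₁ (D₂ + sign s * D₁) := by
  obtain ⟨a, b, k, r, ha, hb, h1, h2⟩ := h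
  have hx : Runs 2 ([⟨cap, 1⟩] ++ [⟨xing s, 0⟩]) (2 + 2) :=
    Runs.append (k := 4) (by simp [Runs]) ((runs_xing s).addRight 2)
  have hy : Runs (2 + 2) [⟨cup, 1⟩] 2 := by simp [Runs]
  refine ⟨a ++ shift k ([⟨cap, 1⟩] ++ [⟨xing s, 0⟩]), shift k [⟨cup, 1⟩] ++ b, k + 2, r, ?_, ?_,
    fun w hw => ?_, fun w n' d' hw hnd hcw => ?_⟩
  · exact ha.append (hx.frame k r)
  · exact (hy.frame k r).append hb
  · simp only [addLeft_apply, crossing, mk_mul, h1]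
    congr 1
    simp [tangleSum, shift_shift]
  · have hw' := runs_tangleSum (runs_xing s) hw
    have := h2 _ (n' + sign s * d') d' hw' ?_ (hcw.addLeft s hw)
    · convert this using 1
      · simp [tangleSum, shift_shift]
      · ring
      · ring
    · rcases eq_or_ne d' 0 with rfl | hn
      · simpa using hnd
      · exact .inr hn

theorem comp_onTop (h : IsContext G N₁ N₂ D₁ D₂) {i : ℕ} (hi : Runs 2 [⟨dot, i⟩] 2) :
    IsContext (fun T => G (onTop [⟨dot, i⟩] hi T)) N₁ N₂ D₁ D₂ := by
  obtain ⟨a, b, k, r, ha, hb, h1, h2⟩ := h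
  refine ⟨a ++ shift k [⟨dot, i⟩], b, k, r, ha.append (hi.frame k r), hb,
    fun w hw => ?_, fun w n' d' hw hnd hcw => ?_⟩
  · simp only [onTop_mk, h1]
    congr 1
    simp
  · have hw' : Runs 2 (⟨dot, i⟩ :: w) 2 := hi.append hw
    convert h2 _ n' d' hw' hnd (hcw.dotTop (by simpa [Runs] using hi)) using 1
    simp

theorem comp_below (h : IsContext G N₁ N₂ D₁ D₂) {i : ℕ} (hi : Runs 2 [⟨dot, i⟩] 2) :
    IsContext (fun T => G (below [⟨dot, i⟩] hi T)) N₁ N₂ D₁ D₂ := by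
  obtain ⟨a, b, k, r, ha, hb, h1, h2⟩ := h
  refine ⟨a, shift k [⟨dot, i⟩] ++ b, k, r, ha, (hi.frame k r).append hb,
    fun w hw => ?_, fun w n' d' hw hnd hcw => ?_⟩
  · simp only [below_mk, h1]
    congr 1
    simp
  · have hw' : Runs 2 (w ++ [⟨dot, i⟩]) 2 := hw.append hi
    convert h2 _ n' d' hw' hnd (hcw.dotBottom (by simpa [Runs] using hi)) using 1
    simp

theorem comp_on (h : IsContext G N₁ N₂ D₁ D₂) (P : Dots) :
    IsContext (fun T => G (P.on T)) N₁ N₂ D₁ D₂ := by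
  cases P
  exacts [h, (h.comp_onTop runs_dot_zero).comp_below runs_dot_zero,
    (h.comp_onTop runs_dot_zero).comp_onTop runs_dot_one,
    (h.comp_onTop runs_dot_one).comp_below runs_dot_zero]

theorem natAbs_mul_sign_add {s : Bool} {a b : ℤ} (h : 0 ≤ sign s * (a * b)) :
    (a * sign s + b).natAbs = a.natAbs + b.natAbs := by
  cases s <;> simp only [sign, neg_mul, one_mul, mul_neg, mul_one] at h ⊢ <;>
  rcases lt_trichotomy a 0 with ha | ha | ha <;> rcases lt_trichotomy b 0 with hb | hb | hb <;>
  first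
  | omega
  | (have := mul_pos_of_neg_of_neg ha hb; omega)
  | (have := mul_pos ha hb; omega)
  | (have := mul_neg_of_neg_of_pos ha hb; omega)
  | (have := mul_neg_of_pos_of_neg ha hb; omega)

/-- The three determinants are `|N₁ s + N₂|`, `|N₂|` and `|N₁|`, so the sign hypothesis is what
makes them add up. -/
theorem isTQA_crossing (h : IsContext G N₁ N₂ D₁ D₂) {s : Bool} (hs : 0 ≤ sign s * (N₁ * N₂))
    (h0 : IsTQA (closure (G 1))) (h1 : IsTQA (closure (G infinity))) :
    IsTQA (closure (G (crossing s))) := by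
  obtain ⟨a, b, k, r, ha, hb, hG, hN⟩ := h
  rw [one_def, hG, closure_mk] at h0
  rw [show infinity = mk [] rfl from rfl, hG [] rfl, closure_mk] at h1
  rw [crossing, hG, closure_mk]
  -- Erasing the crossing leaves the tangle `∞`; the other smoothing leaves the tangle `0`.
  refine IsTQA.resolve ([⟨cap, 0⟩] ++ a) (b ++ [⟨cup, 0⟩]) s k _ _ _ ?_ ?_ ?_ ?_ h1 h0
  · simp
  · simp
  · simp [zeroTangle]
  · have hr : ∀ w, Runs 2 w 2 → Runs 2 (a ++ shift k w ++ b) 2 := fun w hw =>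
      (ha.append (hw.frame k r)).append hb
    rw [(hN _ _ _ (runs_xing s) (.inr one_ne_zero) (.crossing s)).det_closure (hr _ (runs_xing s)),
      (hN _ _ _ runs_zeroTangle (.inr one_ne_zero) .zero).det_closure (hr _ runs_zeroTangle),
      (hN [] _ _ rfl (.inl one_ne_zero) .infinity).det_closure (hr [] rfl)]
    simp only [mul_one, mul_zero, add_zero, zero_add]
    exact natAbs_mul_sign_add hs

/-- A link that depends on a rational tangle all of whose crossings have the same sign is TQA if
the two links obtained by replacing that tangle by those of fraction `0` and `∞` are, provided
that the determinants add up. -/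
theorem isTQA_of_pos (h : IsContext G N₁ N₂ D₁ D₂) {s : Bool} (hs : 0 ≤ sign s * (N₁ * N₂))
    (h0 : IsTQA (closure (G 1))) (h1 : IsTQA (closure (G infinity))) {T : Tangle} {n d : ℕ}
    (hT : Pos s T n d) : IsTQA (closure (G T)) := by
  have hss : sign s * sign s = 1 := by cases s <;> rfl
  induction hT generalizing G N₁ N₂ D₁ D₂ with
  | crossing => exact h.isTQA_crossing hs h0 h1
  | left _ ih =>
    -- The outermost crossing is absorbed into the context, replacing `N₂` by `N₂ + s N₁`; the sign
    -- condition only improves, by `N₁²`.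
    refine ih (h.comp_addLeft s) ?_ ?_ ?_
    · nlinarith [mul_self_nonneg N₁]
    · rw [addLeft_one]; exact h.isTQA_crossing hs h0 h1
    · rwa [addLeft_infinity]
  | top _ ih =>
    refine ih (h.comp_addTop s) ?_ ?_ ?_
    · nlinarith [mul_self_nonneg N₂]
    · rwa [addTop_one]
    · exact h.isTQA_crossing hs h0 h1

end IsContext

/-- Two-bridge links are TQA with any even pattern of dots at the endpoints: crossings above untwist
in the closure, and below a crossing on the left both fillings give an unknot, on which the dots
cancel. -/
theorem isTQA_closure_on {s : Bool} {T : Tangle} {n d : ℕ} (h : Pos s T n d) (P : Dots) :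
    IsTQA (closure (P.on T)) := by
  induction h generalizing P with
  | crossing => exact isTQA_closure_on_crossing P s
  | @left T _ _ h _ =>
    rw [Dots.on_addLeft]
    refine ((IsContext.id.comp_addLeft s).comp_on P.throughLeft).isTQA_of_pos (s := s) ?_ ?_ ?_ h
    · cases s <;> simp [sign]
    · rw [← Dots.on_addLeft, addLeft_one]; exact isTQA_closure_on_crossing P s
    · rw [← Dots.on_addLeft, addLeft_infinity]; exact isTQA_closure_on_infinity P
  | top _ ih => rw [Dots.on_addTop, closure_addTop]; exact ih _

theorem isTQA_closure {s : Bool} {T : Tangle} {n d : ℕ} (h : Pos s T n d) : IsTQA (closure T) :=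
  isTQA_closure_on h .none

end Tangle

/-! ### Resolving the summands of a sum of rational tangles -/

namespace Tangle

theorem sign_mul_sign (s : Bool) : sign s * sign s = 1 := by cases s <;> rfl

/-- `Rigid s R q`: the tangle `R` is a sum of rational tangles with finite fractions that commute
with a crossing of sign `s`; the sum of the fractions is `q`, up to the sign of `s`. -/
inductive Rigid (s : Bool) : Tangle → ℚ → Prop
  | one : Rigid s 1 0
  | mul {T R : Tangle} {n d : ℤ} {q : ℚ} (hT : Rational T n d) (hd : 0 < d)
      (hc : Commute (crossing s) T) (h : Rigid s R q) : Rigid s (T * R) ((sign s * n : ℤ) / d + q)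

/-- `Resolvable s S F q`: the tangle `S` is a sum of tangles, some of which are fixed and the
others are rational tangles of fraction between `0` and `1`, up to the sign of `s`; the sum of the
fixed ones is `F`, and the sum of their fractions is `q`, up to the sign of `s`. -/
inductive Resolvable (s : Bool) : Tangle → Tangle → ℚ → Prop
  | one : Resolvable s 1 1 0
  | fixed {R S F : Tangle} {q q' : ℚ} (hR : Rigid s R q') (h : Resolvable s S F q) :
      Resolvable s (R * S) (R * F) (q' + q)
  | free {A S F : Tangle} {n d : ℕ} {q : ℚ} (hA : Pos s A n d) (h : Resolvable s S F q) :
      Resolvable s (addTop s A * S) F q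

namespace Rigid

variable {s : Bool} {R R' : Tangle} {q q' : ℚ}

theorem single {T : Tangle} {n d : ℤ} (hT : Rational T n d) (hd : 0 < d)
    (hc : Commute (crossing s) T) : Rigid s T ((sign s * n : ℤ) / d) := by
  simpa using Rigid.mul hT hd hc .one

theorem crossing : Rigid s (Tangle.crossing s) 1 := by
  simpa [sign_mul_sign] using single (Rational.crossing s) one_pos (Commute.refl _)

theorem crossing_not : Rigid s (Tangle.crossing (!s)) (-1) := by
  have h : Commute (Tangle.crossing s) (Tangle.crossing (!s)) :=
    (crossing_mul_crossing s).trans (crossing_mul_crossing' s).symm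
  have := single (Rational.crossing (!s)) one_pos h
  cases s <;> simpa [sign] using this

theorem append (h : Rigid s R q) (h' : Rigid s R' q') : Rigid s (R * R') (q + q') := by
  induction h with
  | one => simpa using h'
  | mul hT hd hc _ ih => rw [mul_assoc, add_assoc]; exact .mul hT hd hc ih

theorem pow_crossing (m : ℕ) : Rigid s (Tangle.crossing s ^ m) m := by
  induction m with
  | zero => simpa using Rigid.one
  | succ m ih => rw [pow_succ, Nat.cast_succ]; exact ih.append .crossing

theorem of_pos {T : Tangle} {n d : ℕ} (h : Pos s T n d) (P : Dots) :
    Rigid s (P.on T) (n / d) := by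
  have := single (h.rational.on P) (by exact_mod_cast h.pos.2) (P.commute_on h)
  rw [← mul_assoc, sign_mul_sign, one_mul] at this
  simpa using this

theorem commute (h : Rigid s R q) : Commute (Tangle.crossing s) R := by
  induction h with
  | one => exact Commute.one_right _
  | mul _ _ hc _ ih => exact hc.mul_right ih

theorem isContext (h : Rigid s R q) {G : Tangle → Tangle} {N₁ N₂ D₁ D₂ : ℤ}
    (hG : IsContext G N₁ N₂ D₁ D₂) : ∃ N D : ℤ, 0 < D ∧ q = (sign s * N : ℤ) / D ∧
      IsContext (fun T => R * G T) (N * D₁ + D * N₁) (N * D₂ + D * N₂) (D * D₁) (D * D₂) := by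
  induction h with
  | one => exact ⟨0, 1, one_pos, by simp, by simpa using hG⟩
  | @mul T R n d q hT hd _ _ ih =>
    obtain ⟨N, D, hD, rfl, h⟩ := ih
    refine ⟨n * D + d * N, d * D, mul_pos hd hD, ?_, ?_⟩
    · have h1 : (d : ℚ) ≠ 0 := by exact_mod_cast hd.ne'
      have h2 : (D : ℚ) ≠ 0 := by exact_mod_cast hD.ne'
      push_cast
      field_simp
    · have := h.mul_left hT
      simp only [← mul_assoc] at this
      convert this using 1 <;> ring

theorem mul_hasFraction (h : Rigid s R q) {S : Tangle} {N D : ℤ} (hD : 0 < D)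
    (hS : HasFraction S N D) : ∃ N' D' : ℤ, 0 < D' ∧ HasFraction (R * S) N' D' ∧
      (sign s * N' : ℤ) / (D' : ℚ) = q + (sign s * N : ℤ) / D := by
  induction h with
  | one => exact ⟨N, D, hD, by simpa using hS, by simp⟩
  | @mul T R n d q hT hd _ _ ih =>
    obtain ⟨N', D', hD', h, e⟩ := ih
    refine ⟨n * D' + d * N', d * D', mul_pos hd hD', ?_, ?_⟩
    · rw [mul_assoc]; exact hT.mul_hasFraction h
    · rw [add_assoc, ← e]
      have h1 : (d : ℚ) ≠ 0 := by exact_mod_cast hd.ne'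
      have h2 : (D' : ℚ) ≠ 0 := by exact_mod_cast hD'.ne'
      push_cast
      field_simp

end Rigid

namespace Resolvable

variable {s : Bool} {S S' F F' R : Tangle} {q q' : ℚ}

theorem of_rigid (h : Rigid s R q) : Resolvable s R R q := by
  simpa using Resolvable.fixed h .one

theorem of_pos {A : Tangle} {n d : ℕ} (h : Pos s A n d) : Resolvable s (addTop s A) 1 0 := by
  simpa using Resolvable.free h .one

theorem mul (h : Resolvable s S F q) (h' : Resolvable s S' F' q') :
    Resolvable s (S * S') (F * F') (q + q') := by
  induction h with
  | one => simpa using h'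
  | fixed hR _ ih => rw [mul_assoc, mul_assoc, add_assoc]; exact .fixed hR ih
  | free hA _ ih => rw [mul_assoc]; exact .free hA ih

/-- Each free summand contributes a nonnegative amount, so the fixed part bounds the total fraction
from below. -/
theorem exists_hasFraction (h : Resolvable s S F q) :
    ∃ N D : ℤ, 0 < D ∧ HasFraction S N D ∧ q ≤ (sign s * N : ℤ) / (D : ℚ) := by
  induction h with
  | one => exact ⟨0, 1, one_pos, Rational.one.hasFraction, by simp⟩
  | fixed hR _ ih =>
    obtain ⟨N, D, hD, h, hq⟩ := ih
    obtain ⟨N', D', hD', h', e⟩ := hR.mul_hasFraction hD h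
    exact ⟨N', D', hD', h', by rw [e]; linarith⟩
  | @free A S F n d q hA _ ih =>
    obtain ⟨N, D, hD, h, hq⟩ := ih
    obtain ⟨N', D', hD', h', e⟩ := (Rigid.of_pos hA.top .none).mul_hasFraction hD h
    refine ⟨N', D', hD', h', ?_⟩
    have : (0 : ℚ) ≤ n / (n + d : ℕ) := by positivity
    linarith

/-- Free summands are resolved one after another. Each disappears or becomes a crossing of sign `s`;
the crossings are collected in front of the rigid part, which accounts for the power `m` in the
hypothesis on the fixed part. -/
theorem isTQA_closure_mul (h : Resolvable s S F q) (hR : Rigid s R q') (hq : 0 ≤ q' + q)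
    (hF : ∀ m : ℕ, IsTQA (closure (crossing s ^ m * R * F))) : IsTQA (closure (R * S)) := by
  induction h generalizing R q' with
  | one => simpa using hF 0
  | fixed hR' _ ih =>
    rw [← mul_assoc]
    refine ih (hR.append hR') (by linarith) fun m => ?_
    simpa only [mul_assoc] using hF m
  | @free A S F n d q hA hS ih =>
    obtain ⟨N, D, hD, hfrac, hND⟩ := hS.exists_hasFraction
    obtain ⟨N', D', hD', rfl, hctx⟩ := hR.isContext (IsContext.mul_right hfrac)
    refine (hctx.comp_addTop s).isTQA_of_pos (s := s) ?_ ?_ ?_ hA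
    -- With `M` the numerator of the sum of the other summands, the fillings `0` and `∞` have
    -- numerators `M` and `D' D + s M`. Nonnegativity of the total fraction means `s M ≥ 0`, which
    -- gives the sign condition.
    · have h1 : (0 : ℚ) < D := by exact_mod_cast hD
      have h2 : (0 : ℚ) < D' := by exact_mod_cast hD'
      have h3 : (0 : ℚ) ≤ (sign s * N' : ℤ) / (D' : ℚ) + (sign s * N : ℤ) / (D : ℚ) := by linarith
      rw [div_add_div _ _ h2.ne' h1.ne'] at h3
      have h4 : (0 : ℚ) ≤ (sign s * N' : ℤ) * D + D' * (sign s * N : ℤ) := by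
        by_contra h
        exact absurd h3 (not_le.2 (div_neg_of_neg_of_pos (not_le.1 h) (mul_pos h2 h1)))
      have h5 : 0 ≤ (sign s * N') * D + D' * (sign s * N) := by exact_mod_cast h4
      have h6 := sign_mul_sign s
      have h7 : 0 ≤ sign s * (N' * D + D' * N) := by linarith
      have h8 : 0 ≤ D' * D := (mul_pos hD' hD).le
      generalize N' * D + D' * N = M at h7 ⊢
      have : sign s * ((N' * 0 + D' * D + sign s * M) * M) =
          D' * D * (sign s * M) + sign s * sign s * (M * M) := by ring
      rw [this, h6, one_mul]
      exact add_nonneg (mul_nonneg h8 h7) (mul_self_nonneg M)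
    · rw [addTop_one, one_mul]
      exact ih hR hq hF
    · rw [addTop_infinity, ← mul_assoc, ← hR.commute.eq]
      refine ih (Rigid.crossing.append hR) (by linarith) fun m => ?_
      have := hF (m + 1)
      rw [pow_succ] at this
      simpa only [mul_assoc] using this

theorem isTQA_closure (h : Resolvable s S F q) (hq : 0 ≤ q)
    (hF : ∀ m : ℕ, IsTQA (closure (crossing s ^ m * F))) : IsTQA (closure S) := by
  have := h.isTQA_closure_mul Rigid.one (by simpa using hq) (by simpa using hF)
  simpa using this

end Resolvable

theorem Pos.exists_pow_mul {s : Bool} {T : Tangle} {n d : ℕ} (h : Pos s T n d) (m : ℕ) :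
    ∃ n' d', Pos s (Tangle.crossing s ^ m * T) n' d' := by
  induction m with
  | zero => exact ⟨n, d, by simpa using h⟩
  | succ m ih =>
    obtain ⟨n', d', ih⟩ := ih
    exact ⟨_, _, by rw [pow_succ', mul_assoc]; exact ih.left⟩

theorem Dots.exists_pow_mul_on (P : Dots) (s : Bool) (m : ℕ) (T : Tangle) :
    ∃ P' : Dots, crossing s ^ m * P.on T = P'.on (crossing s ^ m * T) := by
  induction m with
  | zero => exact ⟨P, by simp⟩
  | succ m ih =>
    obtain ⟨P', ih⟩ := ih
    refine ⟨P'.throughLeft, ?_⟩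
    rw [pow_succ', mul_assoc, ih, ← addLeft_apply, addLeft_on, addLeft_apply, mul_assoc]

theorem isTQA_closure_pow_mul_on {s : Bool} {T : Tangle} {n d : ℕ} (h : Pos s T n d) (P : Dots)
    (m : ℕ) : IsTQA (closure (crossing s ^ m * P.on T)) := by
  obtain ⟨P', e⟩ := P.exists_pow_mul_on s m T
  obtain ⟨n', d', h'⟩ := h.exists_pow_mul m
  rw [e]
  exact isTQA_closure_on h' P'

/-! ### Sums of two rational tangles of opposite signs -/

theorem addLeft_mul_addLeft_not {s : Bool} {A B : Tangle} (h : Commute (crossing s) A) :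
    addLeft s A * addLeft (!s) B = A * B := by
  rw [addLeft_apply, addLeft_apply, h.eq, mul_assoc, ← mul_assoc (crossing s),
    crossing_mul_crossing, one_mul]

/-- In the closure the two top crossings twist the same pair of arcs, so opposite ones cancel. -/
theorem closure_addTop_mul_addTop_not (s : Bool) (A B : Tangle) :
    closure (addTop s A * addTop (!s) B) = closure (A * B) := by
  rw [closure_addTop_mul, ← addTop_inv, ← Equiv.Perm.mul_apply, mul_inv_cancel,
    Equiv.Perm.one_apply]

/-- The fractions are `a/b` and `-c/d` with `c/d < a/b`, up to sign. The Euclidean algorithm runs on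
both at once: opposite left crossings cancel by the flype, opposite top crossings cancel in the
closure. It stops when the algorithms diverge, and the inequality makes the result a sum of tangles
of sign `s`. -/
theorem isTQA_closure_mul_of_lt {s : Bool} {A B : Tangle} {a b c d : ℕ} (hA : Pos s A a b)
    (hB : Pos (!s) B c d) (h : c * b < a * d) : IsTQA (closure (A * B)) := by
  induction hA generalizing B c d with
  | crossing =>
    cases hB with
    | crossing => omega
    | left hB => omega
    | top hB =>
      obtain ⟨T, hT, e⟩ := hB.addLeft_addTop_not
      rw [← addLeft_apply, e, closure_addTop]
      exact isTQA_closure hT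
  | @left A a b hA ih =>
    cases hB with
    | crossing =>
      rw [← addLeft_one (!s), addLeft_mul_addLeft_not hA.commute, mul_one]
      exact isTQA_closure hA
    | @left B c d hB =>
      rw [addLeft_mul_addLeft_not hA.commute]
      exact ih hB (by nlinarith)
    | top hB =>
      -- One crossing borrowed from the left summand turns the negative tangle of fraction in
      -- `(-1,0)` into a positive one of fraction in `(0,1)`.
      obtain ⟨T, hT, e⟩ := hB.addLeft_addTop_not
      rw [addLeft_apply, hA.commute.eq, mul_assoc, ← addLeft_apply, e]
      refine ((Resolvable.of_rigid (Rigid.of_pos hA .none)).mul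
        (Resolvable.of_pos hT)).isTQA_closure (by positivity) fun m => ?_
      rw [mul_one]
      exact isTQA_closure_pow_mul_on hA .none m
  | @top A a b hA ih =>
    cases hB with
    | crossing => omega
    | left hB => nlinarith
    | top hB =>
      rw [closure_addTop_mul_addTop_not]
      exact ih hB (by nlinarith)

/-- For opposite fractions the Euclidean algorithm cancels everything down to a two-component
unlink, whose determinant is `0`. The pattern `P₀` is the one that puts both dots on the same
component; the other two nontrivial patterns mark both components. -/
theorem exists_isTQA_closure_on_mul {s : Bool} {A : Tangle} {n d : ℕ} (hA : Pos s A n d) :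
    ∃ P₀ : Dots, P₀ ≠ .none ∧ ∀ B, Pos (!s) B n d → ∀ P : Dots, P ≠ .none → P ≠ P₀ →
      IsTQA (closure (P.on A * B)) := by
  induction hA with
  | crossing =>
    refine ⟨.diagonal, by simp, fun B hB P h1 h2 => ?_⟩
    obtain rfl := (hB.eq_crossing rfl).1
    rw [← addLeft_one s, ← addLeft_one (!s), Dots.on_addLeft]
    -- After passing the crossing, the allowed patterns have one dot on each arc of the zero tangle.
    -- The excluded one has both dots on the upper arc.
    have hl : P.throughLeft.on 1 = Dots.left.on 1 := by
      cases P
      · exact absurd rfl h1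
      · rfl
      · simp only [Dots.throughLeft, Dots.on]
        rw [← sw_ne, ← nw_one, sw_nw]
      · exact absurd rfl h2
    rw [hl]
    have hcomm : Commute (crossing s) (Dots.left.on 1) := by
      change addLeft s (Dots.left.on 1) = Dots.left.on 1 * crossing s
      rw [Dots.addLeft_on]
      simp only [Dots.throughLeft, Dots.on, ← nw_mul, ← sw_mul, one_mul, addLeft_one]
    rw [addLeft_mul_addLeft_not hcomm, mul_one]
    exact isTQA_closure_left_on_one
  | @left A n d hA ih =>
    obtain ⟨P₀, h0, h⟩ := ih
    refine ⟨P₀.throughLeft, ?_, fun B hB P h1 h2 => ?_⟩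
    · intro e; apply h0; rw [← P₀.throughLeft_throughLeft, e]; rfl
    obtain ⟨B', rfl, hB'⟩ := hB.exists_left (by have := hA.pos; omega)
    rw [Nat.add_sub_cancel] at hB'
    rw [Dots.on_addLeft, addLeft_mul_addLeft_not (Dots.commute_on _ hA)]
    refine h B' hB' _ ?_ ?_
    · intro e; apply h1; rw [← P.throughLeft_throughLeft, e]; rfl
    · intro e; apply h2; rw [← e, P.throughLeft_throughLeft]
  | @top A n d hA ih =>
    obtain ⟨P₀, h0, h⟩ := ih
    refine ⟨P₀.throughTop, ?_, fun B hB P h1 h2 => ?_⟩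
    · intro e; apply h0; rw [← P₀.throughTop_throughTop, e]; rfl
    obtain ⟨B', rfl, hB'⟩ := hB.exists_top (by have := hA.pos; omega)
    rw [Nat.add_sub_cancel_left] at hB'
    rw [Dots.on_addTop, closure_addTop_mul_addTop_not]
    refine h B' hB' _ ?_ ?_
    · intro e; apply h1; rw [← P.throughTop_throughTop, e]; rfl
    · intro e; apply h2; rw [← e, P.throughTop_throughTop]

/-- The crossing turns the second summand into one of fraction in `(-1,0)`. Removing the opposite
top crossings leaves `a/b - b'/a'`, which is nonnegative by `h`; dots are needed only when it is
zero. -/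
theorem exists_isTQA_closure_crossing_not_mul {s : Bool} {A A' : Tangle} {a b a' b' : ℕ}
    (hA : Pos s A a b) (hA' : Pos s A' a' b') (h : b * b' ≤ a * a') :
    ∃ P : Dots, IsTQA (closure (crossing (!s) * (P.on (addTop s A) * addTop s A'))) := by
  obtain ⟨B, hB, e⟩ := hA'.addTop_eq
  have key : ∀ P : Dots, closure (crossing (!s) * (P.on (addTop s A) * addTop s A')) =
      closure (P.throughTop.on A * B) := by
    intro P
    have hc := P.commute_on hA.top
    have : crossing (!s) * (P.on (addTop s A) * addTop s A') =
        P.on (addTop s A) * addTop (!s) B := by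
      rw [e, addLeft_apply, ← mul_assoc (P.on _), ← hc.eq, ← mul_assoc, ← mul_assoc,
        crossing_mul_crossing', one_mul]
    rw [this, Dots.on_addTop, closure_addTop_mul_addTop_not]
  rcases h.lt_or_eq with h | h
  · refine ⟨.none, ?_⟩
    rw [key]
    exact isTQA_closure_mul_of_lt hA hB (by linarith)
  -- Equality `a/b = b'/a'` of fractions in lowest terms forces equal numerators and denominators.
  · have e1 : a = b' := Nat.dvd_antisymm (hA.coprime.dvd_of_dvd_mul_left ⟨_, h⟩)
      (hA'.coprime.symm.dvd_of_dvd_mul_right ⟨b, by rw [← h, mul_comm]⟩)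
    have e2 : b = a' := by
      subst e1
      exact Nat.eq_of_mul_eq_mul_right hA.pos.1 (by rw [h, mul_comm])
    subst e1 e2
    obtain ⟨P₀, -, hP⟩ := exists_isTQA_closure_on_mul hA
    -- The pattern must avoid `P₀` after passing the top crossing, which fixes `top` and exchanges
    -- `left` with `diagonal`.
    by_cases h' : P₀ = .left
    · refine ⟨.top, ?_⟩
      rw [key]
      exact hP B hB .top (by simp) (by simp [h'])
    · refine ⟨.diagonal, ?_⟩
      rw [key]
      exact hP B hB .left (by simp) (Ne.symm h')

/-! ### Sums of several rational tangles of the same sign -/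

/-- `PosSum s q S`: the tangle `S` is a sum of `q` rational tangles of fraction between `0` and
`1`, up to the sign of `s`. -/
inductive PosSum (s : Bool) : ℕ → Tangle → Prop
  | one : PosSum s 0 1
  | mul {A S : Tangle} {n d q : ℕ} (hA : Pos s A n d) (h : PosSum s q S) :
      PosSum s (q + 1) (addTop s A * S)

namespace PosSum

variable {s : Bool} {S S' : Tangle} {q q' : ℕ}

theorem append (h : PosSum s q S) (h' : PosSum s q' S') : PosSum s (q + q') (S * S') := by
  induction h with
  | one => simpa using h'
  | mul hA _ ih => rw [mul_assoc, add_right_comm]; exact .mul hA ih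

theorem single {A : Tangle} {n d : ℕ} (hA : Pos s A n d) : PosSum s 1 (addTop s A) := by
  simpa using PosSum.mul hA .one

theorem resolvable (h : PosSum s q S) : Resolvable s S 1 0 := by
  induction h with
  | one => exact .one
  | mul hA _ ih => exact .free hA ih

theorem commute (h : PosSum s q S) : Commute (crossing s) S := by
  induction h with
  | one => exact Commute.one_right _
  | mul hA _ ih => exact hA.top.commute.mul_right ih

/-- The tangles of fraction between `0` and `1` are obtained from tangles of fraction between `-1`
and `0` by adding a crossing. -/
theorem exists_not (h : PosSum s q S) : ∃ S', PosSum (!s) q S' ∧ S = crossing s ^ q * S' := by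
  induction h with
  | one => exact ⟨1, .one, by simp⟩
  | @mul A S n d q hA _ ih =>
    obtain ⟨S', hS', rfl⟩ := ih
    obtain ⟨B, hB, e⟩ := hA.addTop_eq
    refine ⟨_, .mul hB hS', ?_⟩
    rw [pow_succ, mul_assoc, ← mul_assoc (crossing s) _ S', ← addLeft_apply, ← e, ← mul_assoc,
      ← mul_assoc, (hA.top.commute.pow_left q).eq]

/-- If there is a summand, one is kept fixed and the others are resolved, which leaves two-bridge
links. Without summands or crossings the closure would be an unmarked unlink, hence `h0`. -/
theorem isTQA_closure_pow_mul (h : PosSum s q S) {m : ℕ} (h0 : 0 < q ∨ 0 < m) :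
    IsTQA (closure (crossing s ^ m * S)) := by
  cases h with
  | one =>
    obtain ⟨k, rfl⟩ : ∃ k, m = k + 1 := ⟨m - 1, by omega⟩
    rw [mul_one, pow_succ]
    exact isTQA_closure_pow_mul_on .crossing .none k
  | mul hA h =>
    refine ((Resolvable.of_rigid (Rigid.pow_crossing m)).mul
      ((Resolvable.of_rigid (Rigid.of_pos hA.top .none)).mul h.resolvable)).isTQA_closure
      (by positivity) fun k => ?_
    rw [mul_one, ← mul_assoc, ← pow_add]
    exact isTQA_closure_pow_mul_on hA.top .none _

end PosSum

/-- The negative crossing and the two chosen tangles are kept fixed while the rest is resolved.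
Their total `-1 + x + x'` is nonnegative by `h`, so all determinants add up. -/
theorem exists_isTQA_closure_crossing_not_mul_sum {s : Bool} {A A' S₁ S₂ S₃ : Tangle}
    {a b a' b' q₁ q₂ q₃ : ℕ} (hA : Pos s A a b) (hA' : Pos s A' a' b') (h : b * b' ≤ a * a')
    (h₁ : PosSum s q₁ S₁) (h₂ : PosSum s q₂ S₂) (h₃ : PosSum s q₃ S₃) :
    ∃ P : Dots, IsTQA (closure (crossing (!s) *
      (S₁ * (P.on (addTop s A) * (S₂ * (addTop s A' * S₃)))))) := by
  obtain ⟨P, hP⟩ := exists_isTQA_closure_crossing_not_mul hA hA' h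
  refine ⟨P, ?_⟩
  refine ((Resolvable.of_rigid Rigid.crossing_not).mul (h₁.resolvable.mul
    ((Resolvable.of_rigid (Rigid.of_pos hA.top P)).mul (h₂.resolvable.mul
    ((Resolvable.of_rigid (Rigid.of_pos hA'.top .none)).mul h₃.resolvable))))).isTQA_closure
    ?_ fun m => ?_
  · have h1 : (0 : ℚ) < a + b := by have := hA.pos; exact_mod_cast (by omega)
    have h2 : (0 : ℚ) < a' + b' := by have := hA'.pos; exact_mod_cast (by omega)
    have h3 : (b : ℚ) * b' ≤ a * a' := by exact_mod_cast h
    push_cast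
    -- After clearing denominators this is precisely `b b' ≤ a a'`.
    have : (1 : ℚ) ≤ a / (a + b) + a' / (a' + b') := by
      rw [div_add_div _ _ h1.ne' h2.ne', le_div_iff₀ (mul_pos h1 h2)]
      nlinarith
    linarith
  · simp only [one_mul, mul_one]
    -- Without extra crossings this is the case of two tangles. Otherwise one extra crossing cancels
    -- the negative one and all that remains is positive.
    cases m with
    | zero => rw [pow_zero, one_mul]; exact hP
    | succ m =>
      rw [pow_succ, mul_assoc, ← mul_assoc (crossing s), crossing_mul_crossing, one_mul,
        ← mul_assoc]
      refine (Resolvable.of_pos hA').isTQA_closure_mul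
        ((Rigid.pow_crossing m).append (Rigid.of_pos hA.top P)) (by positivity) fun k => ?_
      rw [mul_one, ← mul_assoc, ← pow_add]
      exact isTQA_closure_pow_mul_on hA.top P _

end Tangle

/-! ### Dots on a knot -/

/-- Consecutive points on a strand of the link. -/
def Step (w : List Slice) (a b : ℕ × ℕ) : Prop := Joined w a b ∨ ∃ o, PassesUnder w a o b

/-- The diagram `w` with a dot inserted at the point `x`. -/
def insertDot (w : List Slice) (x : ℕ × ℕ) : List Slice :=
  w.take x.1 ++ [⟨dot, x.2⟩] ++ w.drop x.1

theorem runs_take_drop {n m : ℕ} {w : List Slice} (h : Runs n w m) (k : ℕ) :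
    Runs n (w.take k) (strandsAfter n (w.take k)) ∧ Runs (strandsAfter n (w.take k)) (w.drop k) m := by
  rw [← List.take_append_drop k w, runs_append_iff] at h
  obtain ⟨c, h1, h2⟩ := h
  rw [h1.strandsAfter_eq]
  exact ⟨h1, h2⟩

theorem runs_insertDot {n m : ℕ} {w : List Slice} (h : Runs n w m) {x : ℕ × ℕ}
    (hx : x.2 < strandsAfter n (w.take x.1)) : Runs n (insertDot w x) m := by
  obtain ⟨h1, h2⟩ := runs_take_drop h x.1
  refine (h1.append (k := strandsAfter n (w.take x.1)) ?_).append h2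
  simp only [Runs, ins, outs]
  omega

theorem insertDot_eq {w : List Slice} {k : ℕ} {s : Slice} (h : w[k]? = some s) (j : ℕ) :
    insertDot w (k, j) = w.take k ++ [⟨dot, j⟩, s] ++ w.drop (k + 1) := by
  obtain ⟨hk, rfl⟩ := List.getElem?_eq_some_iff.1 h
  simp [insertDot]

theorem insertDot_succ_eq {w : List Slice} {k : ℕ} {s : Slice} (h : w[k]? = some s) (j : ℕ) :
    insertDot w (k + 1, j) = w.take k ++ [s, ⟨dot, j⟩] ++ w.drop (k + 1) := by
  simp [insertDot, List.take_add_one, h]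

theorem isotopic_of_localMove {n m : ℕ} {w w' a l r b : List Slice} (hw : Runs n w m)
    (hw' : Runs n w' m) (h : LocalMove l r) (e : w = a ++ l ++ b) (e' : w' = a ++ r ++ b) :
    Isotopic n m w w' := Relation.EqvGen.rel _ _ ⟨hw, hw', a, l, r, b, h, e, e'⟩

/-- A dot can be moved along the link. -/
theorem Step.isotopic {n m : ℕ} {w : List Slice} {a b : ℕ × ℕ} (h : Step w a b) (hw : Runs n w m)
    (ha : a.2 < strandsAfter n (w.take a.1)) (hb : b.2 < strandsAfter n (w.take b.1)) :
    Isotopic n m (insertDot w a) (insertDot w b) := by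
  have ra := runs_insertDot hw ha
  have rb := runs_insertDot hw hb
  have left : ∀ {k i : ℕ} {s : Bool}, w[k]? = some ⟨xing s, i⟩ → a = (k, i) → b = (k + 1, i + 1) →
      Isotopic n m (insertDot w a) (insertDot w b) := by
    rintro k i s hx rfl rfl
    exact isotopic_of_localMove ra rb (.dotLeft s i) (insertDot_eq hx _) (insertDot_succ_eq hx _)
  have right : ∀ {k i : ℕ} {s : Bool}, w[k]? = some ⟨xing s, i⟩ → a = (k, i + 1) →
      b = (k + 1, i) → Isotopic n m (insertDot w a) (insertDot w b) := by
    rintro k i s hx rfl rfl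
    exact isotopic_of_localMove ra rb (.dotRight s i) (insertDot_eq hx _) (insertDot_succ_eq hx _)
  rcases h with h | ⟨o, h⟩
  · cases h with
    | @left k g i j h hj =>
      obtain ⟨c, rfl⟩ := Nat.exists_eq_add_of_lt hj
      have := LocalMove.comm dot g j c
      simp only [ins, outs, add_right_comm j 1 c] at this
      exact isotopic_of_localMove ra rb this (insertDot_eq h _) (insertDot_succ_eq h _)
    | right j h =>
      exact (isotopic_of_localMove rb ra (.comm _ dot _ j) (insertDot_succ_eq h _)
        (insertDot_eq h _)).symm
    | cap h =>
      exact isotopic_of_localMove ra rb (.dotCap _) (insertDot_succ_eq h _) (insertDot_succ_eq h _)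
    | cup h =>
      exact isotopic_of_localMove ra rb (.dotCup _) (insertDot_eq h _) (insertDot_eq h _)
    | dot h => exact .of_eq (by rw [insertDot_eq h, insertDot_succ_eq h])
    | crossOver h => exact left (s := true) h rfl rfl
    | crossUnder h => exact right (s := false) h rfl rfl
  · cases h with
    | crossOver h => exact right (s := true) h rfl rfl
    | crossUnder h => exact left (s := false) h rfl rfl

/-- A step involves a single slice, so it persists in any word that contains this slice, `c` places
further down. -/
theorem Step.exists_level {w : List Slice} {a b : ℕ × ℕ} (h : Step w a b) :
    ∃ k, (a.1 = k ∨ a.1 = k + 1) ∧ (b.1 = k ∨ b.1 = k + 1) ∧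
      ∀ w' c, w'[k + c]? = w[k]? → Step w' (a.1 + c, a.2) (b.1 + c, b.2) := by
  rcases h with h | ⟨o, h⟩
  · cases h with
    | @left k g i j h hj =>
      refine ⟨k, by simp, by simp, fun w' c e => ?_⟩
      simp only [add_right_comm k 1 c]
      exact .inl (.left (e.trans h) hj)
    | @right k g i j h =>
      refine ⟨k, by simp, by simp, fun w' c e => ?_⟩
      simp only [add_right_comm k 1 c]
      exact .inl (.right j (e.trans h))
    | @cap k i h =>
      refine ⟨k, by simp, by simp, fun w' c e => ?_⟩
      simp only [add_right_comm k 1 c]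
      exact .inl (.cap (e.trans h))
    | @cup k i h =>
      exact ⟨k, by simp, by simp, fun w' c e => .inl (.cup (e.trans h))⟩
    | @dot k i h =>
      refine ⟨k, by simp, by simp, fun w' c e => ?_⟩
      simp only [add_right_comm k 1 c]
      exact .inl (.dot (e.trans h))
    | @crossOver k i h =>
      refine ⟨k, by simp, by simp, fun w' c e => ?_⟩
      simp only [add_right_comm k 1 c]
      exact .inl (.crossOver (e.trans h))
    | @crossUnder k i h =>
      refine ⟨k, by simp, by simp, fun w' c e => ?_⟩
      simp only [add_right_comm k 1 c]
      exact .inl (.crossUnder (e.trans h))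
  · cases h with
    | @crossOver k i h =>
      refine ⟨k, by simp, by simp, fun w' c e => ?_⟩
      simp only [add_right_comm k 1 c]
      exact .inr ⟨_, .crossOver (e.trans h)⟩
    | @crossUnder k i h =>
      refine ⟨k, by simp, by simp, fun w' c e => ?_⟩
      simp only [add_right_comm k 1 c]
      exact .inr ⟨_, .crossUnder (e.trans h)⟩

theorem dot_comm {n m : ℕ} {a b : List Slice} {i j : ℕ} (h : Runs n (a ++ [⟨dot, i⟩, ⟨dot, j⟩] ++ b) m)
    (h' : Runs n (a ++ [⟨dot, j⟩, ⟨dot, i⟩] ++ b) m) :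
    Isotopic n m (a ++ [⟨dot, i⟩, ⟨dot, j⟩] ++ b) (a ++ [⟨dot, j⟩, ⟨dot, i⟩] ++ b) := by
  rcases lt_trichotomy i j with hij | rfl | hij
  · obtain ⟨c, rfl⟩ := Nat.exists_eq_add_of_lt hij
    have := LocalMove.comm dot dot i c
    simp only [ins, outs, add_right_comm i 1 c] at this
    exact isotopic_of_localMove h h' this rfl rfl
  · exact .refl _
  · obtain ⟨c, rfl⟩ := Nat.exists_eq_add_of_lt hij
    have := LocalMove.comm dot dot j c
    simp only [ins, outs, add_right_comm j 1 c] at this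
    exact (isotopic_of_localMove h' h this rfl rfl).symm

/-- Two dots on a knot cancel, wherever they are. -/
theorem Diagram.IsKnot.isotopic_two_dots {D : Diagram} (hD : D.IsKnot) {u v : List Slice}
    (e : D.word = u ++ v) {j₀ k j : ℕ} (h₀ : j₀ < strandsAfter 0 u) (hk : k ≤ u.length)
    (hj : j < strandsAfter 0 (u.take k)) :
    Isotopic 0 0 (u.take k ++ [⟨dot, j⟩] ++ u.drop k ++ [⟨dot, j₀⟩] ++ v) (u ++ v) := by
  have huv : Runs 0 (u ++ v) 0 := e ▸ D.closed
  have hx₀ : j₀ < strandsAfter 0 ((u ++ v).take u.length) := by simpa using h₀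
  have hw' : Runs 0 (u ++ [⟨dot, j₀⟩] ++ v) 0 := by
    have := runs_insertDot huv (x := (u.length, j₀)) hx₀
    simpa [insertDot] using this
  set w' := u ++ [⟨dot, j₀⟩] ++ v with hdef
  have htake : ∀ c ≤ u.length, w'.take c = (u ++ v).take c := fun c hc => by
    rw [hdef, List.append_assoc, List.take_append_of_le_length hc, List.take_append_of_le_length hc]
  have hstr : ∀ c, u.length ≤ c → strandsAfter 0 (w'.take (c + 1)) =
      strandsAfter 0 ((u ++ v).take c) := by
    intro c hc
    obtain ⟨i, rfl⟩ := Nat.exists_eq_add_of_le hc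
    rw [hdef, List.append_assoc, add_assoc, List.take_length_add_append,
      List.take_length_add_append, strandsAfter_append, strandsAfter_append, add_comm i,
      List.cons_append, List.nil_append]
    rw [show 1 + i = i + 1 by ring, List.take_succ_cons]
    simp only [strandsAfter, ins, outs]
    congr 1
    omega
  -- The diagram with the second dot fixed and the first one at `x`. Below the fixed dot all levels
  -- move down by one; at its own level the moving dot is placed above it.
  let H : ℕ × ℕ → List Slice := fun x =>
    if x.1 ≤ u.length then insertDot w' x else insertDot w' (x.1 + 1, x.2)
  have hlow : ∀ x : ℕ × ℕ, x.1 ≤ u.length → Isotopic 0 0 (insertDot w' x) (H x) := by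
    intro x hx
    simp only [H, if_pos hx]
    exact .refl _
  -- At the level of the fixed dot, the positions just above and just below it agree because dots
  -- commute.
  have hhigh : ∀ x : ℕ × ℕ, x.2 < strandsAfter 0 ((u ++ v).take x.1) → u.length ≤ x.1 →
      Isotopic 0 0 (insertDot w' (x.1 + 1, x.2)) (H x) := by
    rintro ⟨c, i⟩ hi hx
    simp only at hx hi ⊢
    rcases hx.lt_or_eq with hlt | rfl
    · simp only [H, if_neg (not_le.2 hlt)]
      exact .refl _
    · simp only [H, le_refl, if_true]
      have e0 : w'[u.length]? = some ⟨dot, j₀⟩ := by simp [hdef]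
      have r1 := runs_insertDot hw' (x := (u.length + 1, i)) (by rw [hstr _ le_rfl]; exact hi)
      have r2 := runs_insertDot hw' (x := (u.length, i)) (by rw [htake _ le_rfl]; exact hi)
      rw [insertDot_eq e0] at r2 ⊢
      rw [insertDot_succ_eq e0] at r1 ⊢
      exact dot_comm r1 r2
  have hstep : ∀ a b : ℕ × ℕ, a.2 < strandsAfter 0 ((u ++ v).take a.1) →
      b.2 < strandsAfter 0 ((u ++ v).take b.1) → Step (u ++ v) a b →
      Isotopic 0 0 (H a) (H b) := by
    intro a b ha hb h
    obtain ⟨c, h1, h2, h3⟩ := h.exists_level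
    rcases lt_or_ge c u.length with hc | hc
    · have ha' : a.1 ≤ u.length := by omega
      have hb' : b.1 ≤ u.length := by omega
      have hs : Step w' a b := h3 w' 0 (by
        rw [add_zero, hdef, List.append_assoc, List.getElem?_append_left hc,
          List.getElem?_append_left hc])
      refine (hlow a ha').symm.trans (.trans (hs.isotopic hw' ?_ ?_) (hlow b hb'))
      · rwa [htake _ ha']
      · rwa [htake _ hb']
    · have ha' : u.length ≤ a.1 := by omega
      have hb' : u.length ≤ b.1 := by omega
      have hs := h3 w' 1 (by
        rw [hdef, List.append_assoc, List.getElem?_append_right (by omega),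
          List.getElem?_append_right hc, Nat.sub_add_comm hc]
        simp)
      refine (hhigh a ha ha').symm.trans (.trans (hs.isotopic hw' ?_ ?_) (hhigh b hb hb'))
      · rwa [hstr _ ha']
      · rwa [hstr _ hb']
  have htk : (u ++ v).take k = u.take k := List.take_append_of_le_length hk
  let x₀ : D.Node := ⟨(u.length, j₀), by rw [e]; exact hx₀⟩
  let x : D.Node := ⟨(k, j), by rw [e, htk]; exact hj⟩
  -- The only use of the knot hypothesis: the two points lie on the same component, so a chain of
  -- steps carries one dot to the other.
  have hcomp : (Quot.mk _ x : D.Component) = Quot.mk _ x₀ :=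
    ((Nat.card_eq_one_iff_unique.1 hD).1).elim _ _
  have hiso : Isotopic 0 0 (H x.1) (H x₀.1) := by
    have := Quot.eqvGen_exact hcomp
    rw [← e] at hstep
    clear_value x x₀
    clear hcomp
    induction this with
    | rel a b h =>
      exact hstep a.1 b.1 a.2 b.2 (h.imp id fun ⟨o, ho⟩ => ⟨o.1, ho⟩)
    | refl a => exact .refl _
    | symm a b _ ih => exact ih.symm
    | trans a b c _ _ ih1 ih2 => exact ih1.trans ih2
  have e1 : H x.1 = u.take k ++ [⟨dot, j⟩] ++ u.drop k ++ [⟨dot, j₀⟩] ++ v := by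
    simp only [H, x, if_pos hk, insertDot, htake k hk, htk]
    rw [hdef, List.append_assoc u, List.drop_append_of_le_length hk]
    simp
  have e2 : H x₀.1 = u ++ [⟨dot, j₀⟩, ⟨dot, j₀⟩] ++ v := by
    simp only [H, x₀, le_refl, if_true, insertDot, htake _ le_rfl, List.take_left']
    simp [hdef]
  rw [← e1]
  refine hiso.trans ?_
  have r0 : Runs 0 (H x₀.1) 0 := by
    simp only [H, x₀, le_refl, if_true]
    exact runs_insertDot hw' (by rw [htake _ le_rfl]; exact hx₀)
  exact isotopic_of_localMove r0 huv (.dotCancel j₀) e2 (by simp)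

/-- `Occurs W w G`: the diagram `w` is a part of the diagram `W`, and `G` is the operation of
replacing it by another tangle. -/
def Occurs (W w : List Slice) (G : Tangle → Tangle) : Prop :=
  ∃ (a b : List Slice) (k r : ℕ), ∃ ha : Runs 2 a (k + 2 + r), ∃ hb : Runs (k + 2 + r) b 2,
    W = a ++ shift k w ++ b ∧ ∀ w' (hw : Runs 2 w' 2),
      G (.mk w' hw) = .mk (a ++ shift k w' ++ b) ((ha.append (hw.frame k r)).append hb)

namespace Occurs

variable {W w u : List Slice} {G : Tangle → Tangle}

theorem self (w : List Slice) : Occurs w w fun T => T :=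
  ⟨[], [], 0, 0, rfl, rfl, by simp, fun w' hw => by simp⟩

theorem sum_left (h : Occurs W w G) (hu : Runs 2 u 2) :
    Occurs (tangleSum u W) w fun T => .mk u hu * G T := by
  obtain ⟨a, b, k, r, ha, hb, rfl, h1⟩ := h
  refine ⟨[⟨cap, 1⟩] ++ u ++ shift 2 a, shift 2 b ++ [⟨cup, 1⟩], 2 + k, r, ?_, ?_, ?_,
    fun w hw => ?_⟩
  · have h1 : Runs 2 [⟨cap, 1⟩] 4 := by simp [Runs, Piece.ins, Piece.outs]
    have := (h1.append (hu.addRight 2)).append (ha.shift 2)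
    rwa [show 2 + (k + 2 + r) = 2 + k + 2 + r by ring] at this
  · have h2 : Runs 4 [⟨cup, 1⟩] 2 := by simp [Runs, Piece.ins, Piece.outs]
    have := (hb.shift 2).append h2
    rwa [show 2 + (k + 2 + r) = 2 + k + 2 + r by ring] at this
  · simp [tangleSum, shift_shift]
  · simp only [h1, Tangle.mk_mul]
    congr 1
    simp [tangleSum, shift_shift]

theorem sum_right (h : Occurs W w G) (hu : Runs 2 u 2) :
    Occurs (tangleSum W u) w fun T => G T * .mk u hu := by
  obtain ⟨a, b, k, r, ha, hb, rfl, h1⟩ := h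
  refine ⟨[⟨cap, 1⟩] ++ a, b ++ shift 2 u ++ [⟨cup, 1⟩], k, r + 2, ?_, ?_, ?_,
    fun w hw => ?_⟩
  · have h1 : Runs 2 [⟨cap, 1⟩] (2 + 2) := by simp [Runs, Piece.ins, Piece.outs]
    exact h1.append (ha.addRight 2)
  · have h2 : Runs 4 [⟨cup, 1⟩] 2 := by simp [Runs, Piece.ins, Piece.outs]
    exact ((hb.addRight 2).append (hu.shift 2)).append h2
  · simp [tangleSum, shift_shift]
  · simp only [h1, Tangle.mk_mul]
    congr 1
    simp [tangleSum, shift_shift]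

/-- The link of a diagram of a knot does not change if two dots are placed at endpoints of a part
of the diagram. -/
theorem closure_on (h : Occurs W w G) (hw : Runs 2 w 2) {D : Diagram} (hD : D.IsKnot)
    (e : D.word = [⟨cap, 0⟩] ++ W ++ [⟨cup, 0⟩]) (P : Tangle.Dots) :
    Tangle.closure (G (P.on (.mk w hw))) = D.link := by
  obtain ⟨a, b, k, r, ha, hb, rfl, h1⟩ := h
  obtain ⟨W, hW⟩ := D
  simp only at e
  subst e
  have hcap : Runs 0 [⟨cap, 0⟩] 2 := by simp [Runs]
  have ra := hcap.append ha
  set c : List Slice := [⟨cap, 0⟩] ++ a with hc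
  have rw' := ra.append (hw.frame k r)
  have sa := ra.strandsAfter_eq
  have sw := rw'.strandsAfter_eq
  -- This covers the patterns with one dot above and one below the part; the pattern with both dots
  -- above is separate because there the second dot precedes the part.
  have bottom : ∀ i < 2, Isotopic 0 0 ([⟨cap, 0⟩] ++ (a ++ shift k ([⟨dot, i⟩] ++ (w ++ [⟨dot, 0⟩])) ++ b) ++ [⟨cup, 0⟩])
      ([⟨cap, 0⟩] ++ (a ++ shift k w ++ b) ++ [⟨cup, 0⟩]) := by
    intro i hi
    have := hD.isotopic_two_dots (u := c ++ shift k w) (v := b ++ [⟨cup, 0⟩])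
      (by simp [hc]) (j₀ := k + 0) (k := c.length) (j := k + i)
      (by rw [sw]; omega) (by simp) (by rw [List.take_left', sa]; omega; rfl)
    rw [List.take_left' rfl, List.drop_left' rfl] at this
    simpa [hc] using this
  have top : Isotopic 0 0 ([⟨cap, 0⟩] ++ (a ++ shift k ([⟨dot, 0⟩] ++ ([⟨dot, 1⟩] ++ w)) ++ b) ++ [⟨cup, 0⟩])
      ([⟨cap, 0⟩] ++ (a ++ shift k w ++ b) ++ [⟨cup, 0⟩]) := by
    have := hD.isotopic_two_dots (u := c) (v := shift k w ++ b ++ [⟨cup, 0⟩])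
      (by simp [hc]) (j₀ := k + 1) (k := c.length) (j := k + 0)
      (by rw [sa]; omega) le_rfl (by rw [List.take_length, sa]; omega)
    rw [List.take_length, List.drop_length] at this
    simpa [hc] using this
  cases P
  · change Tangle.closure (G (.mk w hw)) = _
    rw [h1, Tangle.closure_mk]
  · change Tangle.closure (G (.mk ([⟨dot, 0⟩] ++ (w ++ [⟨dot, 0⟩]))
      (Tangle.runs_dot_zero.append (hw.append Tangle.runs_dot_zero)))) = _
    rw [h1, Tangle.closure_mk]
    exact link_eq_of_isotopic _ _ (bottom 0 (by norm_num))
  · change Tangle.closure (G (.mk ([⟨dot, 0⟩] ++ ([⟨dot, 1⟩] ++ w))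
      (Tangle.runs_dot_zero.append (Tangle.runs_dot_one.append hw)))) = _
    rw [h1, Tangle.closure_mk]
    exact link_eq_of_isotopic _ _ top
  · change Tangle.closure (G (.mk ([⟨dot, 1⟩] ++ (w ++ [⟨dot, 0⟩]))
      (Tangle.runs_dot_one.append (hw.append Tangle.runs_dot_zero)))) = _
    rw [h1, Tangle.closure_mk]
    exact link_eq_of_isotopic _ _ (bottom 1 (by norm_num))

end Occurs

/-! ### Rows of crossings -/

namespace Tangle

/-- A row of `n` crossings. -/
def row (n : ℤ) : Tangle := ((crossingUnit true ^ n : Tangleˣ) : Tangle)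

theorem row_add (m n : ℤ) : row (m + n) = row m * row n := by
  simp [row, zpow_add]

@[simp] theorem row_zero : row 0 = 1 := by simp [row]

theorem row_natCast (m : ℕ) : row m = crossing true ^ m := by simp [row]

theorem row_neg_natCast (m : ℕ) : row (-m) = crossing false ^ m := by
  rw [row, zpow_neg, ← inv_zpow, crossingUnit_inv]
  simp

theorem row_one : row 1 = crossing true := by simpa using row_natCast 1

theorem row_neg_one : row (-1) = crossing false := by simpa using row_neg_natCast 1

theorem crossing_pow_natAbs (n : ℤ) : crossing (decide (0 ≤ n)) ^ n.natAbs = row n := by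
  rcases le_or_gt 0 n with h | h
  · obtain ⟨m, rfl⟩ := Int.eq_ofNat_of_zero_le h
    simp [row_natCast]
  · obtain ⟨m, rfl⟩ := Int.eq_ofNat_of_zero_le (show 0 ≤ -n by omega) |>.imp fun m hm =>
      (neg_eq_iff_eq_neg.1 hm)
    rw [row_neg_natCast, decide_eq_false (not_le.2 h), Int.natAbs_neg, Int.natAbs_natCast]

theorem commute_row {T : Tangle} (h : Commute (crossing true) T) (n : ℤ) : Commute (row n) T := by
  exact Commute.units_zpow_left (u := crossingUnit true) h n

theorem commute_row_of_not {T : Tangle} (h : Commute (crossing false) T) (n : ℤ) :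
    Commute (row n) T := by
  have : row n = ((crossingUnit false ^ (-n) : Tangleˣ) : Tangle) := by
    rw [row, zpow_neg, ← inv_zpow, crossingUnit_inv]
    rfl
  rw [this]
  exact Commute.units_zpow_left (u := crossingUnit false) h _

theorem Dots.exists_row_mul_on (P : Dots) (n : ℤ) (T : Tangle) :
    ∃ P' : Dots, row n * P.on T = P'.on (row n * T) := by
  rw [← crossing_pow_natAbs]
  exact P.exists_pow_mul_on _ _ _

theorem Pos.pow_crossing_mul {s : Bool} {T : Tangle} {n d : ℕ} (h : Pos s T n d) (m : ℕ) :
    Pos s (Tangle.crossing s ^ m * T) (n + m * d) d := by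
  induction m with
  | zero => simpa using h
  | succ m ih =>
    rw [pow_succ', mul_assoc, add_mul, one_mul, ← add_assoc]
    exact ih.left

theorem Pos.pow_addTop {s : Bool} {T : Tangle} {n d : ℕ} (h : Pos s T n d) (m : ℕ) :
    Pos s ((Tangle.addTop s ^ m) T) n (d + m * n) := by
  induction m with
  | zero => simpa using h
  | succ m ih =>
    rw [pow_succ', Equiv.Perm.mul_apply, show d + (m + 1) * n = n + (d + m * n) by ring]
    exact ih.top

theorem mk_replicate_append (s : Bool) (m : ℕ) {w : List Slice} (hw : Runs 2 w 2)
    (h : Runs 2 (List.replicate m ⟨xing s, 0⟩ ++ w) 2) :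
    mk (List.replicate m ⟨xing s, 0⟩ ++ w) h = (addTop s ^ m) (mk w hw) := by
  induction m with
  | zero => simp
  | succ m ih =>
    have h' : Runs 2 (List.replicate m ⟨xing s, 0⟩ ++ w) 2 := by
      obtain ⟨-, h⟩ := h
      cases s <;> exact h
    rw [pow_succ', Equiv.Perm.mul_apply, ← ih h', addTop_mk]
    rfl

theorem mk_addCrossings (s : Bool) (m : ℕ) {w : List Slice} (hw : Runs 2 w 2) :
    mk (addCrossings s m w) (runs_addCrossings s m hw) = crossing s ^ m * mk w hw := by
  induction m with
  | zero => simp [addCrossings]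
  | succ m ih =>
    rw [pow_succ', mul_assoc, ← ih]
    rfl

theorem mk_addRow (n : ℤ) {w : List Slice} (hw : Runs 2 w 2) (h : Runs 2 (addRow n w) 2) :
    mk (addRow n w) h = row n * mk w hw := by
  rw [← crossing_pow_natAbs, ← mk_addCrossings]
  rfl

end Tangle

theorem Occurs.addRow {W w : List Slice} {G : Tangle → Tangle} (h : Occurs W w G) (n : ℤ) :
    Occurs (addRow n W) w fun T => Tangle.row n * G T := by
  rw [← Tangle.crossing_pow_natAbs, TwoFold.addRow]
  generalize decide (0 ≤ n) = s
  induction n.natAbs with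
  | zero => simpa [addCrossings] using h
  | succ m ih =>
    have := ih.sum_left (runs_xing s)
    simp only [← mul_assoc] at this
    rw [pow_succ']
    exact this

/-! ### Rational tangles and Montesinos links -/

open Tangle

theorem contFrac_eq (a : ℤ) {b : ℕ} (hb : 0 < b) :
    contFrac a b = a / (b : ℤ) :: contFrac b (a % (b : ℤ)).toNat := by
  obtain ⟨b, rfl⟩ : ∃ c, b = c + 1 := ⟨b - 1, by omega⟩
  rw [contFrac]

theorem contFrac_zero (a : ℤ) : contFrac a 0 = [] := by rw [contFrac]

/-- Division with remainder adds a row or a column of positive crossings. Rows and columns alternate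
along the recursion, so both orientations are proved together. -/
theorem pos_contFracTangle {a b : ℕ} (ha : 0 < a) (hb : 0 < b) (h : a.Coprime b) :
    Pos true (mk (contFracTangle true (contFrac a b)) (runs_contFracTangle _ _)) a b ∧
      Pos true (mk (contFracTangle false (contFrac a b)) (runs_contFracTangle _ _)) b a := by
  induction b using Nat.strong_induction_on generalizing a with
  | _ b ih =>
    have hdiv : a % b + a / b * b = a := by rw [mul_comm]; exact Nat.mod_add_div a b
    have hd : (0 : ℤ) ≤ ((a / b : ℕ) : ℤ) := by positivity
    have e : contFrac a b = ((a / b : ℕ) : ℤ) :: contFrac b (a % b) := by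
      rw [contFrac_eq _ hb]
      norm_cast
    have c1 := runs_contFracTangle false (contFrac b (a % b))
    have c2 := runs_contFracTangle true (contFrac b (a % b))
    have e1 : mk (contFracTangle true (contFrac a b)) (runs_contFracTangle _ _) =
        crossing true ^ (a / b) * mk (contFracTangle false (contFrac b (a % b))) c1 := by
      simp only [e, contFracTangle]
      rw [mk_addRow _ c1, row_natCast]
    have e2 : mk (contFracTangle false (contFrac a b)) (runs_contFracTangle _ _) =
        (addTop true ^ (a / b)) (mk (contFracTangle true (contFrac b (a % b))) c2) := by
      rw [← mk_replicate_append true _ c2 ?_]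
      · simp only [e, contFracTangle, column, hd, decide_true, Int.natAbs_natCast]
      · have := runs_contFracTangle false (contFrac a b)
        simpa only [e, contFracTangle, column, hd, decide_true, Int.natAbs_natCast] using this
    rw [e1, e2]
    rcases Nat.eq_zero_or_pos (a % b) with h0 | h0
    -- Zero remainder ends the algorithm. The innermost tangle is then `0` or `∞`, and the first of
    -- the `a` crossings supplies the base case.
    · obtain rfl : b = 1 := by
        have := Nat.gcd_eq_right (Nat.dvd_of_mod_eq_zero h0)
        rw [h] at this
        exact this.symm
      obtain ⟨a, rfl⟩ : ∃ c, a = c + 1 := ⟨a - 1, by omega⟩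
      simp only [h0, contFrac_zero, contFracTangle, Nat.div_one]
      constructor
      · have := (Pos.crossing (s := true)).pow_crossing_mul a
        rw [← pow_succ] at this
        rw [show mk zeroTangle runs_zeroTangle = 1 from rfl, mul_one]
        simpa [add_comm] using this
      · have := (Pos.crossing (s := true)).pow_addTop a
        rw [← addTop_infinity, ← Equiv.Perm.mul_apply, ← pow_succ] at this
        rw [mul_one, add_comm 1 a] at this
        exact this
    · have hc : b.Coprime (a % b) := by
        rw [Nat.Coprime, Nat.gcd_comm, ← Nat.gcd_rec, Nat.gcd_comm]
        exact h
      obtain ⟨h1, h2⟩ := ih (a % b) (Nat.mod_lt _ hb) hb h0 hc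
      constructor
      · have := h2.pow_crossing_mul (a / b)
        rwa [hdiv] at this
      · have := h1.pow_addTop (a / b)
        rwa [hdiv] at this

/-- The isotopy class of a rational tangle. -/
def ratTangle (t : ℚ) : Tangle := mk (rationalTangle t) (runs_contFracTangle _ _)

/-- The first partial quotient of the continued fraction is the floor, and it is drawn as a row on
the left. -/
theorem ratTangle_eq (t : ℚ) : ratTangle t = row ⌊t⁻¹⌋ *
    mk (contFracTangle false (contFrac (t⁻¹.den : ℕ) (t⁻¹.num % t⁻¹.den).toNat))
      (runs_contFracTangle _ _) := by
  rw [← mk_addRow _ _ (runs_addCrossings _ _ (runs_contFracTangle _ _))]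
  simp only [ratTangle, rationalTangle, contFrac_eq _ t⁻¹.den_pos, contFracTangle,
    Rat.floor_def']

theorem ratTangle_of_int {t : ℚ} {n : ℤ} (h : t⁻¹ = n) : ratTangle t = row ⌊t⁻¹⌋ := by
  rw [ratTangle_eq]
  have hd : t⁻¹.den = 1 := by rw [h]; simp
  simp only [hd, Nat.cast_one, Int.emod_one, Int.toNat_zero, contFrac_zero, contFracTangle]
  exact mul_one _

theorem ratTangle_of_not_int {t : ℚ} (h : ∀ n : ℤ, t⁻¹ ≠ n) : ∃ (A : Tangle) (a b : ℕ),
    Pos true A a b ∧ ratTangle t = row ⌊t⁻¹⌋ * addTop true A ∧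
      Int.fract t⁻¹ = (a : ℚ) / (a + b) := by
  rw [ratTangle_eq]
  set x := t⁻¹ with hx
  have hden : (0 : ℤ) < x.den := by exact_mod_cast x.den_pos
  obtain ⟨r, hr⟩ := Int.eq_ofNat_of_zero_le (Int.emod_nonneg x.num hden.ne')
  have hlt : r < x.den := by
    have := Int.emod_lt_of_pos x.num hden
    omega
  have hfr : Int.fract x = (r : ℚ) / x.den := by
    have h1 : (x.den : ℚ) ≠ 0 := by exact_mod_cast x.den_pos.ne'
    have h2 := Int.mul_ediv_add_emod x.num x.den
    rw [hr] at h2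
    rw [Int.fract, Rat.floor_def', eq_div_iff h1, sub_mul, Rat.mul_den_eq_num]
    have h3 : ((x.num : ℤ) : ℚ) = x.den * (x.num / (x.den : ℤ) : ℤ) + r := by exact_mod_cast h2.symm
    rw [h3]
    ring
  have hr0 : 0 < r := by
    rcases Nat.eq_zero_or_pos r with h0 | h0
    · exfalso
      rw [h0, Nat.cast_zero, zero_div, Int.fract] at hfr
      exact h _ (sub_eq_zero.1 hfr)
    · exact h0
  have hcop : x.den.Coprime r := by
    have h1 : IsCoprime x.num x.den := by
      rw [Int.isCoprime_iff_nat_coprime]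
      simpa using x.reduced
    have h2 : IsCoprime (x.den : ℤ) (x.num % x.den) := by
      have h3 := Int.mul_ediv_add_emod x.num x.den
      have : x.num % x.den = x.num + x.den * (-(x.num / x.den)) := by linarith
      rw [this]
      exact h1.symm.add_mul_left_right _
    rw [hr] at h2
    exact Nat.isCoprime_iff_coprime.1 h2
  have hpos := (pos_contFracTangle x.den_pos hr0 hcop).2
  -- The remaining tangle has fraction `r / den < 1`, so its last crossing is on top: `a = r` and `b
  -- = den - r`.
  obtain ⟨A, e, hA⟩ := hpos.exists_top hlt
  refine ⟨A, _, _, hA, ?_, ?_⟩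
  · rw [← e]
    simp only [hr, Int.toNat_natCast]
  · rw [hfr]
    congr 1
    have : r + (x.den - r) = x.den := by omega
    exact_mod_cast this.symm

/-- The sum of the rational tangles with parameters in a list. -/
def ratSum (l : List ℚ) : Tangle := (l.map ratTangle).prod

theorem runs_ratSums (l : List ℚ) : Runs 2 (tangleSums (l.map rationalTangle)) 2 :=
  runs_tangleSums _ fun T hT => by
    obtain ⟨t, -, rfl⟩ := List.mem_map.1 hT
    exact runs_contFracTangle _ _

theorem mk_ratSums (l : List ℚ) : mk (tangleSums (l.map rationalTangle)) (runs_ratSums l) =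
    ratSum l := by
  induction l with
  | nil => rfl
  | cons t l ih =>
    have e : ratSum (t :: l) = ratTangle t * ratSum l := by simp [ratSum]
    rw [e, ← ih]
    rfl

theorem occurs_ratSums (l₁ l₂ : List ℚ) (t : ℚ) :
    Occurs (tangleSums ((l₁ ++ t :: l₂).map rationalTangle)) (rationalTangle t)
      fun T => ratSum l₁ * (T * ratSum l₂) := by
  induction l₁ with
  | nil =>
    have := (Occurs.self (rationalTangle t)).sum_right (runs_ratSums l₂)
    rw [mk_ratSums] at this
    simpa [ratSum, tangleSums] using this
  | cons a l₁ ih =>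
    have := ih.sum_left (runs_contFracTangle true (contFrac a⁻¹.num a⁻¹.den))
    have e : ratSum (a :: l₁) = ratTangle a * ratSum l₁ := by simp [ratSum]
    simp only [e, mul_assoc]
    exact this

/-- All integral parts commute to the front. Integral parameters contribute only to the row, so `q`
may be smaller than the length. -/
theorem exists_posSum_ratSum (l : List ℚ) : ∃ q S, PosSum true q S ∧ q ≤ l.length ∧
    ratSum l = row (l.map fun t => ⌊t⁻¹⌋).sum * S := by
  induction l with
  | nil => exact ⟨0, 1, .one, by simp, by simp [ratSum]⟩
  | cons t l ih =>
    obtain ⟨q, S, hS, hq, e⟩ := ih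
    have e' : ratSum (t :: l) = ratTangle t * ratSum l := by simp [ratSum]
    rw [e', e, List.map_cons, List.sum_cons, row_add]
    by_cases h : ∃ n : ℤ, t⁻¹ = n
    · obtain ⟨n, hn⟩ := h
      refine ⟨q, S, hS, by simp; omega, ?_⟩
      rw [ratTangle_of_int hn, mul_assoc]
    · obtain ⟨A, a, b, hA, eA, -⟩ := ratTangle_of_not_int (not_exists.1 h)
      refine ⟨q + 1, _, .mul hA hS, by simp; omega, ?_⟩
      rw [eA, mul_assoc, mul_assoc, ← mul_assoc (addTop true A),
        ← (commute_row hA.top.commute _).eq, mul_assoc]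

/-! ### The two families of links -/

theorem Tangle.PosSum.isTQA_closure_row_mul {S : Tangle} {q : ℕ} (h : PosSum true q S) {n : ℤ}
    (hn : 0 ≤ n) (h0 : 0 < q ∨ n ≠ 0) : IsTQA (closure (row n * S)) := by
  obtain ⟨m, rfl⟩ := Int.eq_ofNat_of_zero_le hn
  rw [row_natCast]
  exact h.isTQA_closure_pow_mul (by simpa [Nat.pos_iff_ne_zero] using h0)

/-- The mirror case: borrowing one crossing for each summand makes all of them negative and leaves a
row of `n + q ≤ 0` crossings. -/
theorem Tangle.PosSum.isTQA_closure_row_mul_of_neg {S : Tangle} {q : ℕ} (h : PosSum true q S) {n : ℤ}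
    (hn : n + q ≤ 0) (h0 : 0 < q ∨ n ≠ 0) : IsTQA (closure (row n * S)) := by
  obtain ⟨S', hS', rfl⟩ := h.exists_not
  obtain ⟨m, hm⟩ := Int.eq_ofNat_of_zero_le (show 0 ≤ -(n + q) by omega)
  have hm' : n + q = -(m : ℤ) := by omega
  rw [← row_natCast, ← mul_assoc, ← row_add, hm', row_neg_natCast]
  exact hS'.isTQA_closure_pow_mul (by omega)

open Tangle

/-- The tangle whose closure is the Montesinos link. -/
def montesinosTangle (e : ℤ) (l : List ℚ) : List Slice :=
  addRow e (tangleSums (l.map rationalTangle))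

theorem runs_montesinosTangle (e : ℤ) (l : List ℚ) : Runs 2 (montesinosTangle e l) 2 :=
  runs_addCrossings _ _ (runs_ratSums l)

theorem mk_montesinosTangle (e : ℤ) (l : List ℚ) :
    mk (montesinosTangle e l) (runs_montesinosTangle e l) = row e * ratSum l := by
  rw [← mk_ratSums, ← mk_addRow]
  rfl

theorem montesinos_word (e : ℤ) {p : ℕ} (t : Fin p → ℚ) :
    (montesinos e t).word = [⟨cap, 0⟩] ++ montesinosTangle e (List.ofFn t) ++ [⟨cup, 0⟩] := by
  simp [montesinos, montesinosTangle, List.map_ofFn, Function.comp_def]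

section

variable {D : Diagram} {e : ℤ} {l : List ℚ}

theorem closure_row_mul_ratSum (hD : D.word = [⟨cap, 0⟩] ++ montesinosTangle e l ++ [⟨cup, 0⟩]) :
    closure (row e * ratSum l) = D.link := by
  obtain ⟨w, hw⟩ := D
  simp only at hD
  subst hD
  rw [← mk_montesinosTangle]
  rfl

theorem closure_on_ratTangle {l₁ l₂ : List ℚ} {t : ℚ} (hk : D.IsKnot)
    (hD : D.word = [⟨cap, 0⟩] ++ montesinosTangle e (l₁ ++ t :: l₂) ++ [⟨cup, 0⟩]) (P : Dots) :
    closure (row e * (ratSum l₁ * (P.on (ratTangle t) * ratSum l₂))) = D.link :=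
  ((occurs_ratSums l₁ l₂ t).addRow e).closure_on (runs_contFracTangle _ _) hk hD P

/-- The normal form of the link with the two chosen summands singled out, and with dots on one of
them at no cost because the link is a knot. -/
theorem exists_closure_eq_link {l₁ l₂ l₃ : List ℚ} {t t' : ℚ} (hk : D.IsKnot)
    (hD : D.word = [⟨cap, 0⟩] ++ montesinosTangle e (l₁ ++ t :: (l₂ ++ t' :: l₃)) ++ [⟨cup, 0⟩])
    {A A' : Tangle} {a b a' b' : ℕ} (hA : Pos true A a b) (hA' : Pos true A' a' b')
    (ht : ratTangle t = row ⌊t⁻¹⌋ * addTop true A)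
    (ht' : ratTangle t' = row ⌊t'⁻¹⌋ * addTop true A') :
    ∃ q₁ q₂ q₃ S₁ S₂ S₃, PosSum true q₁ S₁ ∧ PosSum true q₂ S₂ ∧ PosSum true q₃ S₃ ∧
      q₁ + q₂ + q₃ + 2 ≤ (l₁ ++ t :: (l₂ ++ t' :: l₃)).length ∧ ∀ P : Dots,
      closure (row (e + ((l₁ ++ t :: (l₂ ++ t' :: l₃)).map fun t => ⌊t⁻¹⌋).sum) *
        (S₁ * (P.on (addTop true A) * (S₂ * (addTop true A' * S₃))))) = D.link := by
  obtain ⟨q₁, S₁, h₁, hq₁, e₁⟩ := exists_posSum_ratSum l₁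
  obtain ⟨q₂, S₂, h₂, hq₂, e₂⟩ := exists_posSum_ratSum l₂
  obtain ⟨q₃, S₃, h₃, hq₃, e₃⟩ := exists_posSum_ratSum l₃
  refine ⟨q₁, q₂, q₃, S₁, S₂, S₃, h₁, h₂, h₃, by simp; omega, fun P => ?_⟩
  -- Dots are free at the ends of the whole rational tangle. The pattern there is chosen so that it
  -- becomes `P` behind the integral row.
  obtain ⟨P', hP'⟩ := P.exists_row_mul_on ⌊t⁻¹⌋ (addTop true A)
  rw [← closure_on_ratTangle hk hD P', ht, ← hP']
  have e' : ratSum (l₂ ++ t' :: l₃) = ratSum l₂ * (ratTangle t' * ratSum l₃) := by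
    simp [ratSum]
  have pull : ∀ {S : Tangle}, Commute (crossing true) S → ∀ n Y, S * (row n * Y) = row n * (S * Y) :=
    fun h n Y => by rw [← mul_assoc, ← mul_assoc, (commute_row h n).eq]
  have merge : ∀ m n Y, row m * (row n * Y) = row (m + n) * Y := fun m n Y => by
    rw [row_add, mul_assoc]
  rw [e', e₁, e₂, e₃, ht']
  simp only [mul_assoc, pull h₁.commute, pull h₂.commute, pull hA'.top.commute,
    pull (P.commute_on hA.top), merge]
  congr 3
  simp only [List.map_append, List.map_cons, List.sum_append, List.sum_cons]

/-- The case of a sum of rational tangles of fractions between `0` and `1` and one crossing of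
opposite sign. -/
theorem isTQA_of_add_eq_neg_one {l₁ l₂ l₃ : List ℚ} {t t' : ℚ} (hk : D.IsKnot)
    (hD : D.word = [⟨cap, 0⟩] ++ montesinosTangle e (l₁ ++ t :: (l₂ ++ t' :: l₃)) ++ [⟨cup, 0⟩])
    {A A' : Tangle} {a b a' b' : ℕ} (hA : Pos true A a b) (hA' : Pos true A' a' b')
    (ht : ratTangle t = row ⌊t⁻¹⌋ * addTop true A)
    (ht' : ratTangle t' = row ⌊t'⁻¹⌋ * addTop true A') (hab : b * b' ≤ a * a')
    (he : e + ((l₁ ++ t :: (l₂ ++ t' :: l₃)).map fun t => ⌊t⁻¹⌋).sum = -1) : IsTQA D.link := by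
  obtain ⟨q₁, q₂, q₃, S₁, S₂, S₃, h₁, h₂, h₃, -, hP⟩ :=
    exists_closure_eq_link hk hD hA hA' ht ht'
  obtain ⟨P, h⟩ := exists_isTQA_closure_crossing_not_mul_sum hA hA' hab h₁ h₂ h₃
  rw [← hP P, he, row_neg_one]
  exact h

/-- The mirror image of the case `-1`: replacing each fraction `x` by `x - 1` turns a row of `1 - p`
crossings into a single positive crossing, and reverses the inequality. -/
theorem isTQA_of_add_eq_one_sub {l₁ l₂ l₃ : List ℚ} {t t' : ℚ} (hk : D.IsKnot)
    (hD : D.word = [⟨cap, 0⟩] ++ montesinosTangle e (l₁ ++ t :: (l₂ ++ t' :: l₃)) ++ [⟨cup, 0⟩])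
    {A A' : Tangle} {a b a' b' : ℕ} (hA : Pos true A a b) (hA' : Pos true A' a' b')
    (ht : ratTangle t = row ⌊t⁻¹⌋ * addTop true A)
    (ht' : ratTangle t' = row ⌊t'⁻¹⌋ * addTop true A') (hab : a * a' ≤ b * b')
    (he : e + ((l₁ ++ t :: (l₂ ++ t' :: l₃)).map fun t => ⌊t⁻¹⌋).sum =
      1 - (l₁ ++ t :: (l₂ ++ t' :: l₃)).length) : IsTQA D.link := by
  obtain ⟨q₁, q₂, q₃, S₁, S₂, S₃, h₁, h₂, h₃, hq, hP⟩ :=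
    exists_closure_eq_link hk hD hA hA' ht ht'
  rw [he] at hP
  generalize (l₁ ++ t :: (l₂ ++ t' :: l₃)).length = p at hq hP
  -- If some parameter is integral, there are fewer than `p` proper summands and the link already
  -- belongs to the entirely negative family.
  rcases hq.lt_or_eq with hq | hq
  · rw [← hP .none]
    have h := h₁.append ((PosSum.single hA).append (h₂.append ((PosSum.single hA').append h₃)))
    exact h.isTQA_closure_row_mul_of_neg (by push_cast; omega) (.inl (by omega))
  · obtain ⟨S₁', h₁', rfl⟩ := h₁.exists_not
    obtain ⟨S₂', h₂', rfl⟩ := h₂.exists_not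
    obtain ⟨S₃', h₃', rfl⟩ := h₃.exists_not
    obtain ⟨B, hB, eB⟩ := hA.addTop_eq
    obtain ⟨B', hB', eB'⟩ := hA'.addTop_eq
    obtain ⟨P, h⟩ := exists_isTQA_closure_crossing_not_mul_sum hB hB' hab h₁' h₂' h₃'
    -- The dots must also pass the crossing borrowed by the first chosen tangle, hence
    -- `throughLeft`.
    rw [← hP P.throughLeft, eB, ← Dots.addLeft_on, eB', addLeft_apply, addLeft_apply]
    have pull : ∀ {S : Tangle}, Commute (crossing false) S →
        ∀ n Y, S * (row n * Y) = row n * (S * Y) :=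
      fun h n Y => by rw [← mul_assoc, ← mul_assoc, (commute_row_of_not h n).eq]
    have merge : ∀ m n Y, row m * (row n * Y) = row (m + n) * Y := fun m n Y => by
      rw [row_add, mul_assoc]
    have hPc : Commute (crossing false) (P.on (addTop (!true) B)) := P.commute_on hB.top
    have hBc : Commute (crossing false) (addTop (!true) B') := hB'.top.commute
    have h₁c : Commute (crossing false) S₁' := h₁'.commute
    have h₂c : Commute (crossing false) S₂' := h₂'.commute
    simp only [← row_natCast]
    simp only [← row_one, mul_assoc, pull h₁c, pull h₂c, pull hPc, pull hBc, merge]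
    rw [Bool.not_not, ← row_one] at h
    convert h using 4
    subst hq
    push_cast
    ring

/-- Here all summands can be given the same sign; the knot hypothesis matters only when no crossing
remains. -/
theorem isTQA_of_nonneg (hk : D.IsKnot)
    (hD : D.word = [⟨cap, 0⟩] ++ montesinosTangle e l ++ [⟨cup, 0⟩])
    (he : 0 ≤ e + (l.map fun t => ⌊t⁻¹⌋).sum ∨ e + (l.map fun t => ⌊t⁻¹⌋).sum + l.length ≤ 0) :
    IsTQA D.link := by
  obtain ⟨q, S, hS, hq, eS⟩ := exists_posSum_ratSum l
  have hmul : row e * ratSum l = row (e + (l.map fun t => ⌊t⁻¹⌋).sum) * S := by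
    rw [eS, ← mul_assoc, row_add]
  by_cases h0 : 0 < q ∨ e + (l.map fun t => ⌊t⁻¹⌋).sum ≠ 0
  · rw [← closure_row_mul_ratSum hD, hmul]
    rcases he with he | he
    · exact hS.isTQA_closure_row_mul he h0
    · exact hS.isTQA_closure_row_mul_of_neg (by omega) h0
  -- The closure is now that of the zero tangle. Instead of refuting this for a knot, two cancelling
  -- dots are placed so that the splitting rule applies.
  · rw [not_or, not_lt, not_not] at h0
    obtain ⟨hq0, h0⟩ := h0
    obtain rfl : q = 0 := by omega
    have := (Occurs.self (montesinosTangle e l)).closure_on (runs_montesinosTangle e l) hk hD .left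
    rw [← this, mk_montesinosTangle, hmul, h0]
    cases hS
    simpa using isTQA_closure_left_on_one

end

/-! ### From the parameters to the tangles -/

theorem exists_ofFn_eq {p : ℕ} (t : Fin p → ℚ) {i j : Fin p} (hij : i < j) :
    ∃ l₁ l₂ l₃, List.ofFn t = l₁ ++ t i :: (l₂ ++ t j :: l₃) := by
  have hsplit : ∀ (L : List ℚ) k (hk : k < L.length), L = L.take k ++ L[k] :: L.drop (k + 1) :=
    fun L k hk => by rw [List.cons_getElem_drop_succ, List.take_append_drop]
  have hi : (i : ℕ) < (List.ofFn t).length := by simp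
  have h1 := hsplit _ _ hi
  have hk : (j : ℕ) - i - 1 < ((List.ofFn t).drop (i + 1)).length := by
    have := j.2
    simp only [List.length_drop, List.length_ofFn]
    omega
  have h2 := hsplit _ _ hk
  have hi' : (List.ofFn t)[(i : ℕ)] = t i := by simp
  have hj' : ((List.ofFn t).drop (i + 1))[(j : ℕ) - i - 1] = t j := by
    have : (i : ℕ) + 1 + (j - i - 1) = j := by omega
    rw [List.getElem_drop, List.getElem_ofFn]
    simp only [this]
  rw [hi'] at h1
  rw [hj'] at h2
  exact ⟨_, _, _, h1.trans (congrArg (fun M => _ ++ t i :: M) h2)⟩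

theorem flypeParam_of_pos {q : ℚ} (hq : 0 < q) : flypeParam q = q / (1 - q) := by
  have hden : (q.den : ℚ) ≠ 0 := by exact_mod_cast q.den_pos.ne'
  rw [flypeParam, if_pos hq, ← Rat.mul_den_eq_num q,
    show (q.den : ℚ) - q * q.den = (1 - q) * q.den by ring, mul_div_mul_right _ _ hden]

/-- With `x = a/(a+b)` the fractional part, the two quantities are `1/x` and `1/(1 - x)`; comparing
them for two tangles compares the sum of the fractional parts with `1`. -/
theorem abs_flypeParam_hat {t : ℚ} {a b : ℕ} (ha : 0 < a) (hb : 0 < b)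
    (h : Int.fract t⁻¹ = (a : ℚ) / (a + b)) :
    hat t = ((a : ℚ) + b) / a ∧ |flypeParam (hat t)| = ((a : ℚ) + b) / b := by
  have ha' : (0 : ℚ) < a := by exact_mod_cast ha
  have hb' : (0 : ℚ) < b := by exact_mod_cast hb
  have h1 : hat t = ((a : ℚ) + b) / a := by rw [hat, h, inv_div]
  refine ⟨h1, ?_⟩
  have hpos : 0 < hat t := by rw [h1]; positivity
  rw [flypeParam_of_pos hpos, h1, one_sub_div ha'.ne', div_div_div_cancel_right₀ ha'.ne',
    show (a : ℚ) - (a + b) = -b by ring, div_neg, abs_neg, abs_of_pos (by positivity)]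

/-! ### The standard diagram has no dots -/

theorem dotCount_append (u v : List Slice) : dotCount (u ++ v) = dotCount u + dotCount v := by
  simp [dotCount]

theorem dotCount_shift (k : ℕ) (w : List Slice) : dotCount (shift k w) = dotCount w := by
  simp [dotCount, shift, Function.comp_def]

theorem dotCount_xing (s : Bool) (i : ℕ) : dotCount [⟨xing s, i⟩] = 0 := by cases s <;> rfl

theorem dotCount_tangleSum (u v : List Slice) :
    dotCount (tangleSum u v) = dotCount u + dotCount v := by
  simp only [tangleSum, dotCount_append, dotCount_shift]
  simp [dotCount, dots]

theorem dotCount_addRow (n : ℤ) (w : List Slice) : dotCount (addRow n w) = dotCount w := by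
  rw [addRow]
  induction n.natAbs with
  | zero => rfl
  | succ m ih => rw [addCrossings, dotCount_tangleSum, dotCount_xing, ih, zero_add]

theorem dotCount_column (n : ℤ) : dotCount (column n) = 0 := by
  rw [column]
  induction n.natAbs with
  | zero => rfl
  | succ m ih => rw [List.replicate_succ, ← List.singleton_append, dotCount_append, ih,
      dotCount_xing]

theorem dotCount_contFracTangle (h : Bool) (l : List ℤ) : dotCount (contFracTangle h l) = 0 := by
  induction l generalizing h with
  | nil => cases h <;> rfl
  | cons a l ih =>
    cases h
    · rw [contFracTangle, dotCount_append, dotCount_column, ih]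
    · rw [contFracTangle, dotCount_addRow, ih]

theorem dotCount_montesinos (e : ℤ) {p : ℕ} (t : Fin p → ℚ) :
    dotCount (montesinos e t).word = 0 := by
  rw [montesinos_word, dotCount_append, dotCount_append, montesinosTangle, dotCount_addRow]
  have : ∀ l : List ℚ, dotCount (tangleSums (l.map rationalTangle)) = 0 := by
    intro l
    induction l with
    | nil => rfl
    | cons t l ih =>
      rw [List.map_cons, tangleSums, List.foldr_cons, ← tangleSums, dotCount_tangleSum, ih,
        rationalTangle, dotCount_contFracTangle]
  rw [this]
  rfl

theorem epsilon_eq (e : ℤ) {p : ℕ} (t : Fin p → ℚ) :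
    epsilon e t = e + ((List.ofFn t).map fun t => ⌊t⁻¹⌋).sum := by
  rw [epsilon, List.map_ofFn, List.sum_ofFn]
  rfl

theorem isTQA_montesinos_of_eq_neg_one {p : ℕ} {e : ℤ} {t : Fin p → ℚ}
    (hk : (montesinos e t).IsKnot) (he : epsilon e t = -1) {i j : Fin p} (hij : i ≠ j)
    (hi : ∀ n : ℤ, (t i)⁻¹ ≠ n) (hj : ∀ n : ℤ, (t j)⁻¹ ≠ n)
    (h : hat (t j) ≤ |flypeParam (hat (t i))|) : IsTQA (montesinos e t).link := by
  obtain ⟨A, a, b, hA, eA, hf⟩ := ratTangle_of_not_int hi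
  obtain ⟨A', a', b', hA', eA', hf'⟩ := ratTangle_of_not_int hj
  -- The hypothesis says that the two fractional parts add up to at least `1`. This is symmetric in
  -- the two tangles, so their order in the list does not matter.
  have hab : b * b' ≤ a * a' := by
    obtain ⟨h1, h2⟩ := hA.pos
    obtain ⟨h1', h2'⟩ := hA'.pos
    rw [(abs_flypeParam_hat h1 h2 hf).2, (abs_flypeParam_hat h1' h2' hf').1,
      div_le_div_iff₀ (by positivity) (by positivity)] at h
    have : (b : ℚ) * b' ≤ a * a' := by linarith
    exact_mod_cast this
  have hD := montesinos_word e t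
  rw [epsilon_eq] at he
  rcases lt_or_gt_of_ne hij with hij | hij
  · obtain ⟨l₁, l₂, l₃, hl⟩ := exists_ofFn_eq t hij
    rw [hl] at hD he
    exact isTQA_of_add_eq_neg_one hk hD hA hA' eA eA' hab he
  · obtain ⟨l₁, l₂, l₃, hl⟩ := exists_ofFn_eq t hij
    rw [hl] at hD he
    exact isTQA_of_add_eq_neg_one hk hD hA' hA eA' eA (by linarith) he

theorem isTQA_montesinos_of_eq_one_sub {p : ℕ} {e : ℤ} {t : Fin p → ℚ}
    (hk : (montesinos e t).IsKnot) (he : epsilon e t = 1 - (p : ℤ)) {i j : Fin p} (hij : i ≠ j)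
    (hi : ∀ n : ℤ, (t i)⁻¹ ≠ n) (hj : ∀ n : ℤ, (t j)⁻¹ ≠ n)
    (h : |flypeParam (hat (t i))| ≤ hat (t j)) : IsTQA (montesinos e t).link := by
  obtain ⟨A, a, b, hA, eA, hf⟩ := ratTangle_of_not_int hi
  obtain ⟨A', a', b', hA', eA', hf'⟩ := ratTangle_of_not_int hj
  have hab : a * a' ≤ b * b' := by
    obtain ⟨h1, h2⟩ := hA.pos
    obtain ⟨h1', h2'⟩ := hA'.pos
    rw [(abs_flypeParam_hat h1 h2 hf).2, (abs_flypeParam_hat h1' h2' hf').1,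
      div_le_div_iff₀ (by positivity) (by positivity)] at h
    have : (a : ℚ) * a' ≤ b * b' := by linarith
    exact_mod_cast this
  have hD := montesinos_word e t
  have hlen : (p : ℤ) = (List.ofFn t).length := by simp
  rw [epsilon_eq] at he
  replace he := he.trans (congrArg (1 - ·) hlen)
  rcases lt_or_gt_of_ne hij with hij | hij
  · obtain ⟨l₁, l₂, l₃, hl⟩ := exists_ofFn_eq t hij
    rw [hl] at hD he
    exact isTQA_of_add_eq_one_sub hk hD hA hA' eA eA' hab he
  · obtain ⟨l₁, l₂, l₃, hl⟩ := exists_ofFn_eq t hij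
    rw [hl] at hD he
    exact isTQA_of_add_eq_one_sub hk hD hA' hA eA' eA (by linarith) he

end TwoFold

open TwoFold

theorem proposition6p1 {p : ℕ} (e : ℤ) (t : Fin p → ℚ) (ht : ∀ i, t i ≠ 0)
    (hknot : (montesinos e t).IsKnot)
    (h : (-1 < epsilon e t ∨ epsilon e t < 1 - (p : ℤ)) ∨
      (epsilon e t = -1 ∧ ∃ i j : Fin p, i ≠ j ∧
        (∀ n : ℤ, (t i)⁻¹ ≠ n) ∧ (∀ n : ℤ, (t j)⁻¹ ≠ n) ∧
        hat (t j) ≤ |flypeParam (hat (t i))|) ∨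
      (epsilon e t = 1 - (p : ℤ) ∧ ∃ i j : Fin p, i ≠ j ∧
        (∀ n : ℤ, (t i)⁻¹ ≠ n) ∧ (∀ n : ℤ, (t j)⁻¹ ≠ n) ∧
        |flypeParam (hat (t i))| ≤ hat (t j))) :
    (montesinos e t).IsTQALink := by
  refine ⟨dotCount_montesinos e t, ?_⟩
  rcases h with h | ⟨he, i, j, hij, hi, hj, h⟩ | ⟨he, i, j, hij, hi, hj, h⟩
  · refine isTQA_of_nonneg hknot (montesinos_word e t) ?_
    -- Over the integers, `ε > -1` is `0 ≤ ε` and `ε < 1 - p` is `ε + p ≤ 0`.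
    rw [← epsilon_eq, List.length_ofFn]
    omega
  · exact isTQA_montesinos_of_eq_neg_one hknot he hij hi hj h
  · exact isTQA_montesinos_of_eq_one_sub hknot he hij hi hj h
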